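/- **Corollary 4.1 (Riccati / fractional Fokker–Planck with odd drift).** Let $0<\beta\le 1$, let $b\neq 0$, $\gamma$, $v$ be real constants, and let $f$ be an odd real function, differentiable on $\mathbb R\setminus\{0\}$, which satisfies for all $x\ne0$ the Riccati equation $$2f'(x)-f(x)^2+b^2x^2-\gamma+\frac{16v^2-1}{x^2}=0 .$$ Let $\Phi=\int f(x)\,dx$ be any antiderivative of $f$ on $\mathbb R\setminus\{0\}$. For $z>0$ and real $a$ put $$I_a(z)=\sum_{m\ge0}\frac{(z/2)^{2m+a}}{m!\,\Gamma(m+a+1)},\qquad K_a(z)=\frac{\pi}{2}\,\frac{I_{-a}(z)-I_a(z)}{\sin(a\pi)}$$ (for integer $a$, $K_a$ is the limit of this quotient in the order). Let $A_1,A_2,B_1,B_2$ be arbitrary quantities independent of $x$ and $t$, which may depend on the source point $y>0$. For $x\neq0$, $t>0$, $y>0$ define $$p(x,t|y)=F\!\left(\frac{x}{\sqrt{4\sinh^2(bt)}}\right)\frac{e^{\gamma t/4}}{(4\sinh^2(bt))^{1/4}}\exp\!\left[-\Big(\frac b4\coth(bt)\,x^2+\frac12\Phi(x)\Big)+\frac{y^2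 b}{2(1-e^{2bt})}\right],$$ where, with $k=|b|y$, $$F(z)=\begin{cases} z^{1/2}\,[A_1I_{2v}(kz)+A_2I_{-2v}(kz)], & z>0,\\ |z|^{1/2}\,[B_1K_{2v}(k|z|)+B_2I_{2v}(k|z|)], & z<0.\end{cases}$$ Let $\varphi:(0,\infty)\to\mathbb R$ be $C^2$, let $A_1,A_2,B_1,B_2$ be $C^2$ functions of $y\in(0,\infty)$, and suppose that for some $N\in\mathbb N$ the functions $y^{2v}A_1\varphi$, $y^{-2v}A_2\varphi$, $y^{-2|v|}(1+|\log y|)B_1\varphi$ and $y^{2v}B_2\varphi$ are integrable on $(0,\infty)$ with respect to $(1+y)^{-N}dy$. Put $$u(x,t)=\int_0^\infty p(x,t|y)\,\varphi(y)\,dy,\qquad u_\beta(x,t)=\int_0^\infty u(x,s)\,g_\beta(s;t)\,ds ,$$ where $g_\beta(s;t)=t^{-\beta}W_{-\beta,1-\beta}(-s\,t^{-\beta})$ with the Wright function $W_{\lambda,\mu}(z)=\sum_{k\ge0}\frac{z^k}{k!\,\Gamma(\lambda k+\mu)}$ if $\beta<1$, and $g_1(\cdot\,;t)=\delta_t$,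 that is, $u_1=u$. Then, for all $x\ne0$ and $t>0$: 1. The integrals defining $u$ and $u_\beta$ converge absolutely, and for $\beta<1$ the series defining $g_\beta(s;t)$ converges for every real $s$. 2. $u_\beta$ is a classical solution of the fractional Fokker–Planck equation $$ {}_CD_t^\beta u_\beta=\frac{\partial^2u_\beta}{\partial x^2}+\frac{\partial}{\partial x}\big[f(x)\,u_\beta\big],$$ where ${}_CD_t^\beta h(t)=\frac1{\Gamma(1-\beta)}\int_0^t(t-\tau)^{-\beta}h'(\tau)\,d\tau$ is the Caputo derivative (an absolutely convergent integral) for $\beta<1$, and ${}_CD_t^1h=h'$. (For $\beta=1$ this says that $u$ solves the ordinary Fokker–Planck equation.) 3. If $A_1(y)+A_2(y)=|b|\sqrt y\,e^{\Phi(y)/2-by^2/4}$ for all $y>0$, then $\lim_{t\to0^+}u_\beta(x,t)=\varphi(x)$ for all $x>0$; if $B_2=0$, then $\lim_{t\to0^+}u_\beta(x,t)=0$ for all $x<0$. (So under both conditions $p(\cdot,0|y)=\delta_y$ on $\mathbb R\setminus\{0\}$ in this sense.) -/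

import Mathlib

open Real Set MeasureTheory Filter Topology

noncomputable section

namespace RiccatiFP

/-- The Wright function `W_{l,m}(z) = ∑ₖ zᵏ / (k! Γ(l k + m))` for real arguments (`l > -1`).
At the poles of `Γ` Mathlib's value is `0`, so the corresponding term vanishes, as it should. -/
def wright (l m z : ℝ) : ℝ :=
  ∑' k : ℕ, z ^ k / ((k.factorial : ℝ) * Real.Gamma (l * k + m))

/-- The density `g_β(s; t) = t^{-β} W_{-β, 1-β}(-s / t^β)`, for `0 < β < 1`. -/
def wrightDensity (β s t : ℝ) : ℝ :=
  1 / t ^ β * wright (-β) (1 - β) (-(s / t ^ β))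

/-- The Wright-type transform `h_β(t) = ∫₀^∞ h(s) g_β(s; t) ds`; for `β = 1` the density
degenerates to the point mass at `t`, and the transform is the identity. -/
def wrightTransform (β : ℝ) (h : ℝ → ℝ) (t : ℝ) : ℝ :=
  if β = 1 then h t else ∫ s in Ioi (0 : ℝ), h s * wrightDensity β s t

/-- The Caputo derivative of order `0 < β ≤ 1` (based at `0`) of `h` at `t` exists and equals `d`:
`h` is differentiable on `(0, t]`, and either `β = 1` and `d = h'(t)`, or `β < 1`, the integral
below converges absolutely and `d = Γ(1-β)⁻¹ ∫₀ᵗ (t-τ)^{-β} h'(τ) dτ`. -/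
def HasCaputoDerivAt (β : ℝ) (h : ℝ → ℝ) (d t : ℝ) : Prop :=
  (∀ τ ∈ Ioc 0 t, DifferentiableAt ℝ h τ) ∧
    ((β = 1 ∧ d = deriv h t) ∨
      (β < 1 ∧ IntervalIntegrable (fun τ => (t - τ) ^ (-β) * deriv h τ) volume 0 t ∧
        d = 1 / Real.Gamma (1 - β) * ∫ τ in (0 : ℝ)..t, (t - τ) ^ (-β) * deriv h τ))

/-- `u` solves `_C D_t^β u = u_xx + (f u)_x` classically at all `x ≠ 0`, `t > 0`. -/
def SolvesFractionalFokkerPlanck (β : ℝ) (f : ℝ → ℝ) (u : ℝ → ℝ → ℝ) : Prop :=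
  ∀ x t : ℝ, x ≠ 0 → 0 < t →
    ContDiffAt ℝ 2 (fun ξ => u ξ t) x ∧
    DifferentiableAt ℝ (fun ξ => f ξ * u ξ t) x ∧
    HasCaputoDerivAt β (fun τ => u x τ)
      (iteratedDeriv 2 (fun ξ => u ξ t) x + deriv (fun ξ => f ξ * u ξ t) x) t

/-- The modified Bessel function `I_a(z) = ∑ₘ (z/2)^{2m+a} / (m! Γ(m+a+1))`, for `z > 0`. -/
def besselI (a z : ℝ) : ℝ :=
  ∑' m : ℕ, (z / 2) ^ (2 * (m : ℝ) + a) / ((m.factorial : ℝ) * Real.Gamma (m + a + 1))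

/-- The quotient `(π/2) (I_{-a}(z) - I_a(z)) / sin(a π)`. -/
def besselKQuot (a z : ℝ) : ℝ :=
  π / 2 * ((besselI (-a) z - besselI a z) / Real.sin (a * π))

/-- The modified Bessel function `K_a(z)`, for `z > 0`: the quotient above if `a` is not an
integer, and its limit in the order if `a` is an integer. -/
def besselK (a z : ℝ) : ℝ :=
  if Real.sin (a * π) ≠ 0 then besselKQuot a z
  else limUnder (𝓝[≠] a) (fun μ => besselKQuot μ z)

/-- The profile `F(z)` with parameters `v`, `k` and constants `a₁, a₂, b₁, b₂`. -/
def profile (v k a₁ a₂ b₁ b₂ z : ℝ) : ℝ :=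
  if 0 < z then z ^ (1 / 2 : ℝ) * (a₁ * besselI (2 * v) (k * z) + a₂ * besselI (-(2 * v)) (k * z))
  else |z| ^ (1 / 2 : ℝ) * (b₁ * besselK (2 * v) (k * |z|) + b₂ * besselI (2 * v) (k * |z|))

/-- The kernel `p(x, t | y)`, `y > 0`. Here `b` is the constant of the Riccati equation, `Φ` is an
antiderivative of the drift, and the constants `A₁, A₂, B₁, B₂` may depend on the source point
`y`. The argument `k` of the Bessel functions is `|b| y`, which is `b y` if `b > 0`. -/
def kernel (b γ v : ℝ) (Φ A₁ A₂ B₁ B₂ : ℝ → ℝ) (x t y : ℝ) : ℝ :=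
  profile v (|b| * y) (A₁ y) (A₂ y) (B₁ y) (B₂ y) (x / √(4 * Real.sinh (b * t) ^ 2)) *
    (Real.exp (γ * t / 4) / (4 * Real.sinh (b * t) ^ 2) ^ (1 / 4 : ℝ)) *
    Real.exp (-(b / 4 * (Real.cosh (b * t) / Real.sinh (b * t)) * x ^ 2 + 1 / 2 * Φ x)
      + y ^ 2 * b / (2 * (1 - Real.exp (2 * b * t))))

/-- The function `u(x, t) = ∫₀^∞ p(x, t | y) φ(y) dy`. -/
def kernelIntegral (b γ v : ℝ) (Φ A₁ A₂ B₁ B₂ φ : ℝ → ℝ) (x t : ℝ) : ℝ :=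
  ∫ y in Ioi (0 : ℝ), kernel b γ v Φ A₁ A₂ B₁ B₂ x t y * φ y

end RiccatiFP

end

noncomputable section

namespace RiccatiFP

/-! Write u = e^{-Φ/2} w. Then u_xx + (f u)_x = e^{-Φ/2} (w_xx + V w) with V = f'/2 - f²/4, and the
Riccati equation says exactly that V(x) = γ/4 - b²x²/4 - κ/x² with κ = 4v² - 1/4. The drift has
disappeared, and the same even potential governs both half-lines. In the variables X = r e^{bt}, T =
(e^{2bt} - 1)/(2b), and after a Gaussian gauge factor, w_t = w_rr + V w becomes the Bessel heat
equation K_T = K_XX - (κ/X²) K.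

Up to explicit factors the kernel p is the Bessel heat kernel (2T)^{-1/2} g(Xy/2T) e^{-(X²+y²)/4T}
(`kernel_factor_eq`), where g(z) is √z I_{±2v}(z) or √z K_{2v}(z). What matters about g is collected
in `BesselProfile`: it solves g'' = (1 + κ/z²) g, it is bounded by a submultiplicative weight ρ
times a polynomial times e^z, and g(z) e^{-z} has a limit L at infinity. For I of any order L =
(2π)^{-1/2}; for K it is 0.

The growth e^{Xy/2T} completes the square in the exponent, so the kernel and its derivatives are
dominated by ρ(y) (1+y)^{-N} e^{-(X-y)²/8T}, with constants polynomial in X, 1/X, T, 1/T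
(`BesselProfile.heat_bounds`). This yields convergence and differentiation under the integral. As T
→ 0, Laplace's method gives the initial value √(2π) L α(X) (`BesselProfile.tendsto_heatInt`), and
integration by parts against a C² density keeps the derivatives bounded
(`BesselProfile.small_time_bounds`). Hence w, w_x and w_xx grow at most exponentially in time and
are bounded down to t = 0, locally uniformly in space.

For β < 1 put M(σ) = W_{-β,1-β}(-σ); the density is t^{-β} M(t^{-β} s). Two facts carry the
subordination. A Hankel contour shows that M decays faster than every exponential
(`wright_exp_decay`). A convolution identity, proved by comparing Mellin transforms, shows that
fractional integration of the time derivative reproduces the density (`integral_caputoKernel`). So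
the Caputo derivative of the transform of h is the transform of h' whenever h and h' grow at most
exponentially (`hasCaputoDerivAt_wrightTransform`), space derivatives pass under the integral, and ∫
M = 1 transfers the initial value. -/

/-! ### Gamma integrals along rays -/

lemma integrableOn_rpow_mul_exp_neg {a r : ℝ} (ha : 0 < a) (hr : 0 < r) :
    IntegrableOn (fun t : ℝ => t ^ (a - 1) * Real.exp (-(r * t))) (Ioi 0) := by
  have h := integrableOn_rpow_mul_exp_neg_mul_rpow (p := 1) (s := a - 1) (b := r) (by linarith)
    one_pos hr
  refine h.congr_fun (fun t _ => ?_) measurableSet_Ioi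
  simp

lemma norm_cexp_neg_mul (r : ℂ) (t : ℝ) :
    ‖Complex.exp (-(r * t))‖ = Real.exp (-(r.re * t)) := by
  rw [Complex.norm_exp]; simp

/-- The Gamma integral with complex rate. -/
lemma integral_rpow_mul_cexp {a : ℝ} (ha : 0 < a) {r : ℂ} (hr : 0 < r.re) :
    ∫ t in Ioi (0 : ℝ), ((t ^ (a - 1) : ℝ) : ℂ) * Complex.exp (-(r * t))
      = (1 / r) ^ (a : ℂ) * Complex.Gamma a := by
  set U : Set ℂ := {z | 0 < z.re} with hU
  have hUo : IsOpen U := isOpen_lt continuous_const Complex.continuous_re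
  have hUc : IsPreconnected U := (convex_halfSpace_re_gt 0).isPreconnected
  set F : ℂ → ℂ := fun r => ∫ t in Ioi (0 : ℝ), ((t ^ (a - 1) : ℝ) : ℂ) * Complex.exp (-(r * t))
  have hmeas : ∀ z : ℂ, AEStronglyMeasurable
      (fun t : ℝ => ((t ^ (a - 1) : ℝ) : ℂ) * Complex.exp (-(z * t))) (volume.restrict (Ioi 0)) := by
    intro z
    apply Measurable.aestronglyMeasurable
    fun_prop
  have hF : DifferentiableOn ℂ F U := by
    intro z hz
    have hz' : 0 < z.re := hz
    refine DifferentiableAt.differentiableWithinAt ?_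
    have := hasDerivAt_integral_of_dominated_loc_of_deriv_le (μ := volume.restrict (Ioi (0:ℝ)))
      (F := fun (r : ℂ) (t : ℝ) => ((t ^ (a - 1) : ℝ) : ℂ) * Complex.exp (-(r * t)))
      (F' := fun (r : ℂ) (t : ℝ) => ((t ^ (a - 1) : ℝ) : ℂ) * (Complex.exp (-(r * t)) * (-t)))
      (x₀ := z) (s := {w | z.re / 2 < w.re})
      (bound := fun t => t ^ ((a + 1) - 1) * Real.exp (-(z.re / 2 * t)))
      ((isOpen_lt continuous_const Complex.continuous_re).mem_nhds (by simp; linarith))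
      (Eventually.of_forall hmeas) ?_ ?_ ?_
      (integrableOn_rpow_mul_exp_neg (by linarith) (by linarith)) ?_
    · exact this.2.differentiableAt
    · refine (integrableOn_rpow_mul_exp_neg ha hz').mono' (hmeas z) ?_
      refine (ae_restrict_mem measurableSet_Ioi).mono fun t ht => ?_
      have ht' : (0 : ℝ) < t := ht
      rw [norm_mul, norm_cexp_neg_mul, Complex.norm_real, Real.norm_of_nonneg (by positivity)]
    · apply Measurable.aestronglyMeasurable
      fun_prop
    · refine (ae_restrict_mem measurableSet_Ioi).mono fun t ht w hw => ?_
      have ht' : (0 : ℝ) < t := ht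
      have hw' : z.re / 2 < w.re := hw
      rw [norm_mul, norm_mul, norm_cexp_neg_mul, Complex.norm_real, norm_neg, Complex.norm_real,
        Real.norm_of_nonneg (by positivity), Real.norm_of_nonneg ht'.le]
      have : t ^ (a + 1 - 1) = t ^ (a - 1) * t := by
        rw [← Real.rpow_add_one ht'.ne']; ring_nf
      rw [this, mul_assoc, mul_comm t]
      gcongr
    · refine Eventually.of_forall fun t w _ => ?_
      refine HasDerivAt.const_mul _ ?_
      have : HasDerivAt (fun w : ℂ => -(w * (t:ℂ))) (-(t:ℂ)) w := by
        simpa using ((hasDerivAt_id w).mul_const (t:ℂ)).fun_neg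
      exact this.cexp
  have hG : DifferentiableOn ℂ (fun r : ℂ => (1 / r) ^ (a : ℂ) * Complex.Gamma a) U := by
    intro z hz
    have hz' : 0 < z.re := hz
    have hz0 : z ≠ 0 := fun h => by simp [h] at hz'
    refine DifferentiableAt.differentiableWithinAt ?_
    refine DifferentiableAt.mul_const ?_ _
    refine DifferentiableAt.cpow_const (c := (a:ℂ)) (by fun_prop (disch := assumption)) ?_
    left
    rw [one_div, Complex.inv_re]
    exact div_pos hz' (Complex.normSq_pos.2 hz0)
  -- Identity theorem: both sides are holomorphic in the right half-plane and agree at the positive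
  -- reals, which accumulate at 1.
  have key := (hF.analyticOnNhd hUo).eqOn_of_preconnected_of_frequently_eq (hG.analyticOnNhd hUo)
    hUc (z₀ := 1) (by simp [hU]) ?_
  · exact key hr
  have hreal : ∀ x : ℝ, 0 < x → F x = (1 / (x:ℂ)) ^ (a : ℂ) * Complex.Gamma a := by
    intro x hx
    rw [← Complex.integral_cpow_mul_exp_neg_mul_Ioi (a := a) (r := x) (by simpa) hx]
    refine setIntegral_congr_fun measurableSet_Ioi fun t ht => ?_
    have ht' : (0 : ℝ) < t := ht
    rw [Complex.ofReal_cpow ht'.le]; push_cast; rfl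
  have h1 : ∃ᶠ x : ℝ in 𝓝[≠] 1, F x = (1 / (x:ℂ)) ^ (a : ℂ) * Complex.Gamma a := by
    refine Eventually.frequently ?_
    filter_upwards [nhdsWithin_le_nhds (Ioi_mem_nhds one_pos)] with x hx using hreal x hx
  have h2 : Tendsto (fun x : ℝ => (x : ℂ)) (𝓝[≠] 1) (𝓝[≠] 1) := by
    refine tendsto_nhdsWithin_of_tendsto_nhds_of_eventually_within _ ?_ ?_
    · exact (Complex.continuous_ofReal.tendsto' 1 1 (by simp)).mono_left nhdsWithin_le_nhds
    · filter_upwards [self_mem_nhdsWithin] with x hx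
      simpa using hx
  exact h2.frequently h1

/-- The reflection formula without division by the sine, so that it also covers p = 1, 2, …, where
both sides are 0. -/
lemma inv_Gamma_one_sub (p : ℝ) (hp : 0 < p) :
    (Real.Gamma (1 - p))⁻¹ = 1 / π * (Real.Gamma p * Real.sin (π * p)) := by
  have h := Real.Gamma_mul_Gamma_one_sub p
  have hΓ := (Real.Gamma_pos_of_pos hp).ne'
  by_cases hs : Real.sin (π * p) = 0
  -- Here π / 0 = 0, and Γ(p) ≠ 0 forces the default value Γ(1 - p) = 0.
  · rw [hs, div_zero] at h
    have : Real.Gamma (1 - p) = 0 := (mul_eq_zero.1 h).resolve_left hΓ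
    simp [this, hs]
  · have hG : Real.Gamma (1 - p) = π / Real.sin (π * p) / Real.Gamma p := by
      rw [← h]; field_simp
    rw [hG]; field_simp

/-- The rate r = -e^{iθ} has positive real part for π/2 < θ < π, and (1/r)^p = e^{ip(π-θ)}. The
phase e^{ipθ} turns this into e^{ipπ}, independently of the ray. -/
lemma integral_ray (p θ : ℝ) (hp : 0 < p) (h1 : π / 2 < θ) (h2 : θ < π) :
    ∫ t in Ioi (0 : ℝ), ((t ^ (p - 1) : ℝ) : ℂ) *
        Complex.exp (t * Complex.exp (θ * Complex.I) + p * θ * Complex.I)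
      = Real.Gamma p * Complex.exp (p * π * Complex.I) := by
  set r : ℂ := Complex.exp (((θ - π : ℝ) : ℂ) * Complex.I) with hrdef
  have hr : r = - Complex.exp (θ * Complex.I) := by
    rw [hrdef]; push_cast; rw [sub_mul, Complex.exp_sub, Complex.exp_pi_mul_I, div_neg, div_one]
  have hre : 0 < r.re := by
    rw [hrdef, Complex.exp_ofReal_mul_I_re]
    exact Real.cos_pos_of_mem_Ioo ⟨by linarith, by linarith⟩
  have hinv : 1 / r = Complex.exp (((π - θ : ℝ) : ℂ) * Complex.I) := by
    rw [hrdef, one_div, ← Complex.exp_neg]; push_cast; ring_nf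
  have hpow : (1 / r) ^ (p : ℂ) = Complex.exp (p * (π - θ) * Complex.I) := by
    rw [hinv, Complex.cpow_def_of_ne_zero (Complex.exp_ne_zero _), Complex.log_exp]
    · push_cast; ring_nf
    · simp; linarith
    · simp; linarith
  have := integral_rpow_mul_cexp hp hre
  rw [hpow] at this
  calc _ = ∫ t in Ioi (0 : ℝ), (((t ^ (p - 1) : ℝ) : ℂ) * Complex.exp (-(r * t))) *
        Complex.exp (p * θ * Complex.I) := by
        refine setIntegral_congr_fun measurableSet_Ioi fun t _ => ?_
        rw [mul_assoc _ (Complex.exp _) (Complex.exp _), ← Complex.exp_add, hr]; ring_nf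
    _ = _ := by
        rw [integral_mul_const, this, Complex.Gamma_ofReal, mul_right_comm, ← Complex.exp_add,
          mul_comm]
        ring_nf

/-- The imaginary part Γ(p) sin(πp) is a reciprocal Gamma value; this is how the coefficients of the
Wright series arise from ray integrals. -/
lemma im_integral_ray (p θ : ℝ) (hp : 0 < p) (h1 : π / 2 < θ) (h2 : θ < π) :
    (∫ t in Ioi (0 : ℝ), ((t ^ (p - 1) : ℝ) : ℂ) *
        Complex.exp (t * Complex.exp (θ * Complex.I) + p * θ * Complex.I)).im
      = π * (Real.Gamma (1 - p))⁻¹ := by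
  rw [integral_ray p θ hp h1 h2, inv_Gamma_one_sub p hp, Complex.im_ofReal_mul]
  have : Complex.exp (p * π * Complex.I) = Complex.exp (((π * p : ℝ) : ℂ) * Complex.I) := by
    push_cast; ring_nf
  rw [this, Complex.exp_ofReal_mul_I_im]
  field_simp

/-! ### The Wright series -/

/-- Ratio test. Log-convexity of Γ at s + β = (1-β)s + β(s+1) gives Γ(s+β) ≤ s^β Γ(s), so the ratio
is at most x (k+1)^{β-1}, which tends to 0 because β < 1. -/
lemma summable_Gamma_div_factorial {β : ℝ} (h0 : 0 < β) (h1 : β < 1) (x : ℝ) (hx : 0 < x) :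
    Summable fun k : ℕ => x ^ k * Real.Gamma (β * (k + 1)) / (k.factorial : ℝ) := by
  have hpos : ∀ k : ℕ, 0 < β * ((k:ℝ) + 1) := fun k => by positivity
  have hlim : Tendsto (fun k : ℕ => x * ((k : ℝ) + 1) ^ (-(1 - β))) atTop (𝓝 0) := by
    have h : Tendsto (fun k : ℕ => ((k : ℝ) + 1)) atTop atTop :=
      tendsto_atTop_add_const_right _ _ tendsto_natCast_atTop_atTop
    simpa using ((tendsto_rpow_neg_atTop (by linarith : 0 < 1 - β)).comp h).const_mul x
  have hev : ∀ᶠ k : ℕ in atTop, x * ((k : ℝ) + 1) ^ (-(1 - β)) ≤ 1 / 2 :=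
    hlim.eventually_le_const (by norm_num)
  refine summable_of_ratio_norm_eventually_le (r := 1 / 2) (by norm_num) ?_
  filter_upwards [hev] with k hk
  have hs := hpos k
  have hΓ : Real.Gamma (β * (k + 1 + 1)) ≤ Real.Gamma (β * (k + 1)) * (k + 1) ^ β := by
    have := Real.Gamma_mul_add_mul_le_rpow_Gamma_mul_rpow_Gamma (s := β * ((k:ℝ) + 1))
      (t := β * ((k:ℝ) + 1) + 1) (a := 1 - β) (b := β) hs (by linarith) (by linarith) h0 (by ring)
    have hg := Real.Gamma_pos_of_pos hs
    have e : Real.Gamma (β * (k + 1)) ^ (1 - β) * ((β * (k + 1)) ^ β * Real.Gamma (β * (k + 1)) ^ β)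
        = (β * (k + 1)) ^ β * Real.Gamma (β * (k + 1)) := by
      rw [mul_left_comm, ← Real.rpow_add hg, sub_add_cancel, Real.rpow_one]
    rw [Real.Gamma_add_one hs.ne', Real.mul_rpow hs.le hg.le, e] at this
    calc Real.Gamma (β * (k + 1 + 1))
        = Real.Gamma ((1 - β) * (β * (k + 1)) + β * (β * (k + 1) + 1)) := by ring_nf
      _ ≤ _ := this
      _ ≤ ((k:ℝ) + 1) ^ β * Real.Gamma (β * (k + 1)) := by
        have hG := (Real.Gamma_pos_of_pos hs).le
        gcongr
        nlinarith
      _ = _ := mul_comm _ _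
  have hG := (Real.Gamma_pos_of_pos hs).le
  have hG2 := (Real.Gamma_pos_of_pos (hpos (k + 1))).le
  rw [Real.norm_of_nonneg (by positivity), Real.norm_of_nonneg (by positivity)]
  push_cast
  calc x ^ (k + 1) * Real.Gamma (β * (k + 1 + 1)) / ((k + 1).factorial : ℝ)
      ≤ x ^ (k + 1) * (Real.Gamma (β * (k + 1)) * (k + 1) ^ β) / ((k + 1).factorial : ℝ) := by gcongr
    _ = (x * ((k : ℝ) + 1) ^ (-(1 - β))) * (x ^ k * Real.Gamma (β * (k + 1)) / (k.factorial : ℝ)) := by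
      have hk1 : (0:ℝ) < (k:ℝ) + 1 := by positivity
      rw [Nat.factorial_succ, neg_sub, Real.rpow_sub hk1, Real.rpow_one]
      push_cast
      field_simp
      ring
    _ ≤ _ := by gcongr

lemma inv_Gamma_wright {β : ℝ} (h0 : 0 < β) (k : ℕ) :
    (Real.Gamma (-β * k + (1 - β)))⁻¹
      = 1 / π * (Real.Gamma (β * (k + 1)) * Real.sin (π * (β * (k + 1)))) := by
  rw [← inv_Gamma_one_sub _ (by positivity)]; ring_nf

lemma summable_wright {β : ℝ} (h0 : 0 < β) (h1 : β < 1) (z : ℝ) :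
    Summable fun k : ℕ => z ^ k / ((k.factorial : ℝ) * Real.Gamma (-β * k + (1 - β))) := by
  refine ((summable_Gamma_div_factorial h0 h1 (|z| + 1) (by positivity)).mul_left (1/π)).of_norm_bounded
    fun k => ?_
  have hG := (Real.Gamma_pos_of_pos (show 0 < β * ((k:ℝ)+1) by positivity)).le
  rw [div_eq_mul_inv, mul_inv, inv_Gamma_wright h0, norm_mul, norm_mul, norm_mul, norm_mul,
    norm_pow, Real.norm_eq_abs, Real.norm_of_nonneg (by positivity : (0:ℝ) ≤ 1/π), Real.norm_of_nonneg hG,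
    Real.norm_of_nonneg (by positivity : (0:ℝ) ≤ (k.factorial : ℝ)⁻¹)]
  calc |z| ^ k * ((k.factorial : ℝ)⁻¹ * (1 / π * (Real.Gamma (β * (k + 1)) * ‖Real.sin (π * (β * (k + 1)))‖)))
     ≤ (|z| + 1) ^ k * ((k.factorial : ℝ)⁻¹ * (1 / π * (Real.Gamma (β * (k + 1)) * 1))) := by
        gcongr
        · linarith
        · exact Real.abs_sin_le_one _
    _ = _ := by field_simp

lemma continuous_wright {β : ℝ} (h0 : 0 < β) (h1 : β < 1) : Continuous (wright (-β) (1 - β)) := by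
  rw [continuous_iff_continuousAt]
  intro z
  have hs := (summable_wright h0 h1 (|z| + 1)).norm
  have : ContinuousOn (wright (-β) (1 - β)) (Ioo (-(|z| + 1)) (|z| + 1)) := by
    unfold wright
    refine continuousOn_tsum (fun k => by fun_prop) hs fun k x hx => ?_
    have hx' : |x| ≤ |z| + 1 := (abs_lt.2 hx).le
    rw [norm_div, norm_div, norm_pow, norm_pow]
    gcongr
    rw [Real.norm_eq_abs, Real.norm_eq_abs, abs_of_nonneg (by positivity : 0 ≤ |z| + 1)]
    exact hx'
  refine this.continuousAt (Ioo_mem_nhds ?_ ?_)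
  · linarith [neg_abs_le z]
  · linarith [le_abs_self z]

/-! ### The Wright function along a ray and its decay -/

/-- The integrand of the representation of the Wright function along a ray. -/
def rayKernel (β θ σ r : ℝ) : ℂ :=
  ((r ^ (β - 1) : ℝ) : ℂ) * Complex.exp (r * Complex.exp (θ * Complex.I)
    - σ * ((r ^ β : ℝ) : ℂ) * Complex.exp (β * θ * Complex.I) + β * θ * Complex.I)

/-- Expand exp(-σ r^β e^{iβθ}) and integrate term by term: the k-th term is a ray integral with p =
β(k+1), whose imaginary part is π / Γ(1 - β(k+1)). -/
lemma wright_eq_ray {β θ : ℝ} (h0 : 0 < β) (h1 : β < 1) (hθ : π / 2 < θ) (hθ' : θ < π) (σ : ℝ) :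
    wright (-β) (1 - β) (-σ) = 1 / π * (∫ r in Ioi (0 : ℝ), rayKernel β θ σ r).im := by
  have hcos : 0 < -Real.cos θ := by
    have := Real.cos_neg_of_pi_div_two_lt_of_lt hθ (by linarith [Real.pi_pos]); linarith
  set F : ℕ → ℝ → ℂ := fun k t => ((-σ) ^ k / (k.factorial : ℂ)) *
    (((t ^ (β * (k + 1) - 1) : ℝ) : ℂ) *
        Complex.exp (t * Complex.exp (θ * Complex.I) + ((β * (k + 1) : ℝ) : ℂ) * θ * Complex.I)) with hF
  have hp : ∀ k : ℕ, 0 < β * ((k:ℝ) + 1) := fun k => by positivity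
  have hnorm : ∀ (k : ℕ) (t : ℝ), t ∈ Ioi (0:ℝ) → ‖F k t‖ = |σ| ^ k / (k.factorial : ℝ) *
      (t ^ (β * (k + 1) - 1) * Real.exp (-(-Real.cos θ * t))) := by
    intro k t ht
    have ht' : (0:ℝ) < t := ht
    simp only [hF]
    rw [norm_mul, norm_mul, Complex.norm_exp, norm_div, norm_pow, norm_neg, Complex.norm_real,
      Complex.norm_real, Complex.norm_natCast, Real.norm_eq_abs,
      Real.norm_of_nonneg (by positivity : 0 ≤ t ^ (β * ((k:ℝ) + 1) - 1))]
    congr 3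
    have : t * Complex.exp (θ * Complex.I) + ((β * (k + 1) : ℝ) : ℂ) * θ * Complex.I
      = t * Complex.exp (θ * Complex.I) + ((β * (k + 1) * θ : ℝ) : ℂ) * Complex.I := by
      push_cast; ring
    rw [this, Complex.add_re, Complex.re_ofReal_mul, Complex.exp_ofReal_mul_I_re]
    simp; ring
  have hint : ∀ k : ℕ, IntegrableOn (F k) (Ioi 0) := by
    intro k
    refine ((integrableOn_rpow_mul_exp_neg (hp k) hcos).const_mul
      (|σ| ^ k / (k.factorial : ℝ))).mono' ?_ ?_
    · apply Measurable.aestronglyMeasurable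
      fun_prop
    · exact (ae_restrict_mem measurableSet_Ioi).mono fun t ht => (hnorm k t ht).le
  have hsum : Summable fun k => ∫ t in Ioi (0:ℝ), ‖F k t‖ := by
    have : ∀ k : ℕ, ∫ t in Ioi (0:ℝ), ‖F k t‖ = |σ| ^ k / (k.factorial : ℝ) *
        ((1 / -Real.cos θ) ^ (β * ((k:ℝ) + 1)) * Real.Gamma (β * (k + 1))) := by
      intro k
      rw [setIntegral_congr_fun measurableSet_Ioi (hnorm k), integral_const_mul,
        Real.integral_rpow_mul_exp_neg_mul_Ioi (hp k) hcos]
    simp_rw [this]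
    -- The summand 1 in |σ| + 1 only keeps the base positive when σ = 0.
    have hs := (summable_Gamma_div_factorial h0 h1
      ((|σ| + 1) * (1 / -Real.cos θ) ^ β) (by positivity)).mul_left ((1 / -Real.cos θ) ^ β)
    refine hs.of_nonneg_of_le (fun k => ?_) fun k => ?_
    · have hG := (Real.Gamma_pos_of_pos (hp k)).le
      positivity
    · have hG := (Real.Gamma_pos_of_pos (hp k)).le
      rw [Real.rpow_mul (by positivity), Real.rpow_add_one (by positivity), Real.rpow_natCast, mul_pow]
      calc _ ≤ (|σ| + 1) ^ k / (k.factorial : ℝ) * (((1 / -Real.cos θ) ^ β) ^ k * (1 / -Real.cos θ) ^ β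
              * Real.Gamma (β * (k + 1))) := by
            gcongr; linarith
        _ = _ := by ring
  have h := hasSum_integral_of_summable_integral_norm hint hsum
  have hval : ∀ k : ℕ, (∫ t in Ioi (0:ℝ), F k t).im
      = π * ((-σ) ^ k / ((k.factorial : ℝ) * Real.Gamma (-β * k + (1 - β)))) := by
    intro k
    simp only [hF]
    rw [integral_const_mul]
    have e : (-(σ:ℂ)) ^ k / (k.factorial : ℂ) = (((-σ) ^ k / (k.factorial : ℝ) : ℝ) : ℂ) := by
      push_cast; rfl
    rw [e, Complex.im_ofReal_mul, im_integral_ray _ _ (hp k) hθ hθ']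
    have : 1 - β * ((k:ℝ) + 1) = -β * k + (1 - β) := by ring
    rw [this, ← div_div, div_eq_mul_inv _ (Real.Gamma _)]; ring
  have h2 := (Complex.hasSum_iff _ _).1 h |>.2
  simp_rw [hval] at h2
  have hfun : ∀ t ∈ Ioi (0:ℝ), ∑' k, F k t = rayKernel β θ σ t := by
    intro t ht
    have ht' : (0:ℝ) < t := ht
    have hterm : ∀ k, F k t = (((t ^ (β - 1) : ℝ) : ℂ) * Complex.exp (t * Complex.exp (θ * Complex.I) +
        β * θ * Complex.I)) *
        ((- (σ * ((t ^ β : ℝ) : ℂ) * Complex.exp (β * θ * Complex.I))) ^ k / (k.factorial : ℂ)) := by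
      intro k
      have e1 : t ^ (β * ((k:ℝ) + 1) - 1) = t ^ (β - 1) * (t ^ β) ^ k := by
        rw [← Real.rpow_natCast, ← Real.rpow_mul ht'.le, ← Real.rpow_add ht']; ring_nf
      have e2 : t * Complex.exp (θ * Complex.I) + ((β * (k + 1) : ℝ) : ℂ) * θ * Complex.I
          = (t * Complex.exp (θ * Complex.I) + β * θ * Complex.I) + k * (β * θ * Complex.I) := by
        push_cast; ring
      simp only [hF]
      rw [e1, e2, Complex.exp_add _ ((k:ℂ) * _), Complex.exp_nat_mul]
      push_cast
      rw [← neg_mul, ← neg_mul, mul_pow, mul_pow]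
      ring
    simp_rw [hterm]
    rw [tsum_mul_left]
    have : ∑' k : ℕ, (- (σ * ((t ^ β : ℝ) : ℂ) * Complex.exp (β * θ * Complex.I))) ^ k / (k.factorial : ℂ)
      = Complex.exp (- (σ * ((t ^ β : ℝ) : ℂ) * Complex.exp (β * θ * Complex.I))) := by
      rw [Complex.exp_eq_exp_ℂ, NormedSpace.exp_eq_tsum_div]
    rw [this, mul_assoc, ← Complex.exp_add, rayKernel]
    ring_nf
  rw [setIntegral_congr_fun measurableSet_Ioi hfun] at h2
  rw [← h2.tsum_eq, tsum_mul_left, wright]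
  field_simp

lemma norm_rayKernel {β θ σ r : ℝ} (hr : 0 < r) :
    ‖rayKernel β θ σ r‖
      = r ^ (β - 1) * Real.exp (-(-Real.cos θ * r)) * Real.exp (-(σ * Real.cos (β * θ) * r ^ β)) := by
  have e : (r * Complex.exp (θ * Complex.I) - σ * ((r ^ β : ℝ) : ℂ) * Complex.exp (β * θ * Complex.I)
      + β * θ * Complex.I) = r * Complex.exp (θ * Complex.I) - ((σ * r ^ β : ℝ) : ℂ) *
        Complex.exp ((β * θ : ℝ) * Complex.I) + ((β * θ : ℝ) : ℂ) * Complex.I := by push_cast; ring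
  rw [rayKernel, norm_mul, Complex.norm_real, Real.norm_of_nonneg (by positivity), Complex.norm_exp, e,
    mul_assoc, ← Real.exp_add]
  congr 2
  rw [Complex.add_re, Complex.sub_re, Complex.re_ofReal_mul, Complex.re_ofReal_mul,
    Complex.exp_ofReal_mul_I_re, Complex.exp_ofReal_mul_I_re]
  simp; ring

lemma measurable_rayKernel (β θ σ : ℝ) : Measurable (rayKernel β θ σ) := by
  unfold rayKernel; fun_prop

/-- The integrand of the contour integral in the logarithmic variable. -/
def hankelIntegrand (β σ : ℝ) (w : ℂ) : ℂ :=
  Complex.exp (Complex.exp w - σ * Complex.exp (β * w) + β * w)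

lemma differentiable_hankelIntegrand (β σ : ℝ) : Differentiable ℂ (hankelIntegrand β σ) := by
  unfold hankelIntegrand; fun_prop

lemma rayKernel_exp (β θ σ x : ℝ) :
    Real.exp x • rayKernel β θ σ (Real.exp x) = hankelIntegrand β σ (x + θ * Complex.I) := by
  have e : Real.exp x * Real.exp x ^ (β - 1) = Real.exp (β * x) := by
    rw [← Real.exp_mul, ← Real.exp_add]; ring_nf
  rw [rayKernel, Complex.real_smul, ← mul_assoc, ← Complex.ofReal_mul, e, Complex.ofReal_exp,
    ← Complex.exp_add, hankelIntegrand, Complex.exp_add (x:ℂ), mul_add (β:ℂ), Complex.exp_add ((β:ℂ) * x),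
    ← Real.exp_mul, mul_comm x β]
  push_cast
  ring_nf

lemma hankelIntegrand_conj (β σ x θ : ℝ) :
    hankelIntegrand β σ (x + ((-θ : ℝ) : ℂ) * Complex.I)
      = (starRingEnd ℂ) (hankelIntegrand β σ (x + θ * Complex.I)) := by
  simp only [hankelIntegrand, ← Complex.exp_conj, map_add, map_sub, map_mul, Complex.conj_ofReal,
    Complex.conj_I, Complex.ofReal_neg, neg_mul, mul_neg]

/-- The exponent has real part e^x cos y - σ e^{βx} cos(βy) + βx, and cos(βy) ≥ cos(βθ) for |y| ≤ θ.
The decay in σ is thus uniform across the strip. -/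
lemma norm_hankelIntegrand_le {β θ σ : ℝ} (h0 : 0 < β) (hσ : 0 ≤ σ) (hβθ : β * θ ≤ π / 2) (x y : ℝ)
    (hy : |y| ≤ θ) :
    ‖hankelIntegrand β σ (x + y * Complex.I)‖
      ≤ Real.exp (Real.exp x) * Real.exp (β * x) * Real.exp (-(σ * Real.cos (β * θ) * Real.exp (β * x))) := by
  rw [hankelIntegrand, Complex.norm_exp, ← Real.exp_add, ← Real.exp_add, Real.exp_le_exp]
  have e2 : (β : ℂ) * (x + y * Complex.I) = ((β * x : ℝ) : ℂ) + ((β * y : ℝ) : ℂ) * Complex.I := by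
    push_cast; ring
  have e3 : ((β * x : ℝ) : ℂ) + ((β * y : ℝ) : ℂ) * Complex.I = ((β * x : ℝ) : ℂ) +
    ((β * y : ℝ) : ℂ) * Complex.I := rfl
  rw [e2, Complex.exp_add (x:ℂ), Complex.exp_add ((β * x : ℝ) : ℂ), ← Complex.ofReal_exp,
    ← Complex.ofReal_exp, Complex.add_re, Complex.sub_re, Complex.re_ofReal_mul, Complex.re_ofReal_mul,
    Complex.re_ofReal_mul, Complex.exp_ofReal_mul_I_re, Complex.exp_ofReal_mul_I_re]
  have h1 : Real.exp x * Real.cos y ≤ Real.exp x :=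
    mul_le_of_le_one_right (Real.exp_pos _).le (Real.cos_le_one _)
  have h2 : Real.cos (β * θ) ≤ Real.cos (β * y) := by
    rw [← Real.cos_abs (β * y), abs_mul, abs_of_pos h0]
    exact Real.cos_le_cos_of_nonneg_of_le_pi (by positivity) (by linarith [Real.pi_pos]) (by gcongr)
  have h3 : σ * (Real.cos (β * θ) * Real.exp (β * x)) ≤ σ * (Real.exp (β * x) * Real.cos (β * y)) := by
    rw [mul_comm (Real.exp _)]; gcongr
  simp
  nlinarith

/-- In the logarithmic variable the integrand is entire and commutes with conjugation. By Cauchy's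
theorem on [log ε, log R] × [-θ, θ], twice the imaginary part of the upper side is controlled by the
two vertical sides, each of length 2θ. The side at R carries the decay in σ, the side at ε is
O(ε^β). -/
lemma abs_im_integral_rayKernel_le {β θ σ ε R : ℝ} (h0 : 0 < β) (hσ : 0 ≤ σ) (hθ : 0 < θ)
    (hβθ : β * θ ≤ π / 2) (hε : 0 < ε) (hεR : ε ≤ R) :
    |(∫ r in ε..R, rayKernel β θ σ r).im|
      ≤ θ * (Real.exp R * R ^ β * Real.exp (-(σ * Real.cos (β * θ) * R ^ β)) + Real.exp R * ε ^ β) := by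
  have hR : 0 < R := hε.trans_le hεR
  have hcos : 0 ≤ Real.cos (β * θ) := Real.cos_nonneg_of_neg_pi_div_two_le_of_le
    (by nlinarith [Real.pi_pos, mul_pos h0 hθ]) hβθ
  have hsub : ∫ r in ε..R, rayKernel β θ σ r
      = ∫ x in Real.log ε..Real.log R, hankelIntegrand β σ (x + θ * Complex.I) := by
    have h := intervalIntegral.integral_deriv_smul_comp'' (a := Real.log ε) (b := Real.log R)
      (f := Real.exp) (f' := Real.exp) (g := rayKernel β θ σ) Real.continuous_exp.continuousOn
      (fun x _ => (Real.hasDerivAt_exp x).hasDerivWithinAt) Real.continuous_exp.continuousOn ?_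
    · simp only [Function.comp, rayKernel_exp, Real.exp_log hε, Real.exp_log hR] at h
      exact h.symm
    · rintro _ ⟨x, _, rfl⟩
      apply ContinuousAt.continuousWithinAt
      have hx := (Real.exp_pos x).ne'
      unfold rayKernel
      have c1 : ∀ p : ℝ, ContinuousAt (fun r : ℝ => ((r ^ p : ℝ) : ℂ)) (Real.exp x) := fun p =>
        Complex.continuous_ofReal.continuousAt.comp (Real.continuousAt_rpow_const _ _ (Or.inl hx))
      have c2 := c1 (β - 1)
      have c3 := c1 β
      fun_prop
  set B := ∫ x in Real.log ε..Real.log R, hankelIntegrand β σ (x + θ * Complex.I) with hB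
  have hconj : ∫ x in Real.log ε..Real.log R, hankelIntegrand β σ (x + ((-θ : ℝ) : ℂ) * Complex.I)
      = (starRingEnd ℂ) B := by
    simp only [hankelIntegrand_conj, hB]
    rw [intervalIntegral.integral_of_le (Real.log_le_log hε hεR),
      intervalIntegral.integral_of_le (Real.log_le_log hε hεR), integral_conj]
  have hrect := Complex.integral_boundary_rect_eq_zero_of_differentiableOn (hankelIntegrand β σ)
    (⟨Real.log ε, -θ⟩) (⟨Real.log R, θ⟩) (differentiable_hankelIntegrand β σ).differentiableOn
  simp only [] at hrect
  rw [hconj, ← hB] at hrect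
  have hseg : ∀ x : ℝ, ‖∫ y in (-θ)..θ, hankelIntegrand β σ (x + y * Complex.I)‖
      ≤ Real.exp (Real.exp x) * Real.exp (β * x) * Real.exp (-(σ * Real.cos (β * θ) * Real.exp (β * x)))
        * (2 * θ) := by
    intro x
    refine (intervalIntegral.norm_integral_le_of_norm_le_const fun y hy => ?_).trans
      (le_of_eq (by rw [sub_neg_eq_add, ← two_mul, abs_of_pos (by positivity)]))
    rw [uIoc_of_le (by linarith)] at hy
    exact norm_hankelIntegrand_le h0 hσ hβθ x y (abs_le.2 ⟨hy.1.le, hy.2⟩)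
  have s1 := hseg (Real.log R)
  have s2 := hseg (Real.log ε)
  have eR : Real.exp (β * Real.log R) = R ^ β := by rw [mul_comm, ← Real.rpow_def_of_pos hR]
  have eε : Real.exp (β * Real.log ε) = ε ^ β := by rw [mul_comm, ← Real.rpow_def_of_pos hε]
  rw [Real.exp_log hR, eR] at s1
  rw [Real.exp_log hε, eε] at s2
  have s2' : Real.exp ε * ε ^ β * Real.exp (-(σ * Real.cos (β * θ) * ε ^ β)) * (2 * θ)
      ≤ Real.exp R * ε ^ β * 1 * (2 * θ) := by
    gcongr
    rw [Real.exp_le_one_iff]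
    have : 0 ≤ σ * Real.cos (β * θ) * ε ^ β := by positivity
    linarith
  have hnorm : ‖(starRingEnd ℂ) B - B‖ ≤
      ‖∫ y in (-θ)..θ, hankelIntegrand β σ (Real.log R + y * Complex.I)‖ +
      ‖∫ y in (-θ)..θ, hankelIntegrand β σ (Real.log ε + y * Complex.I)‖ := by
    have : (starRingEnd ℂ) B - B = Complex.I * (∫ y in (-θ)..θ, hankelIntegrand β σ (Real.log ε + y * Complex.I))
      - Complex.I * (∫ y in (-θ)..θ, hankelIntegrand β σ (Real.log R + y * Complex.I)) := by
      simp only [smul_eq_mul] at hrect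
      linear_combination hrect
    rw [this, add_comm]
    refine (norm_sub_le _ _).trans (le_of_eq ?_)
    simp
  have him : ‖(starRingEnd ℂ) B - B‖ = 2 * |B.im| := by
    have : (starRingEnd ℂ) B - B = ((-(2 * B.im) : ℝ) : ℂ) * Complex.I := by
      apply Complex.ext <;> simp; ring
    rw [this]; simp
  rw [hsub]
  rw [him] at hnorm
  nlinarith

/-- The first two conditions make e^{r cos θ} decay along the ray, the third makes cos(βθ) positive;
they are compatible because β < 1. -/
lemma exists_ray_angle {β : ℝ} (h0 : 0 < β) (h1 : β < 1) :
    ∃ θ, π / 2 < θ ∧ θ < π ∧ β * θ < π / 2 := by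
  have hp := Real.pi_pos
  obtain ⟨θ, h, h'⟩ := exists_between (show π / 2 < min π (π / (2 * β)) from
    lt_min (by linarith) (by rw [div_lt_div_iff₀ (by norm_num) (by positivity)]; nlinarith))
  refine ⟨θ, h, h'.trans_le (min_le_left _ _), ?_⟩
  have := h'.trans_le (min_le_right _ _)
  rw [lt_div_iff₀ (by positivity)] at this
  linarith

lemma integrableOn_rayKernel {β θ σ : ℝ} (h0 : 0 < β) (hσ : 0 ≤ σ) (hcos : 0 < -Real.cos θ)
    (hc : 0 ≤ Real.cos (β * θ)) : IntegrableOn (rayKernel β θ σ) (Ioi 0) := by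
  refine (integrableOn_rpow_mul_exp_neg h0 hcos).mono' (measurable_rayKernel _ _ _).aestronglyMeasurable ?_
  refine (ae_restrict_mem measurableSet_Ioi).mono fun r hr => ?_
  have hr' : (0:ℝ) < r := hr
  rw [norm_rayKernel hr']
  refine mul_le_of_le_one_right (by positivity) ?_
  rw [Real.exp_le_one_iff]
  have : 0 ≤ σ * Real.cos (β * θ) * r ^ β := by positivity
  linarith

/-- Faster than exponential decay of the Wright function on the negative half-line. -/
lemma wright_exp_decay {β : ℝ} (h0 : 0 < β) (h1 : β < 1) (l : ℝ) :
    ∃ C, 0 ≤ C ∧ ∀ σ, 0 ≤ σ → |wright (-β) (1 - β) (-σ)| ≤ C * Real.exp (-(l * σ)) := by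
  obtain ⟨θ, hθ, hθ', hβθ⟩ := exists_ray_angle h0 h1
  have hp := Real.pi_pos
  have hθ0 : 0 < θ := by linarith
  have hcos : 0 < -Real.cos θ := by
    have := Real.cos_neg_of_pi_div_two_lt_of_lt hθ (by linarith [Real.pi_pos]); linarith
  have hc : 0 < Real.cos (β * θ) := Real.cos_pos_of_mem_Ioo ⟨by nlinarith [mul_pos h0 hθ0], hβθ⟩
  -- The rate l is bought by a large radius: the vertical side at R and the tail beyond R both carry
  -- the factor exp(-σ cos(βθ) R^β) ≤ exp(-lσ).
  obtain ⟨R, hR1, hRl⟩ : ∃ R : ℝ, 1 ≤ R ∧ l ≤ Real.cos (β * θ) * R ^ β := by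
    have := ((tendsto_rpow_atTop h0).const_mul_atTop hc).eventually_ge_atTop l
    exact ((eventually_ge_atTop 1).and this).exists
  have hR : 0 < R := by linarith
  set G := ∫ r in Ioi (0:ℝ), r ^ (β - 1) * Real.exp (-(-Real.cos θ * r)) with hG
  have hG0 : 0 ≤ G := setIntegral_nonneg measurableSet_Ioi fun r hr => by
    have hr' : (0:ℝ) < r := hr
    positivity
  refine ⟨1 / π * (θ * (Real.exp R * R ^ β) + G), by positivity, fun σ hσ => ?_⟩
  rw [wright_eq_ray h0 h1 hθ hθ', abs_mul, abs_of_pos (by positivity : 0 < 1/π), mul_assoc]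
  gcongr
  have hint := integrableOn_rayKernel (θ := θ) h0 hσ hcos hc.le
  set E := Real.exp (-(σ * Real.cos (β * θ) * R ^ β)) with hE
  have hEl : E ≤ Real.exp (-(l * σ)) := by
    rw [hE, Real.exp_le_exp]; nlinarith
  have htail : ‖∫ r in Ioi R, rayKernel β θ σ r‖ ≤ G * E := by
    calc ‖∫ r in Ioi R, rayKernel β θ σ r‖
        ≤ ∫ r in Ioi R, r ^ (β - 1) * Real.exp (-(-Real.cos θ * r)) * E := by
          refine norm_integral_le_of_norm_le (((integrableOn_rpow_mul_exp_neg h0 hcos).mono_set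
            (Ioi_subset_Ioi hR.le)).mul_const E) ?_
          refine (ae_restrict_mem measurableSet_Ioi).mono fun r hr => ?_
          have hr' : R < r := hr
          have hr0 : 0 < r := hR.trans hr'
          rw [norm_rayKernel hr0, hE]
          gcongr
      _ = (∫ r in Ioi R, r ^ (β - 1) * Real.exp (-(-Real.cos θ * r))) * E := integral_mul_const _ _
      _ ≤ G * E := by
          gcongr
          refine setIntegral_mono_set (integrableOn_rpow_mul_exp_neg h0 hcos) ?_
            (LE.le.eventuallyLE (Ioi_subset_Ioi hR.le))
          refine (ae_restrict_mem measurableSet_Ioi).mono fun r hr => ?_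
          have hr' : (0:ℝ) < r := hr
          simp only [Pi.zero_apply]
          positivity
  -- The piece over (0, ε) and the vertical side at ε have no decay in σ, but both are O(ε^β) and
  -- disappear as ε → 0.
  have key : ∀ ε ∈ Ioc 0 R, |(∫ r in Ioi (0:ℝ), rayKernel β θ σ r).im|
      ≤ (θ * (Real.exp R * R ^ β) + G) * E + (θ * Real.exp R + 1 / β) * ε ^ β := by
    rintro ε ⟨hε, hεR⟩
    have hsplit : ∫ r in Ioi (0:ℝ), rayKernel β θ σ r = (∫ r in (0:ℝ)..ε, rayKernel β θ σ r)
        + (∫ r in ε..R, rayKernel β θ σ r) + ∫ r in Ioi R, rayKernel β θ σ r := by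
      rw [intervalIntegral.integral_add_adjacent_intervals,
        intervalIntegral.integral_interval_add_Ioi hint (hint.mono_set (Ioi_subset_Ioi hR.le))]
      · rw [intervalIntegrable_iff_integrableOn_Ioc_of_le hε.le]
        exact hint.mono_set Ioc_subset_Ioi_self
      · rw [intervalIntegrable_iff_integrableOn_Ioc_of_le hεR]
        exact hint.mono_set (Ioc_subset_Ioi_self.trans (Ioi_subset_Ioi hε.le))
    have hfirst : ‖∫ r in (0:ℝ)..ε, rayKernel β θ σ r‖ ≤ 1 / β * ε ^ β := by
      have : ∫ r in (0:ℝ)..ε, r ^ (β - 1) = 1 / β * ε ^ β := by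
        rw [integral_rpow (Or.inl (by linarith))]
        simp [h0.ne']; ring
      rw [← this]
      refine intervalIntegral.norm_integral_le_of_norm_le hε.le ?_
        (intervalIntegral.intervalIntegrable_rpow' (by linarith))
      refine Eventually.of_forall fun r hr => ?_
      have hr0 : 0 < r := hr.1
      rw [norm_rayKernel hr0, mul_assoc, ← Real.exp_add]
      refine mul_le_of_le_one_right (by positivity) ?_
      rw [Real.exp_le_one_iff]
      have h1 : 0 ≤ σ * Real.cos (β * θ) * r ^ β := by positivity
      have h2 : 0 ≤ -Real.cos θ * r := by positivity
      linarith
    have hmid := abs_im_integral_rayKernel_le (σ := σ) h0 hσ hθ0 hβθ.le hε hεR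
    rw [hsplit, Complex.add_im, Complex.add_im]
    have a1 := (Complex.abs_im_le_norm (∫ r in (0:ℝ)..ε, rayKernel β θ σ r)).trans hfirst
    have a2 := (Complex.abs_im_le_norm (∫ r in Ioi R, rayKernel β θ σ r)).trans htail
    rw [← hE] at hmid
    refine (abs_add_le _ _).trans ?_
    have := abs_add_le (∫ r in (0:ℝ)..ε, rayKernel β θ σ r).im (∫ r in ε..R, rayKernel β θ σ r).im
    linarith
  have hlim : Tendsto (fun ε : ℝ => (θ * (Real.exp R * R ^ β) + G) * E + (θ * Real.exp R + 1 / β) * ε ^ β)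
      (𝓝[>] 0) (𝓝 ((θ * (Real.exp R * R ^ β) + G) * E)) := by
    have : Tendsto (fun ε : ℝ => ε ^ β) (𝓝[>] 0) (𝓝 0) := by
      have := (Real.continuousAt_rpow_const 0 β (Or.inr h0.le)).tendsto
      rw [Real.zero_rpow h0.ne'] at this
      exact this.mono_left nhdsWithin_le_nhds
    simpa using (this.const_mul (θ * Real.exp R + 1 / β)).const_add ((θ * (Real.exp R * R ^ β) + G) * E)
  calc _ ≤ (θ * (Real.exp R * R ^ β) + G) * E := ge_of_tendsto hlim (by
        filter_upwards [Ioc_mem_nhdsGT hR] with ε hε using key ε hε)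
    _ ≤ _ := by gcongr

/-! ### The Mellin transform of the Wright function -/

/-- The function `M(σ) = W_{-β, 1-β}(-σ)`. -/
def mWright (β σ : ℝ) : ℝ := wright (-β) (1 - β) (-σ)

lemma continuous_mWright {β : ℝ} (h0 : 0 < β) (h1 : β < 1) : Continuous (mWright β) :=
  (continuous_wright h0 h1).comp continuous_neg

/-- Fubini in the ray representation: the σ-integral is a Gamma integral with rate r^β e^{iβθ}, and
what remains is a ray integral with p = β(1 - s), convergent at 0 because s < 1. -/
lemma wright_mellin_strip {β s : ℝ} (h0 : 0 < β) (h1 : β < 1) (hs : 0 < s) (hs1 : s < 1) :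
    ∫ σ in Ioi (0:ℝ), σ ^ (s - 1) * mWright β σ
      = Real.Gamma s * (Real.Gamma (1 - β + β * s))⁻¹ := by
  obtain ⟨θ, hθ, hθ', hβθ⟩ := exists_ray_angle h0 h1
  have hp := Real.pi_pos
  have hθ0 : 0 < θ := by linarith
  have hcos : 0 < -Real.cos θ := by
    have := Real.cos_neg_of_pi_div_two_lt_of_lt hθ (by linarith [Real.pi_pos]); linarith
  have hc : 0 < Real.cos (β * θ) := Real.cos_pos_of_mem_Ioo ⟨by nlinarith [mul_pos h0 hθ0], hβθ⟩
  have hq : 0 < β * (1 - s) := mul_pos h0 (by linarith)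
  set F : ℝ → ℝ → ℂ := fun σ r => ((σ ^ (s - 1) : ℝ) : ℂ) * rayKernel β θ σ r with hF
  have hFm : Measurable (Function.uncurry F) := by
    simp only [hF, rayKernel]
    fun_prop
  have hFn : ∀ σ r : ℝ, 0 < σ → 0 < r → ‖F σ r‖ = r ^ (β - 1) * Real.exp (-(-Real.cos θ * r)) *
      (σ ^ (s - 1) * Real.exp (-(Real.cos (β * θ) * r ^ β * σ))) := by
    intro σ r hσ hr
    simp only [hF]
    rw [norm_mul, norm_rayKernel hr, Complex.norm_real, Real.norm_of_nonneg (by positivity)]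
    have : σ * Real.cos (β * θ) * r ^ β = Real.cos (β * θ) * r ^ β * σ := by ring
    rw [this]; ring
  have hFint : Integrable (Function.uncurry F)
      ((volume.restrict (Ioi 0)).prod (volume.restrict (Ioi 0))) := by
    rw [integrable_prod_iff' hFm.aestronglyMeasurable]
    constructor
    · refine (ae_restrict_mem measurableSet_Ioi).mono fun r hr => ?_
      have hr' : (0:ℝ) < r := hr
      have hrate : 0 < Real.cos (β * θ) * r ^ β := by positivity
      refine ((integrableOn_rpow_mul_exp_neg hs hrate).const_mul
        (r ^ (β - 1) * Real.exp (-(-Real.cos θ * r)))).mono'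
        (hFm.comp (measurable_id.prodMk measurable_const)).aestronglyMeasurable ?_
      exact (ae_restrict_mem measurableSet_Ioi).mono fun σ hσ => (hFn σ r hσ hr').le
    · have : ∀ r ∈ Ioi (0:ℝ), ∫ σ in Ioi (0:ℝ), ‖Function.uncurry F (σ, r)‖
          = (1 / Real.cos (β * θ)) ^ s * Real.Gamma s *
            (r ^ (β * (1 - s) - 1) * Real.exp (-(-Real.cos θ * r))) := by
        intro r hr
        have hr' : (0:ℝ) < r := hr
        have hrate : 0 < Real.cos (β * θ) * r ^ β := by positivity
        have e := setIntegral_congr_fun (μ := volume) measurableSet_Ioi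
          fun σ (hσ : σ ∈ Ioi (0:ℝ)) => hFn σ r hσ hr'
        simp only [Function.uncurry]
        rw [e, integral_const_mul, Real.integral_rpow_mul_exp_neg_mul_Ioi hs hrate]
        have e2 : (1 / (Real.cos (β * θ) * r ^ β)) ^ s = (1 / Real.cos (β * θ)) ^ s * r ^ (-(β * s)) := by
          rw [one_div, one_div, Real.inv_rpow hrate.le, Real.inv_rpow hc.le,
            Real.mul_rpow hc.le (by positivity), mul_inv, ← Real.rpow_mul hr'.le, Real.rpow_neg hr'.le]
        have e3 : r ^ (β * (1 - s) - 1) = r ^ (β - 1) * r ^ (-(β * s)) := by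
          rw [← Real.rpow_add hr']; ring_nf
        rw [e2, e3]; ring
      refine IntegrableOn.congr_fun (Integrable.const_mul (integrableOn_rpow_mul_exp_neg hq hcos) _)
        (fun r hr => (this r hr).symm) measurableSet_Ioi
  have hswap := integral_integral_swap hFint
  have hinner : ∀ r ∈ Ioi (0:ℝ), ∫ σ in Ioi (0:ℝ), F σ r = (Real.Gamma s : ℂ) *
      (((r ^ (β * (1 - s) - 1) : ℝ) : ℂ) *
        Complex.exp (r * Complex.exp (θ * Complex.I) + ((β * (1 - s) : ℝ) : ℂ) * θ * Complex.I)) := by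
    intro r hr
    have hr' : (0:ℝ) < r := hr
    set ρ : ℂ := ((r ^ β : ℝ) : ℂ) * Complex.exp ((β * θ : ℝ) * Complex.I) with hρ
    have hρre : 0 < ρ.re := by
      rw [hρ, Complex.re_ofReal_mul, Complex.exp_ofReal_mul_I_re]; positivity
    have hpow : (1 / ρ) ^ (s : ℂ) = ((r ^ (-(β * s)) : ℝ) : ℂ) * Complex.exp (-(β * s * θ * Complex.I)) := by
      have : 1 / ρ = Complex.exp (((-(β * Real.log r) : ℝ) : ℂ) + ((-(β * θ) : ℝ) : ℂ) * Complex.I) := by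
        rw [hρ, Real.rpow_def_of_pos hr', one_div, Complex.ofReal_exp, ← Complex.exp_add, ← Complex.exp_neg]
        push_cast; ring_nf
      have him : (((-(β * Real.log r) : ℝ) : ℂ) + ((-(β * θ) : ℝ) : ℂ) * Complex.I).im = -(β * θ) := by simp
      rw [this, Complex.cpow_def_of_ne_zero (Complex.exp_ne_zero _), Complex.log_exp, Real.rpow_def_of_pos hr',
        Complex.ofReal_exp, ← Complex.exp_add]
      · push_cast; ring_nf
      · rw [him]; linarith
      · rw [him]; nlinarith [mul_pos h0 hθ0]
    have := integral_rpow_mul_cexp hs hρre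
    rw [hpow] at this
    calc _ = ∫ σ in Ioi (0:ℝ), ((σ ^ (s - 1) : ℝ) : ℂ) * Complex.exp (-(ρ * σ)) *
          (((r ^ (β - 1) : ℝ) : ℂ) * Complex.exp (r * Complex.exp (θ * Complex.I) + β * θ * Complex.I)) := by
          refine setIntegral_congr_fun measurableSet_Ioi fun σ _ => ?_
          simp only [hF, rayKernel]
          rw [mul_mul_mul_comm, ← mul_assoc (((σ ^ (s - 1) : ℝ) : ℂ)), ← Complex.exp_add, hρ]
          push_cast; ring_nf
      _ = _ := by
          rw [integral_mul_const, this]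
          have e3 : r ^ (β * (1 - s) - 1) = r ^ (β - 1) * r ^ (-(β * s)) := by
            rw [← Real.rpow_add hr']; ring_nf
          have e4 : (r * Complex.exp (θ * Complex.I) + ((β * (1 - s) : ℝ) : ℂ) * θ * Complex.I)
            = (r * Complex.exp (θ * Complex.I) + β * θ * Complex.I) + (-(β * s * θ * Complex.I)) := by
            push_cast; ring
          rw [e3, e4, Complex.exp_add _ (-_), Complex.Gamma_ofReal]; push_cast; ring
  have hG := im_integral_ray (β * (1 - s)) θ hq hθ hθ'
  have hI : (∫ σ in Ioi (0:ℝ), ∫ r in Ioi (0:ℝ), F σ r).im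
      = π * (Real.Gamma s * (Real.Gamma (1 - β + β * s))⁻¹) := by
    rw [hswap, setIntegral_congr_fun measurableSet_Ioi hinner, integral_const_mul,
      Complex.im_ofReal_mul, hG]
    have : 1 - β * (1 - s) = 1 - β + β * s := by ring
    rw [this]; ring
  have him : (∫ σ in Ioi (0:ℝ), ∫ r in Ioi (0:ℝ), F σ r).im
      = ∫ σ in Ioi (0:ℝ), (∫ r in Ioi (0:ℝ), F σ r).im :=
    (integral_im (𝕜 := ℂ) hFint.integral_prod_left).symm
  have hM : ∀ σ ∈ Ioi (0:ℝ), σ ^ (s - 1) * mWright β σ = 1 / π * (∫ r in Ioi (0:ℝ), F σ r).im := by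
    intro σ _
    simp only [hF]
    rw [integral_const_mul, Complex.im_ofReal_mul, mWright, wright_eq_ray h0 h1 hθ hθ']; ring
  rw [setIntegral_congr_fun measurableSet_Ioi hM, integral_const_mul, ← him, hI]
  field_simp

lemma mWright_exp_decay {β : ℝ} (h0 : 0 < β) (h1 : β < 1) (l : ℝ) :
    ∃ C, 0 ≤ C ∧ ∀ σ, 0 ≤ σ → |mWright β σ| ≤ C * Real.exp (-(l * σ)) := wright_exp_decay h0 h1 l

lemma mWright_bigO {β : ℝ} (h0 : 0 < β) (h1 : β < 1) :
    (fun σ => (mWright β σ : ℂ)) =O[atTop] (fun t => Real.exp (-1 * t)) ∧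
    (fun σ => (mWright β σ : ℂ)) =O[𝓝[>] 0] (fun t : ℝ => t ^ (-(0:ℝ))) := by
  constructor
  · obtain ⟨C, _, hC⟩ := mWright_exp_decay h0 h1 1
    refine Asymptotics.IsBigO.of_bound C ?_
    filter_upwards [eventually_ge_atTop 0] with σ hσ
    have := hC σ hσ
    simpa using this
  · have : Tendsto (fun σ => (mWright β σ : ℂ)) (𝓝[>] 0) (𝓝 (mWright β 0 : ℂ)) :=
      ((Complex.continuous_ofReal.comp (continuous_mWright h0 h1)).tendsto 0).mono_left
        nhdsWithin_le_nhds
    simpa using this.isBigO_one ℝ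

lemma mWright_locallyIntegrableOn {β : ℝ} (h0 : 0 < β) (h1 : β < 1) :
    LocallyIntegrableOn (fun σ => (mWright β σ : ℂ)) (Ioi 0) :=
  ((Complex.continuous_ofReal.comp (continuous_mWright h0 h1)).locallyIntegrable).locallyIntegrableOn _

lemma mellinConvergent_mWright {β : ℝ} (h0 : 0 < β) (h1 : β < 1) {s : ℂ} (hs : 0 < s.re) :
    MellinConvergent (fun σ => (mWright β σ : ℂ)) s :=
  mellinConvergent_of_isBigO_rpow_exp one_pos (mWright_locallyIntegrableOn h0 h1)
    (mWright_bigO h0 h1).1 (mWright_bigO h0 h1).2 hs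

/-- Analytic continuation from 0 < s < 1: M is continuous and decays exponentially, so its Mellin
transform is holomorphic for Re s > 0, as is the right-hand side. -/
lemma mellin_mWright {β : ℝ} (h0 : 0 < β) (h1 : β < 1) {s : ℂ} (hs : 0 < s.re) :
    mellin (fun σ => (mWright β σ : ℂ)) s
      = Complex.Gamma s * (Complex.Gamma (1 - β + β * s))⁻¹ := by
  set U : Set ℂ := {z | 0 < z.re} with hU
  have hUo : IsOpen U := isOpen_lt continuous_const Complex.continuous_re
  have hUc : IsPreconnected U := (convex_halfSpace_re_gt 0).isPreconnected
  have hF : DifferentiableOn ℂ (mellin (fun σ => (mWright β σ : ℂ))) U := fun z hz =>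
    (mellin_differentiableAt_of_isBigO_rpow_exp one_pos (mWright_locallyIntegrableOn h0 h1)
      (mWright_bigO h0 h1).1 (mWright_bigO h0 h1).2 hz).differentiableWithinAt
  have hG : DifferentiableOn ℂ (fun s : ℂ => Complex.Gamma s * (Complex.Gamma (1 - β + β * s))⁻¹) U := by
    intro z hz
    have hz' : 0 < z.re := hz
    refine DifferentiableAt.differentiableWithinAt (DifferentiableAt.mul ?_ ?_)
    · refine Complex.differentiableAt_Gamma z fun m h => ?_
      rw [h] at hz'; simp at hz'
      linarith [Nat.cast_nonneg (α := ℝ) m]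
    · exact (Complex.differentiable_one_div_Gamma _).comp (f := fun s : ℂ => 1 - β + β * s) z
        (by fun_prop)
  refine (hF.analyticOnNhd hUo).eqOn_of_preconnected_of_frequently_eq (hG.analyticOnNhd hUo)
    hUc (z₀ := ((1 / 2 : ℝ) : ℂ)) (by simp [hU]) ?_ hs
  have hreal : ∀ x : ℝ, 0 < x → x < 1 → mellin (fun σ => (mWright β σ : ℂ)) x =
      Complex.Gamma x * (Complex.Gamma (1 - β + β * x))⁻¹ := by
    intro x hx hx1
    have e := wright_mellin_strip h0 h1 hx hx1
    have e1 : Complex.Gamma x * (Complex.Gamma (1 - β + β * x))⁻¹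
        = ((Real.Gamma x * (Real.Gamma (1 - β + β * x))⁻¹ : ℝ) : ℂ) := by
      push_cast [← Complex.Gamma_ofReal]; rfl
    rw [e1, ← e, ← integral_complex_ofReal, mellin]
    refine setIntegral_congr_fun measurableSet_Ioi fun t ht => ?_
    have ht' : (0 : ℝ) < t := ht
    simp only [smul_eq_mul]
    push_cast
    rw [Complex.ofReal_cpow ht'.le]; push_cast; rfl
  have h1' : ∃ᶠ x : ℝ in 𝓝[≠] (1/2), mellin (fun σ => (mWright β σ : ℂ)) x =
      Complex.Gamma x * (Complex.Gamma (1 - β + β * x))⁻¹ := by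
    refine Eventually.frequently ?_
    filter_upwards [nhdsWithin_le_nhds (Ioo_mem_nhds (a := (0:ℝ)) (b := 1) (by norm_num) (by norm_num))]
      with x hx using hreal x hx.1 hx.2
  have h2 : Tendsto (fun x : ℝ => (x : ℂ)) (𝓝[≠] (1/2)) (𝓝[≠] ((1/2 : ℝ) : ℂ)) := by
    refine tendsto_nhdsWithin_of_tendsto_nhds_of_eventually_within _ ?_ ?_
    · exact (Complex.continuous_ofReal.tendsto _).mono_left nhdsWithin_le_nhds
    · filter_upwards [self_mem_nhdsWithin] with x hx
      have : x ≠ 1/2 := hx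
      exact fun h => this (Complex.ofReal_injective h)
  exact h2.frequently h1'

lemma integral_mWright {β : ℝ} (h0 : 0 < β) (h1 : β < 1) :
    ∫ σ in Ioi (0:ℝ), mWright β σ = 1 := by
  have h := mellin_mWright h0 h1 (s := 1) (by simp)
  simp only [mellin, sub_self, Complex.cpow_zero, one_smul, mul_one, sub_add_cancel, Complex.Gamma_one,
    inv_one] at h
  rw [integral_complex_ofReal] at h
  exact_mod_cast h

lemma rpow_mul_mWright_le {β : ℝ} (h0 : 0 < β) (h1 : β < 1) {p : ℝ} (hp : 0 ≤ p) :
    ∃ C, 0 ≤ C ∧ ∀ σ, 0 < σ → σ ^ p * |mWright β σ| ≤ C := by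
  obtain ⟨C, hC0, hC⟩ := mWright_exp_decay h0 h1 p
  refine ⟨C, hC0, fun σ hσ => ?_⟩
  have h : σ ^ p ≤ Real.exp (p * σ) := by
    rw [mul_comm, Real.exp_mul]
    exact Real.rpow_le_rpow hσ.le (by linarith [Real.add_one_le_exp σ]) hp
  calc σ ^ p * |mWright β σ| ≤ Real.exp (p * σ) * (C * Real.exp (-(p * σ))) := by
        gcongr; exact hC σ hσ.le
    _ = C := by rw [mul_left_comm, ← Real.exp_add]; simp

/-! ### The convolution identity for the Caputo derivative -/

lemma intervalIntegrable_beta {β a t : ℝ} (h1 : β < 1) (ha : 0 < a) (ht : 0 < t) :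
    IntervalIntegrable (fun τ => (t - τ) ^ (-β) * τ ^ (a - 1)) volume 0 t := by
  have h := (Complex.betaIntegral_convergent (u := a) (v := ((1 - β : ℝ) : ℂ)) (by simpa) (by
    rw [Complex.ofReal_re]; linarith)).norm
  have h2 := (h.comp_mul_left (c := t⁻¹)).const_mul (t ^ (-β) * t ^ (a - 1))
  have e1 : (1:ℝ) / t⁻¹ = t := by simp
  rw [zero_div, e1] at h2
  refine (intervalIntegrable_congr_ae ?_).2 h2
  rw [uIoc_of_le ht.le, ← restrict_Ioo_eq_restrict_Ioc]
  refine (ae_restrict_mem measurableSet_Ioo).mono fun τ hτ => ?_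
  have hτ0 : 0 < τ := hτ.1
  have hτ1 : 0 < t - τ := sub_pos.2 hτ.2
  have k1 : 0 < t⁻¹ * τ := by positivity
  have k2 : 1 - t⁻¹ * τ = (t - τ) * t⁻¹ := by field_simp
  have k3 : 0 < 1 - t⁻¹ * τ := by rw [k2]; positivity
  simp only []
  rw [norm_mul]
  have n1 : ‖((t⁻¹ * τ : ℝ) : ℂ) ^ ((a : ℂ) - 1)‖ = (t⁻¹ * τ) ^ (a - 1) := by
    rw [Complex.norm_cpow_eq_rpow_re_of_pos k1]; simp
  have n2 : ‖(1 - ((t⁻¹ * τ : ℝ) : ℂ)) ^ (((1 - β : ℝ) : ℂ) - 1)‖ = (1 - t⁻¹ * τ) ^ (-β) := by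
    have : (1 - ((t⁻¹ * τ : ℝ) : ℂ)) = ((1 - t⁻¹ * τ : ℝ) : ℂ) := by push_cast; rfl
    rw [this, Complex.norm_cpow_eq_rpow_re_of_pos k3]; simp
  rw [n1, n2, k2, Real.mul_rpow (by positivity) hτ0.le, Real.mul_rpow hτ1.le (by positivity),
    Real.inv_rpow ht.le, Real.inv_rpow ht.le]
  field_simp

/-- The kernel of the double integral in the Caputo derivative of a subordinated function. -/
def caputoKernel (β t τ s : ℝ) : ℝ :=
  (t - τ) ^ (-β) * (β * s * τ ^ (-β - 1) * mWright β (τ ^ (-β) * s))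

lemma measurable_caputoKernel {β : ℝ} (h0 : 0 < β) (h1 : β < 1) (t : ℝ) :
    Measurable (Function.uncurry (caputoKernel β t)) := by
  have := (continuous_mWright h0 h1).measurable
  unfold caputoKernel Function.uncurry
  fun_prop

/-- The weight has two uses: s^{-1/2} is the modulus of the Mellin kernel on the line Re s = 1/2,
and e^{ls} admits functions of exponential growth. Integration in s leaves the Beta integrand
(t-τ)^{-β} τ^{β/2-1}. -/
lemma integrable_weight_caputoKernel {β t l : ℝ} (h0 : 0 < β) (h1 : β < 1) (ht : 0 < t) (hl : 0 ≤ l) :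
    Integrable (fun p : ℝ × ℝ => p.2 ^ (-(1/2) : ℝ) * Real.exp (l * p.2) * caputoKernel β t p.1 p.2)
      ((volume.restrict (Ioc 0 t)).prod (volume.restrict (Ioi 0))) := by
  -- Since t^β τ^{-β} ≥ 1 for τ ≤ t, the rate (l + 1) t^β absorbs e^{ls} and still leaves the
  -- exponential in `P`.
  obtain ⟨C, hC0, hC⟩ := mWright_exp_decay h0 h1 ((l + 1) * t ^ β)
  set P : ℝ × ℝ → ℝ := fun p => ((t - p.1) ^ (-β) * p.1 ^ (-β - 1)) *
    (p.2 ^ ((3 / 2 : ℝ) - 1) * Real.exp (-(t ^ β * p.1 ^ (-β) * p.2))) with hP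
  have hPint : Integrable P ((volume.restrict (Ioc 0 t)).prod (volume.restrict (Ioi 0))) := by
    have hm : Measurable P := by simp only [hP]; fun_prop
    rw [integrable_prod_iff hm.aestronglyMeasurable]
    have hpos : ∀ τ ∈ Ioc 0 t, 0 < t ^ β * τ ^ (-β) := fun τ hτ => by
      have := hτ.1
      positivity
    constructor
    · refine (ae_restrict_mem measurableSet_Ioc).mono fun τ hτ => ?_
      simp only [hP]
      exact Integrable.const_mul (integrableOn_rpow_mul_exp_neg (a := 3/2) (by norm_num) (hpos τ hτ)) _
    · have : ∀ τ ∈ Ioc 0 t, ∫ s in Ioi (0:ℝ), ‖P (τ, s)‖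
          = ((1 / t ^ β) ^ (3/2 : ℝ) * Real.Gamma (3/2)) * ((t - τ) ^ (-β) * τ ^ ((β / 2) - 1)) := by
        intro τ hτ
        have hτ0 : 0 < τ := hτ.1
        have hτ1 : 0 ≤ t - τ := sub_nonneg.2 hτ.2
        have e : ∀ s ∈ Ioi (0:ℝ), ‖P (τ, s)‖ = ((t - τ) ^ (-β) * τ ^ (-β - 1)) *
            (s ^ ((3 / 2 : ℝ) - 1) * Real.exp (-(t ^ β * τ ^ (-β) * s))) := by
          intro s hs
          have hs' : (0:ℝ) < s := hs
          rw [Real.norm_of_nonneg]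
          simp only [hP]
          positivity
        rw [setIntegral_congr_fun measurableSet_Ioi e, integral_const_mul,
          Real.integral_rpow_mul_exp_neg_mul_Ioi (by norm_num) (hpos τ hτ)]
        have e2 : (1 / (t ^ β * τ ^ (-β))) ^ (3/2 : ℝ) = (1 / t ^ β) ^ (3/2 : ℝ) * τ ^ (β * (3/2)) := by
          rw [one_div, one_div, mul_inv, Real.mul_rpow (by positivity) (by positivity), Real.rpow_neg hτ0.le,
            inv_inv, ← Real.rpow_mul hτ0.le]
        have e3 : τ ^ (β / 2 - 1) = τ ^ (-β - 1) * τ ^ (β * (3/2)) := by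
          rw [← Real.rpow_add hτ0]; ring_nf
        rw [e2, e3]; ring
      refine IntegrableOn.congr_fun (Integrable.const_mul ?_ _) (fun τ hτ => (this τ hτ).symm)
        measurableSet_Ioc
      exact (intervalIntegrable_iff_integrableOn_Ioc_of_le ht.le).1 (intervalIntegrable_beta h1 (by positivity) ht)
  refine (hPint.const_mul (β * C)).mono' ?_ ?_
  · have := measurable_caputoKernel h0 h1 t
    apply Measurable.aestronglyMeasurable
    exact Measurable.mul (by fun_prop) this
  · rw [Measure.prod_restrict]
    refine (ae_restrict_mem (measurableSet_Ioc.prod measurableSet_Ioi)).mono ?_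
    rintro ⟨τ, s⟩ ⟨hτ, hs⟩
    have hτ0 : 0 < τ := hτ.1
    have hs' : (0:ℝ) < s := hs
    have hτ1 : 0 ≤ t - τ := sub_nonneg.2 hτ.2
    have hM := hC (τ ^ (-β) * s) (by positivity)
    simp only [caputoKernel, hP]
    rw [norm_mul, norm_mul, norm_mul, norm_mul, Real.norm_eq_abs (mWright _ _),
      Real.norm_of_nonneg (by positivity), Real.norm_of_nonneg (by positivity),
      Real.norm_of_nonneg (by positivity), Real.norm_of_nonneg (by positivity)]
    have e3 : s ^ ((3 / 2 : ℝ) - 1) = s ^ (-(1/2) : ℝ) * s := by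
      rw [← Real.rpow_add_one hs'.ne']; norm_num
    have hge : 1 ≤ t ^ β * τ ^ (-β) := by
      rw [Real.rpow_neg hτ0.le, ← div_eq_mul_inv, one_le_div (by positivity)]
      exact Real.rpow_le_rpow hτ0.le hτ.2 h0.le
    have hexp : Real.exp (l * s) * Real.exp (-((l + 1) * t ^ β * (τ ^ (-β) * s)))
        ≤ Real.exp (-(t ^ β * τ ^ (-β) * s)) := by
      rw [← Real.exp_add, Real.exp_le_exp]
      have : l * s ≤ l * s * (t ^ β * τ ^ (-β)) := le_mul_of_one_le_right (by positivity) hge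
      linarith
    calc s ^ (-(1/2) : ℝ) * Real.exp (l * s) * ((t - τ) ^ (-β) * (β * s * τ ^ (-β - 1) * |mWright β (τ ^ (-β) * s)|))
        ≤ s ^ (-(1/2) : ℝ) * Real.exp (l * s) * ((t - τ) ^ (-β) * (β * s * τ ^ (-β - 1) *
          (C * Real.exp (-((l + 1) * t ^ β * (τ ^ (-β) * s)))))) := by gcongr
      _ = s ^ (-(1/2) : ℝ) * ((t - τ) ^ (-β) * (β * s * τ ^ (-β - 1) *
          C)) * (Real.exp (l * s) * Real.exp (-((l + 1) * t ^ β * (τ ^ (-β) * s)))) := by ring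
      _ ≤ s ^ (-(1/2) : ℝ) * ((t - τ) ^ (-β) * (β * s * τ ^ (-β - 1) *
          C)) * Real.exp (-(t ^ β * τ ^ (-β) * s)) := by gcongr
      _ = _ := by rw [e3]; ring

/-- Mellin inversion requires continuity at the point. For s away from 0 the singular power τ^{-β-1}
is harmless: boundedness of σ^{1+1/β} M(σ) at σ = τ^{-β} s cancels exactly this power. -/
lemma continuousAt_integral_caputoKernel {β t x : ℝ} (h0 : 0 < β) (h1 : β < 1) (ht : 0 < t) (hx : 0 < x) :
    ContinuousAt (fun s => ∫ τ in Ioc 0 t, caputoKernel β t τ s) x := by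
  obtain ⟨C, hC0, hC⟩ := rpow_mul_mWright_le h0 h1 (p := 1 + 1 / β) (by positivity)
  have hm := measurable_caputoKernel h0 h1 t
  refine continuousAt_of_dominated (bound := fun τ => (t - τ) ^ (-β) * τ ^ ((1:ℝ) - 1) * (β * (x/2) ^ (-(1/β)) * C))
    (Eventually.of_forall fun s => (hm.comp (measurable_id.prodMk measurable_const)).aestronglyMeasurable)
    ?_ ?_ ?_
  · filter_upwards [Ioi_mem_nhds (show x / 2 < x by linarith)] with s hs
    have hs2 : x / 2 < s := hs
    have hs0 : 0 < s := by linarith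
    refine (ae_restrict_mem measurableSet_Ioc).mono fun τ hτ => ?_
    have hτ0 : 0 < τ := hτ.1
    have hτ1 : 0 ≤ t - τ := sub_nonneg.2 hτ.2
    have h := hC (τ ^ (-β) * s) (by positivity)
    have e : (τ ^ (-β) * s) ^ (1 + 1/β) = (s * τ ^ (-β - 1)) * s ^ (1/β) := by
      rw [Real.mul_rpow (by positivity) hs0.le, ← Real.rpow_mul hτ0.le, Real.rpow_add hs0, Real.rpow_one]
      have : -β * (1 + 1 / β) = -β - 1 := by field_simp; ring
      rw [this]; ring
    rw [e] at h
    have h' : s * τ ^ (-β - 1) * |mWright β (τ ^ (-β) * s)| ≤ s ^ (-(1/β)) * C := by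
      rw [Real.rpow_neg hs0.le, ← div_eq_inv_mul, le_div_iff₀ (by positivity)]
      linarith
    rw [caputoKernel, norm_mul, norm_mul, norm_mul, norm_mul, Real.norm_eq_abs (mWright _ _),
      Real.norm_of_nonneg (by positivity), Real.norm_of_nonneg h0.le, Real.norm_of_nonneg hs0.le,
      Real.norm_of_nonneg (by positivity), sub_self, Real.rpow_zero, mul_one]
    have : s ^ (-(1/β)) ≤ (x/2) ^ (-(1/β)) :=
      Real.rpow_le_rpow_of_nonpos (by linarith) hs2.le (by simp; positivity)
    calc (t - τ) ^ (-β) * (β * s * τ ^ (-β - 1) * |mWright β (τ ^ (-β) * s)|)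
        = (t - τ) ^ (-β) * (β * (s * τ ^ (-β - 1) * |mWright β (τ ^ (-β) * s)|)) := by ring
      _ ≤ (t - τ) ^ (-β) * (β * (s ^ (-(1/β)) * C)) := by gcongr
      _ ≤ (t - τ) ^ (-β) * (β * ((x/2) ^ (-(1/β)) * C)) := by gcongr
      _ = _ := by ring
  · exact ((intervalIntegrable_iff_integrableOn_Ioc_of_le ht.le).1
      (intervalIntegrable_beta h1 one_pos ht)).mul_const _
  · refine Eventually.of_forall fun τ => ?_
    have := continuous_mWright h0 h1
    unfold caputoKernel
    fun_prop

/-- The convolution identity behind the Caputo derivative of a subordinated function. -/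
lemma integral_caputoKernel {β t x : ℝ} (h0 : 0 < β) (h1 : β < 1) (ht : 0 < t) (hx : 0 < x) :
    ∫ τ in Ioc 0 t, caputoKernel β t τ x = Real.Gamma (1 - β) * (t ^ (-β) * mWright β (t ^ (-β) * x)) := by
  -- Both sides, as functions of x, are compared through their Mellin transforms on the line Re s =
  -- 1/2.
  set G1 : ℝ → ℂ := fun s => ((∫ τ in Ioc 0 t, caputoKernel β t τ s : ℝ) : ℂ) with hG1
  set G2 : ℝ → ℂ := fun s => ((Real.Gamma (1 - β) * t ^ (-β) : ℝ) : ℂ) • (mWright β (t ^ (-β) * s) : ℂ) with hG2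
  have hcM := continuous_mWright h0 h1
  have htb : 0 < t ^ (-β) := by positivity
  have hG2c : ∀ {s : ℂ}, 0 < s.re → HasMellin G2 s
      (((Real.Gamma (1 - β) * t ^ (-β) : ℝ) : ℂ) • (((t ^ (-β) : ℝ) : ℂ) ^ (-s) •
        (Complex.Gamma s * (Complex.Gamma (1 - β + β * s))⁻¹))) := by
    intro s hs
    have hc := (MellinConvergent.comp_mul_left (f := fun σ => (mWright β σ : ℂ)) (s := s) htb).2
      (mellinConvergent_mWright h0 h1 hs)
    refine ⟨hc.const_smul _, ?_⟩
    rw [hG2, mellin_const_smul, mellin_comp_mul_left (fun σ => (mWright β σ : ℂ)) s htb, mellin_mWright h0 h1 hs]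
  have hprod : ∀ s : ℂ, s.re = 1 / 2 → Integrable
      (fun p : ℝ × ℝ => (p.2 : ℂ) ^ (s - 1) • (caputoKernel β t p.1 p.2 : ℂ))
      ((volume.restrict (Ioc 0 t)).prod (volume.restrict (Ioi 0))) := by
    intro s hs
    have hm := measurable_caputoKernel h0 h1 t
    have hm' : Measurable fun p : ℝ × ℝ => caputoKernel β t p.1 p.2 := hm
    refine (integrable_weight_caputoKernel h0 h1 ht (le_refl 0)).mono ?_ ?_
    · apply Measurable.aestronglyMeasurable
      simp only [smul_eq_mul]
      exact Measurable.mul (by fun_prop) (by fun_prop)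
    · rw [Measure.prod_restrict]
      refine (ae_restrict_mem (measurableSet_Ioc.prod measurableSet_Ioi)).mono ?_
      rintro ⟨τ, x⟩ ⟨hτ, hx⟩
      have hx' : (0:ℝ) < x := hx
      have hw : (0:ℝ) ≤ x ^ (-(1 / 2) : ℝ) := by positivity
      simp only [norm_smul, norm_mul, zero_mul, Real.exp_zero, mul_one]
      rw [Complex.norm_cpow_eq_rpow_re_of_pos hx', Complex.norm_real, Complex.sub_re, hs,
        Real.norm_of_nonneg hw]
      norm_num
  have hM1 : ∀ s : ℂ, s.re = 1 / 2 → HasMellin G1 s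
      (((Real.Gamma (1 - β) * t ^ (-β) : ℝ) : ℂ) • (((t ^ (-β) : ℝ) : ℂ) ^ (-s) •
        (Complex.Gamma s * (Complex.Gamma (1 - β + β * s))⁻¹))) := by
    intro s hs
    have hi := hprod s hs
    have e1 : ∀ x : ℝ, (x : ℂ) ^ (s - 1) • G1 x
        = ∫ τ in Ioc 0 t, (x : ℂ) ^ (s - 1) • (caputoKernel β t τ x : ℂ) := by
      intro x
      simp only [hG1]
      rw [integral_smul, integral_complex_ofReal]
    have hc : MellinConvergent G1 s := by
      have := hi.integral_prod_right
      rw [MellinConvergent]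
      simp_rw [e1]
      exact this
    refine ⟨hc, ?_⟩
    rw [mellin]
    simp_rw [e1]
    rw [← integral_integral_swap (f := fun (τ x : ℝ) => (x : ℂ) ^ (s - 1) • (caputoKernel β t τ x : ℂ)) hi]
    have hs1 : 0 < (s + 1).re := by rw [Complex.add_re, hs]; norm_num
    have hinner : ∀ τ ∈ Ioc 0 t, ∫ x in Ioi (0:ℝ), (x : ℂ) ^ (s - 1) • (caputoKernel β t τ x : ℂ)
        = (β * (Complex.Gamma (s + 1) * (Complex.Gamma (1 - β + β * (s + 1)))⁻¹)) *
          ((τ : ℂ) ^ (β * s - 1) * ((t : ℂ) - τ) ^ (((1 - β : ℝ) : ℂ) - 1)) := by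
      intro τ hτ
      have hτ0 : 0 < τ := hτ.1
      have hτ1 : 0 ≤ t - τ := sub_nonneg.2 hτ.2
      have hτb : 0 < τ ^ (-β) := by positivity
      have hm := mellin_comp_mul_left (fun σ => (mWright β σ : ℂ)) (s + 1) hτb
      rw [mellin_mWright h0 h1 hs1, mellin] at hm
      calc _ = ∫ x in Ioi (0:ℝ), (((t - τ) ^ (-β) * β * τ ^ (-β - 1) : ℝ) : ℂ) *
            ((x : ℂ) ^ (s + 1 - 1) • (mWright β (τ ^ (-β) * x) : ℂ)) := by
            refine setIntegral_congr_fun measurableSet_Ioi fun x hx => ?_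
            have hx' : (0:ℝ) < x := hx
            have : (x : ℂ) ^ (s + 1 - 1) = (x : ℂ) ^ (s - 1) * x := by
              rw [show s + 1 - 1 = s - 1 + 1 by ring,
                Complex.cpow_add _ _ (by exact_mod_cast hx'.ne'), Complex.cpow_one]
            simp only [smul_eq_mul, caputoKernel]
            rw [this]; push_cast; ring
        _ = _ := by
            rw [integral_const_mul, hm, smul_eq_mul]
            have t1 : (((t - τ) ^ (-β) : ℝ) : ℂ) = ((t : ℂ) - τ) ^ (((1 - β : ℝ) : ℂ) - 1) := by
              rw [Complex.ofReal_cpow hτ1]; push_cast; ring_nf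
            have t2 : ((τ ^ (-β - 1) : ℝ) : ℂ) * ((τ ^ (-β) : ℝ) : ℂ) ^ (-(s + 1)) = (τ : ℂ) ^ (β * s - 1) := by
              have hτc : (τ : ℂ) ≠ 0 := by exact_mod_cast hτ0.ne'
              have : ((τ ^ (-β) : ℝ) : ℂ) ^ (-(s + 1)) = (τ : ℂ) ^ (β * (s + 1)) := by
                rw [Complex.cpow_def_of_ne_zero (by exact_mod_cast hτb.ne'), ← Complex.ofReal_log hτb.le,
                  Real.log_rpow hτ0, Complex.cpow_def_of_ne_zero hτc, ← Complex.ofReal_log hτ0.le]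
                push_cast; ring_nf
              rw [this, Complex.ofReal_cpow hτ0.le, ← Complex.cpow_add _ _ hτc]
              push_cast; ring_nf
            rw [← t1, ← t2]; push_cast; ring
    -- The τ-integral is t^{βs-β} B(βs, 1-β). Its factor Γ(βs) cancels against Γ(1 + βs) = βs Γ(βs),
    -- which leaves Γ(1-β) times the transform of the density.
    rw [setIntegral_congr_fun measurableSet_Ioc hinner, integral_const_mul,
      ← intervalIntegral.integral_of_le ht.le, Complex.betaIntegral_scaled _ _ ht]
    have hβs : 0 < (β * s : ℂ).re := by rw [Complex.re_ofReal_mul, hs]; positivity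
    have hB := Complex.Gamma_mul_Gamma_eq_betaIntegral (s := β * s) (t := ((1 - β : ℝ) : ℂ)) hβs (by
      rw [Complex.ofReal_re]; linarith)
    have htc : (t : ℂ) ≠ 0 := by exact_mod_cast ht.ne'
    have t3 : ((t ^ (-β) : ℝ) : ℂ) ^ (-s) = (t : ℂ) ^ (β * s) := by
      rw [Complex.cpow_def_of_ne_zero (by exact_mod_cast htb.ne'), ← Complex.ofReal_log htb.le,
        Real.log_rpow ht, Complex.cpow_def_of_ne_zero htc, ← Complex.ofReal_log ht.le]
      push_cast; ring_nf
    have t4 : (t : ℂ) ^ (β * s + ((1 - β : ℝ) : ℂ) - 1) = (t : ℂ) ^ (β * s) * ((t ^ (-β) : ℝ) : ℂ) := by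
      rw [Complex.ofReal_cpow ht.le, ← Complex.cpow_add _ _ htc]; push_cast; ring_nf
    have g1 : Complex.Gamma (s + 1) = s * Complex.Gamma s := by
      refine Complex.Gamma_add_one s fun h => ?_
      rw [h] at hs; simp at hs
    have g2 : Complex.Gamma (1 - β + β * (s + 1)) = β * s * Complex.Gamma (β * s) := by
      rw [← Complex.Gamma_add_one (β * s) (fun h => by rw [h] at hβs; simp at hβs)]; ring_nf
    have g3 : Complex.Gamma (β * s + ((1 - β : ℝ) : ℂ)) = Complex.Gamma (1 - β + β * s) := by
      push_cast; ring_nf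
    have n1 : Complex.Gamma (β * s) ≠ 0 := Complex.Gamma_ne_zero_of_re_pos hβs
    have n2 : Complex.Gamma (1 - β + β * s) ≠ 0 := by
      apply Complex.Gamma_ne_zero_of_re_pos
      rw [Complex.add_re, Complex.re_ofReal_mul, hs]; simp; linarith
    have n3 : s ≠ 0 := fun h => by rw [h] at hs; simp at hs
    have n4 : (β : ℂ) ≠ 0 := by exact_mod_cast h0.ne'
    rw [Complex.Gamma_ofReal, g3] at hB
    rw [t3, t4, g1, g2, smul_eq_mul, smul_eq_mul]
    have hB' : Complex.betaIntegral (β * s) ((1 - β : ℝ) : ℂ)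
      = Complex.Gamma (β * s) * (Real.Gamma (1 - β) : ℂ) / Complex.Gamma (1 - β + β * s) := by
      rw [hB]; field_simp
    rw [hB']
    push_cast
    field_simp
  set D : ℝ → ℂ := fun s => G1 s - G2 s with hD
  have hDm : ∀ s : ℂ, s.re = 1/2 → HasMellin D s 0 := by
    intro s hs
    have a := hM1 s hs
    have b := hG2c (s := s) (by rw [hs]; norm_num)
    have := hasMellin_sub a.1 b.1
    rw [a.2, b.2, sub_self] at this
    exact this
  have hDc : ContinuousAt D x := by
    refine ContinuousAt.sub ?_ ?_
    · exact Complex.continuous_ofReal.continuousAt.comp (continuousAt_integral_caputoKernel h0 h1 ht hx)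
    · apply Continuous.continuousAt
      simp only [hG2]
      fun_prop
  have h2 : (((1 / 2 : ℝ) : ℂ)).re = 1 / 2 := Complex.ofReal_re _
  have hzero : ∀ y : ℝ, mellin D (((1/2 : ℝ) : ℂ) + y * Complex.I) = 0 := fun y => (hDm _ (by simp)).2
  -- The transform of the difference vanishes on the whole line, so inversion at the continuity
  -- point x gives the value 0.
  have key := mellinInv_mellin_eq (1/2) D hx (hDm _ h2).1 (by
    have : (fun y : ℝ => mellin D (((1/2 : ℝ) : ℂ) + y * Complex.I)) = fun _ => 0 := funext hzero
    rw [Complex.VerticalIntegrable, this]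
    exact integrable_zero _ _ _) hDc
  have hinv : mellinInv (1/2) (mellin D) x = 0 := by
    rw [mellinInv]
    simp only [hzero, smul_zero, integral_zero]
  rw [hinv] at key
  simp only [hD, hG1, hG2] at key
  have key' := (sub_eq_zero.1 key.symm)
  rw [smul_eq_mul, ← Complex.ofReal_mul] at key'
  rw [Complex.ofReal_injective key']; ring

lemma wrightDensity_eq {β t : ℝ} (ht : 0 < t) (s : ℝ) :
    wrightDensity β s t = t ^ (-β) * mWright β (t ^ (-β) * s) := by
  rw [wrightDensity, mWright, Real.rpow_neg ht.le, one_div, div_eq_inv_mul]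

/-- Self-similarity: the substitution s = t^β σ moves all dependence on t from the density into h,
where it can be differentiated. -/
lemma integral_wrightDensity {β t : ℝ} (ht : 0 < t) (h : ℝ → ℝ) :
    ∫ s in Ioi (0:ℝ), h s * wrightDensity β s t = ∫ σ in Ioi (0:ℝ), h (t ^ β * σ) * mWright β σ := by
  have htb : 0 < t ^ β := by positivity
  have := integral_comp_mul_left_Ioi (fun s => h s * mWright β (t ^ (-β) * s)) 0 htb
  rw [mul_zero] at this
  calc _ = ∫ s in Ioi (0:ℝ), (t ^ β)⁻¹ • (h s * mWright β (t ^ (-β) * s)) := by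
        congr 1; ext s; rw [wrightDensity_eq ht, Real.rpow_neg ht.le, smul_eq_mul]; ring
    _ = ∫ σ in Ioi (0:ℝ), h (t ^ β * σ) * mWright β (t ^ (-β) * (t ^ β * σ)) := by
        rw [this, integral_smul]
    _ = _ := by
        congr 1; ext σ
        rw [← mul_assoc, ← Real.rpow_add ht]; simp

lemma integrable_exp_mul_mWright {β : ℝ} (h0 : 0 < β) (h1 : β < 1) (l : ℝ) {n : ℝ} (hn : 0 ≤ n) :
    IntegrableOn (fun σ => Real.exp (l * σ) * σ ^ n * |mWright β σ|) (Ioi 0) := by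
  obtain ⟨C, hC0, hC⟩ := mWright_exp_decay h0 h1 (l + 1)
  have hc := (continuous_mWright h0 h1).measurable
  have hi := Integrable.const_mul (integrableOn_rpow_mul_exp_neg (a := n + 1) (by linarith) one_pos) C
  refine Integrable.mono' hi ?_ ?_
  · apply Measurable.aestronglyMeasurable; fun_prop
  · refine (ae_restrict_mem measurableSet_Ioi).mono fun σ hσ => ?_
    have hσ' : (0:ℝ) < σ := hσ
    rw [Real.norm_of_nonneg (by positivity), add_sub_cancel_right]
    calc Real.exp (l * σ) * σ ^ n * |mWright β σ|
        ≤ Real.exp (l * σ) * σ ^ n * (C * Real.exp (-((l + 1) * σ))) := by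
          gcongr; exact hC σ hσ'.le
      _ = C * (σ ^ n * (Real.exp (l * σ) * Real.exp (-((l + 1) * σ)))) := by ring
      _ = _ := by rw [← Real.exp_add]; ring_nf

lemma integrableOn_comp_mul_mWright {β t C l : ℝ} (h0 : 0 < β) (h1 : β < 1) (ht : 0 < t) {h : ℝ → ℝ}
    (hm : AEStronglyMeasurable h (volume.restrict (Ioi 0)))
    (hb : ∀ s, 0 < s → |h s| ≤ C * Real.exp (l * s)) :
    IntegrableOn (fun s => h s * wrightDensity β s t) (Ioi 0) := by
  have hc := (continuous_mWright h0 h1).measurable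
  have htb : 0 < t ^ β := by positivity
  have hi := integrable_exp_mul_mWright h0 h1 (l * t ^ β) (le_refl 0)
  have hi2 := (integrableOn_Ioi_comp_mul_left_iff (fun s => Real.exp (l * s) *
    |mWright β (t ^ (-β) * s)|) 0 htb).1 (by
      refine hi.congr_fun (fun σ _ => ?_) measurableSet_Ioi
      simp only [Real.rpow_zero, mul_one]
      rw [← mul_assoc (t ^ (-β)), ← Real.rpow_add ht, neg_add_cancel, Real.rpow_zero, one_mul, mul_assoc l])
  rw [mul_zero] at hi2
  refine (hi2.const_mul (C * t ^ (-β))).mono' ?_ ?_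
  · refine hm.mul (Measurable.aestronglyMeasurable ?_)
    simp_rw [wrightDensity_eq ht]
    fun_prop
  · refine (ae_restrict_mem measurableSet_Ioi).mono fun s hs => ?_
    rw [norm_mul, Real.norm_eq_abs, wrightDensity_eq ht, norm_mul, Real.norm_of_nonneg (by positivity),
      Real.norm_eq_abs]
    calc _ ≤ C * Real.exp (l * s) * (t ^ (-β) * |mWright β (t ^ (-β) * s)|) := by
          gcongr; exact hb s hs
      _ = _ := by ring

/-! ### Subordination: Caputo derivative and initial value -/

section Subordination

variable {β C l : ℝ} {h : ℝ → ℝ}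

/-- Differentiation under the integral in the self-similar form: on (t/2, 2t) the factor h' is at
most C exp(l (2t)^β σ), which the decay of M absorbs. -/
lemma hasDerivAt_subordinated {t : ℝ} (h0 : 0 < β) (h1 : β < 1) (hl : 0 ≤ l)
    (hd : ∀ s, 0 < s → DifferentiableAt ℝ h s)
    (hb : ∀ s, 0 < s → |h s| ≤ C * Real.exp (l * s))
    (hb' : ∀ s, 0 < s → |deriv h s| ≤ C * Real.exp (l * s)) (ht : 0 < t) :
    HasDerivAt (fun t => ∫ σ in Ioi (0:ℝ), h (t ^ β * σ) * mWright β σ)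
      (∫ σ in Ioi (0:ℝ), deriv h (t ^ β * σ) * (β * t ^ (β - 1) * σ) * mWright β σ) t := by
  have hc := (continuous_mWright h0 h1).measurable
  have hC : 0 ≤ C := by
    have := (abs_nonneg _).trans (hb 1 one_pos)
    exact nonneg_of_mul_nonneg_left this (Real.exp_pos _)
  have hcont : ContinuousOn h (Ioi 0) := fun s hs => (hd s hs).continuousAt.continuousWithinAt
  have hmeas : ∀ t, 0 < t → AEStronglyMeasurable (fun σ => h (t ^ β * σ) * mWright β σ)
      (volume.restrict (Ioi 0)) := by
    intro t ht
    have htb : 0 < t ^ β := by positivity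
    refine AEStronglyMeasurable.mul ?_ hc.aestronglyMeasurable
    refine ContinuousOn.aestronglyMeasurable (hcont.comp (by fun_prop) fun σ hσ => ?_) measurableSet_Ioi
    exact mul_pos htb hσ
  have hder := measurable_deriv h
  refine (hasDerivAt_integral_of_dominated_loc_of_deriv_le (μ := volume.restrict (Ioi (0:ℝ)))
      (F := fun t σ => h (t ^ β * σ) * mWright β σ)
      (F' := fun t σ => deriv h (t ^ β * σ) * (β * t ^ (β - 1) * σ) * mWright β σ)
      (x₀ := t) (s := Ioo (t / 2) (2 * t))
      (bound := fun σ => C * β * (t/2) ^ (β - 1) * (Real.exp (l * (2 * t) ^ β * σ) * σ ^ (1:ℝ) * |mWright β σ|))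
      (Ioo_mem_nhds (by linarith) (by linarith)) ?_ ?_ ?_ ?_ ?_ ?_).2
  · filter_upwards [Ioi_mem_nhds ht] with t ht using hmeas t ht
  · refine Integrable.mono' ((integrable_exp_mul_mWright h0 h1 (l * t ^ β) (le_refl 0)).const_mul C) (hmeas t ht) ?_
    refine (ae_restrict_mem measurableSet_Ioi).mono fun σ hσ => ?_
    have hσ' : (0:ℝ) < σ := hσ
    rw [norm_mul, Real.norm_eq_abs, Real.norm_eq_abs, Real.rpow_zero, mul_one, ← mul_assoc, mul_assoc l]
    gcongr
    exact hb _ (by positivity)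
  · apply Measurable.aestronglyMeasurable; fun_prop
  · refine (ae_restrict_mem measurableSet_Ioi).mono fun σ hσ t' ht' => ?_
    have hσ' : (0:ℝ) < σ := hσ
    have ht0 : 0 < t' := by linarith [ht'.1]
    have e1 : t' ^ (β - 1) ≤ (t / 2) ^ (β - 1) :=
      Real.rpow_le_rpow_of_nonpos (by linarith) ht'.1.le (by linarith)
    have e2 : t' ^ β ≤ (2 * t) ^ β := Real.rpow_le_rpow ht0.le ht'.2.le h0.le
    rw [norm_mul, norm_mul, Real.norm_eq_abs, Real.norm_eq_abs (mWright _ _),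
      Real.norm_of_nonneg (by positivity), Real.rpow_one]
    calc |deriv h (t' ^ β * σ)| * (β * t' ^ (β - 1) * σ) * |mWright β σ|
        ≤ (C * Real.exp (l * (t' ^ β * σ))) * (β * t' ^ (β - 1) * σ) * |mWright β σ| := by
          gcongr; exact hb' _ (by positivity)
      _ ≤ (C * Real.exp (l * ((2 * t) ^ β * σ))) * (β * (t/2) ^ (β - 1) * σ) * |mWright β σ| := by
          gcongr
      _ = _ := by rw [← mul_assoc l]; ring
  · exact (integrable_exp_mul_mWright h0 h1 _ zero_le_one).const_mul _
  · refine (ae_restrict_mem measurableSet_Ioi).mono fun σ hσ t' ht' => ?_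
    have hσ' : (0:ℝ) < σ := hσ
    have ht0 : 0 < t' := by linarith [ht'.1]
    have htb : 0 < t' ^ β := by positivity
    have hg := (hd (t' ^ β * σ) (by positivity)).hasDerivAt
    have hin : HasDerivAt (fun t : ℝ => t ^ β * σ) (β * t' ^ (β - 1) * σ) t' :=
      (Real.hasDerivAt_rpow_const (Or.inl ht0.ne')).mul_const σ
    exact (hg.comp t' hin).mul_const _

lemma wrightTransform_eq {t : ℝ} (h1 : β < 1) (ht : 0 < t) (h : ℝ → ℝ) :
    wrightTransform β h t = ∫ σ in Ioi (0:ℝ), h (t ^ β * σ) * mWright β σ := by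
  rw [wrightTransform, if_neg h1.ne, integral_wrightDensity ht]

/-- The Caputo derivative of a subordinated function is the subordinated derivative. -/
lemma hasCaputoDerivAt_wrightTransform {t : ℝ} (h0 : 0 < β) (h1 : β < 1) (hl : 0 ≤ l)
    (hd : ∀ s, 0 < s → DifferentiableAt ℝ h s)
    (hb : ∀ s, 0 < s → |h s| ≤ C * Real.exp (l * s))
    (hb' : ∀ s, 0 < s → |deriv h s| ≤ C * Real.exp (l * s)) (ht : 0 < t) :
    HasCaputoDerivAt β (wrightTransform β h) (wrightTransform β (deriv h) t) t := by
  have hc := (continuous_mWright h0 h1).measurable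
  have hder := measurable_deriv h
  have hC : 0 ≤ C := by
    have := (abs_nonneg _).trans (hb 1 one_pos)
    exact nonneg_of_mul_nonneg_left this (Real.exp_pos _)
  have hD : ∀ τ, 0 < τ → HasDerivAt (wrightTransform β h)
      (∫ σ in Ioi (0:ℝ), deriv h (τ ^ β * σ) * (β * τ ^ (β - 1) * σ) * mWright β σ) τ := by
    intro τ hτ
    refine (hasDerivAt_subordinated h0 h1 hl hd hb hb' hτ).congr_of_eventuallyEq ?_
    filter_upwards [Ioi_mem_nhds hτ] with τ hτ using wrightTransform_eq h1 hτ h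
  have hprod : Integrable (fun p : ℝ × ℝ => deriv h p.2 * caputoKernel β t p.1 p.2)
      ((volume.restrict (Ioc 0 t)).prod (volume.restrict (Ioi 0))) := by
    have hm := measurable_caputoKernel h0 h1 t
    have hm' : Measurable fun p : ℝ × ℝ => caputoKernel β t p.1 p.2 := hm
    refine ((integrable_weight_caputoKernel h0 h1 ht (show 0 ≤ l + 1 by linarith)).const_mul C).mono ?_ ?_
    · apply Measurable.aestronglyMeasurable; fun_prop
    · rw [Measure.prod_restrict]
      refine (ae_restrict_mem (measurableSet_Ioc.prod measurableSet_Ioi)).mono ?_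
      rintro ⟨τ, s⟩ ⟨hτ, hs⟩
      have hs' : (0:ℝ) < s := hs
      simp only [norm_mul, ← mul_assoc]
      gcongr
      rw [Real.norm_of_nonneg hC, Real.norm_of_nonneg (Real.exp_pos _).le, Real.norm_eq_abs,
        Real.norm_of_nonneg (by positivity)]
      refine (hb' s hs').trans ?_
      rw [mul_assoc]
      gcongr
      -- One unit of the rate pays for the weight: √s ≤ e^s, hence e^{ls} ≤ s^{-1/2} e^{(l+1)s}.
      have e1 : Real.exp ((l + 1) * s) = Real.exp (l * s) * Real.exp s := by rw [← Real.exp_add]; ring_nf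
      rw [e1, mul_left_comm]
      refine le_mul_of_one_le_right (Real.exp_pos _).le ?_
      rw [Real.rpow_neg hs'.le, ← div_eq_inv_mul, one_le_div (by positivity), ← Real.sqrt_eq_rpow]
      refine Real.sqrt_le_iff.2 ⟨(Real.exp_pos _).le, ?_⟩
      nlinarith [Real.add_one_le_exp s]
  -- Going back to s = τ^β σ turns β τ^{β-1} σ M(σ) dσ into β s τ^{-β-1} M(τ^{-β} s) ds, so the
  -- Caputo integral is a double integral against `caputoKernel`, ready for Fubini.
  have hker : ∀ τ ∈ Ioc 0 t, (t - τ) ^ (-β) * deriv (wrightTransform β h) τ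
      = ∫ s in Ioi (0:ℝ), deriv h s * caputoKernel β t τ s := by
    intro τ hτ
    have hτ0 : 0 < τ := hτ.1
    have htb : 0 < τ ^ β := by positivity
    rw [(hD τ hτ0).deriv]
    have := integral_comp_mul_left_Ioi (fun s => deriv h s * caputoKernel β t τ s) 0 htb
    rw [mul_zero, smul_eq_mul] at this
    have e : ∫ s in Ioi (0:ℝ), deriv h s * caputoKernel β t τ s
      = τ ^ β * ∫ σ in Ioi (0:ℝ), deriv h (τ ^ β * σ) * caputoKernel β t τ (τ ^ β * σ) := by
      rw [this]; field_simp
    rw [e, ← integral_const_mul, ← integral_const_mul]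
    refine setIntegral_congr_fun measurableSet_Ioi fun σ _ => ?_
    have e1 : τ ^ (-β) * (τ ^ β * σ) = σ := by
      rw [← mul_assoc, ← Real.rpow_add hτ0]; simp
    have e2 : τ ^ (β - 1) = τ ^ β * τ ^ β * τ ^ (-β - 1) := by
      rw [← Real.rpow_add hτ0, ← Real.rpow_add hτ0]; ring_nf
    simp only [caputoKernel]
    rw [e1, e2]; ring
  have hInt : IntegrableOn (fun τ => (t - τ) ^ (-β) * deriv (wrightTransform β h) τ) (Ioc 0 t) :=
    IntegrableOn.congr_fun hprod.integral_prod_left (fun τ hτ => (hker τ hτ).symm) measurableSet_Ioc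
  refine ⟨fun τ hτ => (hD τ hτ.1).differentiableAt, Or.inr ⟨h1, ?_, ?_⟩⟩
  · exact (intervalIntegrable_iff_integrableOn_Ioc_of_le ht.le).2 hInt
  · have hΓ : Real.Gamma (1 - β) ≠ 0 := (Real.Gamma_pos_of_pos (by linarith)).ne'
    rw [intervalIntegral.integral_of_le ht.le, setIntegral_congr_fun measurableSet_Ioc hker,
      integral_integral_swap (f := fun τ s => deriv h s * caputoKernel β t τ s) hprod]
    have : ∀ s ∈ Ioi (0:ℝ), ∫ τ in Ioc 0 t, deriv h s * caputoKernel β t τ s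
        = Real.Gamma (1 - β) * (deriv h s * wrightDensity β s t) := by
      intro s hs
      rw [integral_const_mul, integral_caputoKernel h0 h1 ht hs, wrightDensity_eq ht]; ring
    rw [setIntegral_congr_fun measurableSet_Ioi this, integral_const_mul, wrightTransform, if_neg h1.ne]
    field_simp

/-- The initial value of a subordinated function. -/
lemma tendsto_wrightTransform {a : ℝ} (h0 : 0 < β) (h1 : β < 1) (hl : 0 ≤ l)
    (hm : AEStronglyMeasurable h (volume.restrict (Ioi 0)))
    (hb : ∀ s, 0 < s → |h s| ≤ C * Real.exp (l * s)) (ha : Tendsto h (𝓝[>] 0) (𝓝 a)) :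
    Tendsto (wrightTransform β h) (𝓝[>] 0) (𝓝 a) := by
  have hc := (continuous_mWright h0 h1).measurable
  have hC : 0 ≤ C := by
    have := (abs_nonneg _).trans (hb 1 one_pos)
    exact nonneg_of_mul_nonneg_left this (Real.exp_pos _)
  have hlim : Tendsto (fun t : ℝ => ∫ σ in Ioi (0:ℝ), h (t ^ β * σ) * mWright β σ) (𝓝[>] 0)
      (𝓝 (∫ σ in Ioi (0:ℝ), a * mWright β σ)) := by
    refine tendsto_integral_filter_of_dominated_convergence
      (fun σ => C * (Real.exp (l * σ) * σ ^ (0:ℝ) * |mWright β σ|)) ?_ ?_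
      ((integrable_exp_mul_mWright h0 h1 l (le_refl 0)).const_mul C) ?_
    · filter_upwards [self_mem_nhdsWithin] with t ht
      have ht' : (0:ℝ) < t := ht
      have htb : 0 < t ^ β := by positivity
      refine AEStronglyMeasurable.mul ?_ hc.aestronglyMeasurable
      have hq : Measure.QuasiMeasurePreserving (fun σ : ℝ => t ^ β * σ) (volume.restrict (Ioi 0))
          (volume.restrict (Ioi 0)) := by
        have h1 : Measure.QuasiMeasurePreserving (fun σ : ℝ => t ^ β * σ) volume volume :=
          ⟨measurable_const_mul _, by
            rw [Real.map_volume_mul_left htb.ne']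
            exact Measure.smul_absolutelyContinuous⟩
        exact h1.restrict fun σ hσ => mul_pos htb hσ
      exact hm.comp_quasiMeasurePreserving hq
    · filter_upwards [Ioo_mem_nhdsGT (zero_lt_one' ℝ)] with t ht
      refine (ae_restrict_mem measurableSet_Ioi).mono fun σ hσ => ?_
      have ht' : (0:ℝ) < t := ht.1
      have hσ' : (0:ℝ) < σ := hσ
      have : t ^ β ≤ 1 := Real.rpow_le_one ht.1.le ht.2.le h0.le
      rw [norm_mul, Real.norm_eq_abs, Real.norm_eq_abs, Real.rpow_zero, mul_one, ← mul_assoc]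
      gcongr
      refine (hb _ (by positivity)).trans ?_
      gcongr
      exact mul_le_of_le_one_left hσ'.le this
    · refine (ae_restrict_mem measurableSet_Ioi).mono fun σ hσ => ?_
      have hσ' : (0:ℝ) < σ := hσ
      refine Tendsto.mul_const _ (ha.comp ?_)
      refine tendsto_nhdsWithin_of_tendsto_nhds_of_eventually_within _ ?_ ?_
      · have := ((Real.continuousAt_rpow_const 0 β (Or.inr h0.le)).tendsto).mul_const σ
        rw [Real.zero_rpow h0.ne', zero_mul] at this
        exact this.mono_left nhdsWithin_le_nhds
      · filter_upwards [self_mem_nhdsWithin] with t ht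
        have ht' : (0:ℝ) < t := ht
        exact mul_pos (by positivity) hσ'
  rw [integral_const_mul, integral_mWright h0 h1, mul_one] at hlim
  refine hlim.congr' ?_
  filter_upwards [self_mem_nhdsWithin] with t ht using (wrightTransform_eq h1 ht h).symm

end Subordination

/-! ### The normal form of the modified Bessel equation -/

/-- `g` solves the normal form `g'' = (1 + κ / z²) g` of the modified Bessel equation, and `g'` is
its derivative. -/
def SolvesNormalBessel (κ : ℝ) (g g' : ℝ → ℝ) : Prop :=
  ∀ z, 0 < z → HasDerivAt g (g' z) z ∧ HasDerivAt g' ((1 + κ / z ^ 2) * g z) z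

/-- In the variable x = z²/4 the equation becomes x Ψ'' + (c+1) Ψ' = Ψ. One computation therefore
serves I_a (c = a, a power series) and K_a (c = -a, an integral). -/
lemma solvesNormalBessel_rpow_mul {c : ℝ} {Ψ Ψ₁ Ψ₂ : ℝ → ℝ}
    (h1 : ∀ x, 0 < x → HasDerivAt Ψ (Ψ₁ x) x) (h2 : ∀ x, 0 < x → HasDerivAt Ψ₁ (Ψ₂ x) x)
    (hode : ∀ x, 0 < x → x * Ψ₂ x + (c + 1) * Ψ₁ x = Ψ x) :
    SolvesNormalBessel (c ^ 2 - 1 / 4) (fun z => z ^ (c + 1 / 2) * Ψ (z ^ 2 / 4))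
      (fun z => (c + 1 / 2) * z ^ (c - 1 / 2) * Ψ (z ^ 2 / 4) + z ^ (c + 3 / 2) / 2 * Ψ₁ (z ^ 2 / 4)) := by
  intro z hz
  have hx : 0 < z ^ 2 / 4 := by positivity
  have hin : HasDerivAt (fun z : ℝ => z ^ 2 / 4) (z / 2) z := by
    have := (hasDerivAt_pow 2 z).div_const 4
    refine this.congr_deriv ?_
    norm_num; ring
  have hΨ : HasDerivAt (fun z => Ψ (z ^ 2 / 4)) (Ψ₁ (z ^ 2 / 4) * (z / 2)) z := (h1 _ hx).comp z hin
  have hΨ₁ : HasDerivAt (fun z => Ψ₁ (z ^ 2 / 4)) (Ψ₂ (z ^ 2 / 4) * (z / 2)) z := (h2 _ hx).comp z hin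
  have hp : ∀ p : ℝ, HasDerivAt (fun z : ℝ => z ^ p) (p * z ^ (p - 1)) z := fun p =>
    Real.hasDerivAt_rpow_const (Or.inl hz.ne')
  have e1 : z ^ (c + 1 / 2) = z ^ (c - 1 / 2) * z := by rw [← Real.rpow_add_one hz.ne']; ring_nf
  have e2 : z ^ (c + 3 / 2) = z ^ (c - 1 / 2) * z ^ 2 := by
    rw [← Real.rpow_add_natCast hz.ne']; push_cast; ring_nf
  have e3 : z ^ (c + 1 / 2 - 1) = z ^ (c - 1 / 2) := by ring_nf
  have e4 : z ^ (c - 1 / 2 - 1) = z ^ (c - 1 / 2) / z := by rw [Real.rpow_sub_one hz.ne']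
  have e5 : z ^ (c + 3 / 2 - 1) = z ^ (c - 1 / 2) * z := by rw [← Real.rpow_add_one hz.ne']; ring_nf
  constructor
  · refine ((hp (c + 1 / 2)).mul hΨ).congr_deriv ?_
    beta_reduce
    rw [e3, e1, e2]; ring
  · refine ((((hp (c - 1 / 2)).const_mul (c + 1 / 2)).mul hΨ).add
      (((hp (c + 3 / 2)).div_const 2).mul hΨ₁)).congr_deriv ?_
    have ho := hode _ hx
    beta_reduce
    rw [e4, e5, e1, e2, ← ho]
    field_simp
    ring

lemma SolvesNormalBessel.const_mul {κ : ℝ} {g g' : ℝ → ℝ} (h : SolvesNormalBessel κ g g') (c : ℝ) :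
    SolvesNormalBessel κ (fun z => c * g z) (fun z => c * g' z) := fun z hz =>
  ⟨(h z hz).1.const_mul c, ((h z hz).2.const_mul c).congr_deriv (by ring)⟩

lemma SolvesNormalBessel.congr {κ : ℝ} {g g' f : ℝ → ℝ} (h : SolvesNormalBessel κ g g')
    (hf : ∀ z, 0 < z → f z = g z) : SolvesNormalBessel κ f g' := fun z hz =>
  ⟨(h z hz).1.congr_of_eventuallyEq (by filter_upwards [Ioi_mem_nhds hz] with w hw using hf w hw),
    by rw [hf z hz]; exact (h z hz).2⟩

lemma SolvesNormalBessel.continuousOn {κ : ℝ} {g g' : ℝ → ℝ} (h : SolvesNormalBessel κ g g') :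
    ContinuousOn g (Ioi 0) := fun z hz => (h z hz).1.continuousAt.continuousWithinAt

/-! ### The function `I_a` -/

/-- Valid at the poles too, where Γ has the default value 0; the recurrences below thus hold for
every real order. -/
lemma inv_Gamma_eq (s : ℝ) : (Real.Gamma s)⁻¹ = s * (Real.Gamma (s + 1))⁻¹ := by
  rcases eq_or_ne s 0 with rfl | hs
  · simp [Real.Gamma_zero]
  · rw [Real.Gamma_add_one hs, mul_inv]; field_simp

/-- The coefficients of the entire part of `I_a`. -/
def besselCoeff (a : ℝ) (m : ℕ) : ℝ := ((m.factorial : ℝ) * Real.Gamma (m + a + 1))⁻¹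

/-- The entire part of `I_a`: `I_a(z) = (z/2)^a Ψ_a(z²/4)`. -/
def besselPsi (a x : ℝ) : ℝ := ∑' m : ℕ, besselCoeff a m * x ^ m

lemma besselCoeff_succ (a : ℝ) (m : ℕ) :
    ((m : ℝ) + 1) * besselCoeff a (m + 1) = besselCoeff (a + 1) m := by
  have hm : ((m:ℝ) + 1) ≠ 0 := by positivity
  rw [besselCoeff, besselCoeff, Nat.factorial_succ, mul_inv, mul_inv]
  push_cast
  rw [mul_inv]
  have : (m : ℝ) + 1 + a + 1 = m + (a + 1) + 1 := by ring
  rw [this]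
  field_simp

lemma summable_besselCoeff (a x : ℝ) : Summable fun m : ℕ => besselCoeff a m * x ^ m := by
  refine Summable.of_norm_bounded_eventually_nat (g := fun m : ℕ => |x| ^ m / (m.factorial : ℝ))
    (Real.summable_pow_div_factorial _) ?_
  filter_upwards [(tendsto_natCast_atTop_atTop (R := ℝ)).eventually_ge_atTop (1 - a)] with m hm
  have h2 : (1:ℝ) ≤ Real.Gamma (m + a + 1) := by
    calc (1:ℝ) = Real.Gamma 2 := Real.Gamma_two.symm
      _ ≤ _ := Real.Gamma_strictMonoOn_Ici.monotoneOn (by simp) (by simp; linarith) (by linarith)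
  rw [besselCoeff, norm_mul, norm_pow, norm_inv, norm_mul, Real.norm_eq_abs x, Real.norm_natCast,
    Real.norm_of_nonneg (by linarith : 0 ≤ Real.Gamma (m + a + 1)), mul_comm, div_eq_mul_inv]
  gcongr
  exact le_mul_of_one_le_right (by positivity) h2

/-- Termwise differentiation: by `besselCoeff_succ` the shifted coefficients are those of order a +
1. -/
lemma hasDerivAt_besselPsi (a x : ℝ) : HasDerivAt (besselPsi a) (besselPsi (a + 1) x) x := by
  set R := |x| + 1 with hR
  have hx : x ∈ Ioo (-R) R := abs_lt.1 (by linarith)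
  have hterm : ∀ (m : ℕ) (y : ℝ), HasDerivAt (fun y => besselCoeff a m * y ^ m)
      (besselCoeff a m * (m * y ^ (m - 1))) y := fun m y => (hasDerivAt_pow m y).const_mul _
  have hshift : ∀ (y : ℝ) (m : ℕ), besselCoeff a (m + 1) * (((m + 1 : ℕ) : ℝ) * y ^ (m + 1 - 1))
      = besselCoeff (a + 1) m * y ^ m := by
    intro y m
    rw [← besselCoeff_succ, Nat.add_sub_cancel]; push_cast; ring
  have hu : Summable fun m : ℕ => |besselCoeff a m| * (m * R ^ (m - 1)) := by
    rw [← summable_nat_add_iff 1]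
    have := (summable_besselCoeff (a + 1) R).norm
    refine this.congr fun m => ?_
    rw [← hshift R m, norm_mul, Real.norm_eq_abs, Real.norm_of_nonneg (by positivity)]
  have := hasDerivAt_tsum_of_isPreconnected (t := Ioo (-R) R) hu isOpen_Ioo isPreconnected_Ioo
    (fun m y _ => hterm m y) (fun m y hy => ?_) hx (summable_besselCoeff a x) hx
  · refine this.congr_deriv ?_
    rw [besselPsi, (Summable.of_norm_bounded hu fun m => ?_).tsum_eq_zero_add]
    · simp only [hshift]; simp
    · rw [norm_mul, norm_mul, norm_pow, Real.norm_eq_abs, Real.norm_natCast]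
      gcongr
      rw [Real.norm_eq_abs]; linarith
  · rw [norm_mul, norm_mul, norm_pow, Real.norm_eq_abs, Real.norm_natCast]
    gcongr
    rw [Real.norm_eq_abs]; exact (abs_lt.2 hy).le

/-- The coefficients of order a - 1 are (a + m) times those of order a, and the part with the factor
m is x Ψ_a'(x). -/
lemma besselPsi_recurrence (a x : ℝ) :
    besselPsi (a - 1) x = a * besselPsi a x + x * besselPsi (a + 1) x := by
  have hc : ∀ m : ℕ, besselCoeff (a - 1) m * x ^ m
      = a * (besselCoeff a m * x ^ m) + (m * besselCoeff a m) * x ^ m := by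
    intro m
    have : besselCoeff (a - 1) m = (a + m) * besselCoeff a m := by
      rw [besselCoeff, besselCoeff, mul_inv, mul_inv, inv_Gamma_eq (m + (a - 1) + 1)]
      have : (m : ℝ) + (a - 1) + 1 = m + a := by ring
      rw [this]; ring
    rw [this]; ring
  have h1 := (summable_besselCoeff a x).hasSum.mul_left a
  have h2 : HasSum (fun m : ℕ => (m * besselCoeff a m) * x ^ m) (x * besselPsi (a + 1) x) := by
    rw [← hasSum_nat_add_iff' 1]
    simp only [Finset.range_one, Finset.sum_singleton, Nat.cast_zero, zero_mul, sub_zero]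
    have e : ∀ m : ℕ, ((m + 1 : ℕ) : ℝ) * besselCoeff a (m + 1) * x ^ (m + 1)
        = x * (besselCoeff (a + 1) m * x ^ m) := fun m => by
      rw [← besselCoeff_succ]; push_cast; ring
    simp_rw [e]
    exact (summable_besselCoeff (a + 1) x).hasSum.mul_left x
  rw [besselPsi]
  simp_rw [hc]
  exact (h1.add h2).tsum_eq

lemma besselPsi_ode (a x : ℝ) :
    x * besselPsi (a + 1 + 1) x + (a + 1) * besselPsi (a + 1) x = besselPsi a x := by
  have := besselPsi_recurrence (a + 1) x
  rw [add_sub_cancel_right] at this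
  rw [this]; ring

lemma besselI_eq (a : ℝ) {z : ℝ} (hz : 0 < z) :
    besselI a z = (z / 2) ^ a * besselPsi a (z ^ 2 / 4) := by
  rw [besselI, besselPsi, ← tsum_mul_left]
  refine tsum_congr fun m => ?_
  have h2 : 0 < z / 2 := by positivity
  have : (z / 2) ^ (2 * (m:ℝ) + a) = (z / 2) ^ a * (z ^ 2 / 4) ^ m := by
    rw [add_comm, Real.rpow_add h2, Real.rpow_mul h2.le, Real.rpow_natCast]
    congr 2
    norm_num; ring
  rw [this, besselCoeff]; ring

/-- `√z I_a(z)`. -/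
def normalI (a z : ℝ) : ℝ := √z * besselI a z

lemma normalI_eq (a : ℝ) {z : ℝ} (hz : 0 < z) :
    normalI a z = 2 ^ (-a) * (z ^ (a + 1 / 2) * besselPsi a (z ^ 2 / 4)) := by
  rw [normalI, besselI_eq a hz, Real.div_rpow hz.le (by norm_num), Real.sqrt_eq_rpow,
    Real.rpow_add hz, Real.rpow_neg (by norm_num)]
  field_simp

/-- The derivative of `√z I_a(z)`. -/
def normalI' (a z : ℝ) : ℝ := 2 ^ (-a) * ((a + 1 / 2) * z ^ (a - 1 / 2) * besselPsi a (z ^ 2 / 4)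
  + z ^ (a + 3 / 2) / 2 * besselPsi (a + 1) (z ^ 2 / 4))

lemma solves_normalI (a : ℝ) : SolvesNormalBessel (a ^ 2 - 1 / 4) (normalI a) (normalI' a) :=
  ((solvesNormalBessel_rpow_mul (fun x _ => hasDerivAt_besselPsi a x)
    (fun x _ => hasDerivAt_besselPsi (a + 1) x) (fun x _ => besselPsi_ode a x)).const_mul _).congr
    fun _ hz => normalI_eq a hz

lemma normalI_recurrence (a : ℝ) {z : ℝ} (hz : 0 < z) :
    normalI (a - 1) z = normalI (a + 1) z + 2 * a / z * normalI a z := by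
  have h2 : 0 < z / 2 := by positivity
  rw [normalI, normalI, normalI, besselI_eq _ hz, besselI_eq _ hz, besselI_eq _ hz, besselPsi_recurrence,
    Real.rpow_sub_one h2.ne', Real.rpow_add_one h2.ne']
  field_simp
  ring

/-! ### Asymptotics of `I_a` -/

/-- A Beta integral after y = t²; the indicator of (0, 1] lets the substitution be made on the
half-line. -/
lemma integral_pow_mul_one_sub_sq (m : ℕ) {a : ℝ} (ha : 1 / 2 ≤ a) :
    ∫ t in (0:ℝ)..1, t ^ (2 * m) * (1 - t ^ 2) ^ (a - 1 / 2)
      = Real.Gamma (m + 1 / 2) * Real.Gamma (a + 1 / 2) / (2 * Real.Gamma (m + a + 1)) := by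
  set g : ℝ → ℝ := (Ioc 0 1).indicator fun y => y ^ ((m:ℝ) - 1 / 2) * (1 - y) ^ (a - 1 / 2) with hg
  have hB := Complex.Gamma_mul_Gamma_eq_betaIntegral (s := ((m + 1/2 : ℝ) : ℂ)) (t := ((a + 1/2 : ℝ) : ℂ))
    (by rw [Complex.ofReal_re]; positivity) (by rw [Complex.ofReal_re]; linarith)
  have hbeta : Complex.betaIntegral ((m + 1/2 : ℝ) : ℂ) ((a + 1/2 : ℝ) : ℂ)
      = ((∫ y in (0:ℝ)..1, y ^ ((m:ℝ) - 1 / 2) * (1 - y) ^ (a - 1 / 2) : ℝ) : ℂ) := by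
    rw [Complex.betaIntegral, ← intervalIntegral.integral_ofReal]
    refine intervalIntegral.integral_congr fun y hy => ?_
    rw [uIcc_of_le zero_le_one] at hy
    rw [Complex.ofReal_mul, Complex.ofReal_cpow hy.1, Complex.ofReal_cpow (by linarith [hy.2])]
    push_cast
    ring_nf
  rw [hbeta, Complex.Gamma_ofReal, Complex.Gamma_ofReal, ← Complex.ofReal_add, Complex.Gamma_ofReal] at hB
  have hB' : Real.Gamma (m + 1/2) * Real.Gamma (a + 1/2) = Real.Gamma (m + a + 1) *
      ∫ y in (0:ℝ)..1, y ^ ((m:ℝ) - 1 / 2) * (1 - y) ^ (a - 1 / 2) := by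
    have : (m:ℝ) + 1/2 + (a + 1/2) = m + a + 1 := by ring
    rw [this] at hB
    exact_mod_cast hB
  have hΓ : 0 < Real.Gamma (m + a + 1) := Real.Gamma_pos_of_pos (by positivity)
  have hsub := integral_comp_rpow_Ioi_of_pos (g := g) (p := 2) (by norm_num)
  have hR : ∫ y in Ioi (0:ℝ), g y = ∫ y in (0:ℝ)..1, y ^ ((m:ℝ) - 1 / 2) * (1 - y) ^ (a - 1 / 2) := by
    rw [hg, setIntegral_indicator measurableSet_Ioc, intervalIntegral.integral_of_le zero_le_one,
      inter_eq_self_of_subset_right Ioc_subset_Ioi_self]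
  have hL : ∫ t in Ioi (0:ℝ), ((2:ℝ) * t ^ ((2:ℝ) - 1)) • g (t ^ (2:ℝ))
      = 2 * ∫ t in (0:ℝ)..1, t ^ (2 * m) * (1 - t ^ 2) ^ (a - 1 / 2) := by
    rw [← intervalIntegral.integral_const_mul, intervalIntegral.integral_of_le zero_le_one,
      show (Ioc (0:ℝ) 1) = Ioi 0 ∩ Ioc 0 1 from (inter_eq_self_of_subset_right Ioc_subset_Ioi_self).symm,
      ← setIntegral_indicator measurableSet_Ioc]
    refine setIntegral_congr_fun measurableSet_Ioi fun t ht => ?_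
    have ht' : (0:ℝ) < t := ht
    simp only [hg, smul_eq_mul, Real.rpow_two]
    by_cases h : t ∈ Ioc (0:ℝ) 1
    · have h' : t ^ 2 ∈ Ioc (0:ℝ) 1 := ⟨by positivity, by nlinarith [h.2]⟩
      rw [indicator_of_mem h, indicator_of_mem h']
      have e : t ^ (2 * m) = t ^ ((2:ℝ) - 1) * (t ^ 2) ^ ((m:ℝ) - 1 / 2) := by
        rw [← Real.rpow_natCast t 2, ← Real.rpow_mul ht'.le, ← Real.rpow_add ht', ← Real.rpow_natCast]
        congr 1; push_cast; ring
      rw [e]; ring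
    · have h' : t ^ 2 ∉ Ioc (0:ℝ) 1 := fun h' => h ⟨ht', by nlinarith [h'.2]⟩
      rw [indicator_of_notMem h, indicator_of_notMem h', mul_zero]
  rw [hL, hR] at hsub
  rw [eq_div_iff (by positivity), hB', ← hsub]; ring

/-- Poisson's integral. -/
lemma besselPsi_eq_integral {a z : ℝ} (ha : 1 / 2 ≤ a) :
    ∫ t in (0:ℝ)..1, (1 - t ^ 2) ^ (a - 1 / 2) * Real.cosh (z * t)
      = √π / 2 * Real.Gamma (a + 1 / 2) * besselPsi a (z ^ 2 / 4) := by
  have hcont : Continuous fun t : ℝ => (1 - t ^ 2) ^ (a - 1 / 2) :=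
    (by fun_prop : Continuous fun t : ℝ => 1 - t ^ 2).rpow_const fun _ => Or.inr (by linarith)
  set F : ℕ → ℝ → ℝ := fun m t => z ^ (2 * m) / ((2 * m).factorial : ℝ) *
    (t ^ (2 * m) * (1 - t ^ 2) ^ (a - 1 / 2)) with hF
  have hFc : ∀ m, Continuous (F m) := fun m => by simp only [hF]; fun_prop
  have h := hasSum_integral_of_summable_integral_norm (μ := volume.restrict (Ioc 0 1)) (F := F)
    (fun m => (hFc m).integrableOn_Ioc) ?_
  · have h1 : ∀ t : ℝ, ∑' m, F m t = (1 - t ^ 2) ^ (a - 1 / 2) * Real.cosh (z * t) := by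
      intro t
      have := (Real.hasSum_cosh (z * t)).mul_left ((1 - t ^ 2) ^ (a - 1 / 2))
      rw [← this.tsum_eq]
      refine tsum_congr fun m => ?_
      simp only [hF]; rw [mul_pow]; ring
    simp_rw [h1] at h
    rw [intervalIntegral.integral_of_le zero_le_one, ← h.tsum_eq, besselPsi, ← tsum_mul_left]
    refine tsum_congr fun m => ?_
    simp only [hF]
    rw [integral_const_mul, ← intervalIntegral.integral_of_le zero_le_one,
      integral_pow_mul_one_sub_sq m ha, besselCoeff]
    have hΓ : 0 < Real.Gamma (m + a + 1) := Real.Gamma_pos_of_pos (by positivity)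
    -- The duplication formula gives Γ(m + 1/2) = (2m)! √π / (4^m m!), which converts the
    -- coefficients of cosh into those of Ψ_a.
    have hd := Real.Gamma_mul_Gamma_add_half ((m:ℝ) + 1 / 2)
    have e1 : (m:ℝ) + 1/2 + 1/2 = m + 1 := by ring
    have e2 : 2 * ((m:ℝ) + 1/2) = ((2 * m : ℕ) : ℝ) + 1 := by push_cast; ring
    have e3 : 1 - (((2 * m : ℕ) : ℝ) + 1) = -((2 * m : ℕ) : ℝ) := by ring
    rw [e1, e2, e3, Real.Gamma_nat_eq_factorial, Real.Gamma_nat_eq_factorial, Real.rpow_neg (by norm_num),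
      Real.rpow_natCast, pow_mul] at hd
    have hm : ((m.factorial : ℝ)) ≠ 0 := by positivity
    have hG : Real.Gamma (m + 1/2) = ((2 * m).factorial : ℝ) * ((2 ^ 2) ^ m : ℝ)⁻¹ * √π / (m.factorial : ℝ) := by
      rw [← hd]; field_simp
    rw [hG, pow_mul, div_pow]
    field_simp
    norm_num
  · refine (Real.hasSum_cosh z).summable.of_nonneg_of_le (fun m => by positivity) fun m => ?_
    have hzm : 0 ≤ z ^ (2 * m) / ((2 * m).factorial : ℝ) := by
      rw [pow_mul]; positivity
    have : ∫ t in Ioc (0:ℝ) 1, ‖F m t‖ ≤ ∫ t in Ioc (0:ℝ) 1, z ^ (2 * m) / ((2 * m).factorial : ℝ) := by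
      refine setIntegral_mono_on ((hFc m).norm.integrableOn_Ioc) (by simp) measurableSet_Ioc fun t ht => ?_
      have ht0 := ht.1
      have h1 : 0 ≤ 1 - t ^ 2 := by nlinarith [ht.2]
      simp only [hF]
      rw [Real.norm_of_nonneg (by positivity)]
      refine mul_le_of_le_one_right hzm ?_
      refine mul_le_one₀ (pow_le_one₀ ht0.le ht.2) (by positivity) (Real.rpow_le_one h1 (by nlinarith) (by linarith))
    simpa using this

/-- Poisson's integral in the variable w = z(1 - t), measured from the endpoint t = 1 where cosh(zt)
concentrates. There 1 - t² = (w/z)(2 - w/z), and e^{-z} cosh(zt) is e^{-w}/2 plus the remainder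
e^{-(2z-w)}/2. -/
lemma normalI_exp_eq_integral {a z : ℝ} (ha : 1 / 2 ≤ a) (hz : 0 < z) :
    normalI a z * Real.exp (-z) = 2 ^ (-a) * (2 / (√π * Real.Gamma (a + 1 / 2))) *
      ∫ w in Ioi (0:ℝ), (Ioc 0 z).indicator (fun w => w ^ (a - 1 / 2) * (2 - w / z) ^ (a - 1 / 2) *
        ((Real.exp (-w) + Real.exp (-(2 * z - w))) / 2)) w := by
  have hΓ : 0 < Real.Gamma (a + 1 / 2) := Real.Gamma_pos_of_pos (by linarith)
  have hπ : 0 < √π := Real.sqrt_pos.2 Real.pi_pos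
  have hP := besselPsi_eq_integral (z := z) ha
  have hΨ : besselPsi a (z ^ 2 / 4) = 2 / (√π * Real.Gamma (a + 1 / 2)) *
      ∫ t in (0:ℝ)..1, (1 - t ^ 2) ^ (a - 1 / 2) * Real.cosh (z * t) := by
    rw [hP]; field_simp
  have hsub := intervalIntegral.integral_comp_sub_div (a := 0) (b := z)
    (fun t => (1 - t ^ 2) ^ (a - 1 / 2) * Real.cosh (z * t)) hz.ne' 1
  rw [div_self hz.ne', sub_self, zero_div, sub_zero, smul_eq_mul] at hsub
  rw [setIntegral_indicator measurableSet_Ioc, inter_eq_self_of_subset_right Ioc_subset_Ioi_self,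
    ← intervalIntegral.integral_of_le hz.le, normalI_eq a hz, hΨ]
  have hint : ∫ w in (0:ℝ)..z, w ^ (a - 1 / 2) * (2 - w / z) ^ (a - 1 / 2) *
        ((Real.exp (-w) + Real.exp (-(2 * z - w))) / 2)
      = z ^ (a - 1 / 2) * Real.exp (-z) *
        ∫ w in (0:ℝ)..z, (1 - (1 - w / z) ^ 2) ^ (a - 1 / 2) * Real.cosh (z * (1 - w / z)) := by
    rw [← intervalIntegral.integral_const_mul]
    refine intervalIntegral.integral_congr fun w hw => ?_
    rw [uIcc_of_le hz.le] at hw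
    have hwz : w / z ≤ 1 := (div_le_one hz).2 hw.2
    have e1 : 1 - (1 - w / z) ^ 2 = (w / z) * (2 - w / z) := by ring
    have e2 : z * (1 - w / z) = z - w := by field_simp
    rw [e1, e2, Real.mul_rpow (div_nonneg hw.1 hz.le) (by linarith), Real.div_rpow hw.1 hz.le, Real.cosh_eq]
    have e3 : Real.exp (-w) + Real.exp (-(2 * z - w)) = Real.exp (-z) * (Real.exp (z - w) + Real.exp (-(z - w))) := by
      rw [mul_add, ← Real.exp_add, ← Real.exp_add]; ring_nf
    have hzp : z ^ (a - 1 / 2) ≠ 0 := by positivity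
    rw [e3]; field_simp
  rw [hint, hsub]
  have : z ^ (a + 1 / 2) = z ^ (a - 1 / 2) * z := by rw [← Real.rpow_add_one hz.ne']; ring_nf
  rw [this]; ring

/-- For 0 < w ≤ z and a ≥ 1/2 the integrand is at most 2^{a-1/2} w^{a-1/2} e^{-w}, and it tends to
half of this. The resulting Γ(a + 1/2) cancels the one in Poisson's prefactor. -/
lemma tendsto_normalI_of_half_le {a : ℝ} (ha : 1 / 2 ≤ a) :
    Tendsto (fun z => normalI a z * Real.exp (-z)) atTop (𝓝 (√(2 * π))⁻¹) := by
  have hΓ : 0 < Real.Gamma (a + 1 / 2) := Real.Gamma_pos_of_pos (by linarith)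
  have hπ : 0 < √π := Real.sqrt_pos.2 Real.pi_pos
  have hgam : IntegrableOn (fun w : ℝ => w ^ (a - 1 / 2) * Real.exp (-w)) (Ioi 0) := by
    have := integrableOn_rpow_mul_exp_neg (a := a + 1/2) (by linarith) one_pos
    refine this.congr_fun (fun w _ => ?_) measurableSet_Ioi
    ring_nf
  have hgamI : ∫ w in Ioi (0:ℝ), w ^ (a - 1 / 2) * 2 ^ (a - 1 / 2) * (Real.exp (-w) / 2)
      = 2 ^ (a - 1 / 2) / 2 * Real.Gamma (a + 1 / 2) := by
    have := Real.integral_rpow_mul_exp_neg_mul_Ioi (a := a + 1/2) (r := 1) (by linarith) one_pos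
    rw [div_one, Real.one_rpow, one_mul] at this
    rw [← this, ← integral_const_mul]
    refine setIntegral_congr_fun measurableSet_Ioi fun w _ => ?_
    ring_nf
  have hlim : Tendsto (fun z : ℝ => ∫ w in Ioi (0:ℝ), (Ioc 0 z).indicator (fun w =>
      w ^ (a - 1 / 2) * (2 - w / z) ^ (a - 1 / 2) * ((Real.exp (-w) + Real.exp (-(2 * z - w))) / 2)) w)
      atTop (𝓝 (∫ w in Ioi (0:ℝ), w ^ (a - 1 / 2) * 2 ^ (a - 1 / 2) * (Real.exp (-w) / 2))) := by
    refine tendsto_integral_filter_of_dominated_convergence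
      (fun w => 2 ^ (a - 1 / 2) * (w ^ (a - 1 / 2) * Real.exp (-w))) ?_ ?_ (hgam.const_mul _) ?_
    · refine Eventually.of_forall fun z => Measurable.aestronglyMeasurable ?_
      exact Measurable.indicator (by fun_prop) measurableSet_Ioc
    · filter_upwards [eventually_gt_atTop 0] with z hz
      refine (ae_restrict_mem measurableSet_Ioi).mono fun w hw => ?_
      have hw' : (0:ℝ) < w := hw
      by_cases h : w ∈ Ioc 0 z
      · rw [indicator_of_mem h]
        have hwz : w / z ≤ 1 := (div_le_one hz).2 h.2
        have hwz0 : 0 < w / z := by positivity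
        have h2 : (0:ℝ) ≤ 2 - w / z := by linarith
        rw [Real.norm_of_nonneg (by positivity)]
        have e1 : (2 - w / z) ^ (a - 1 / 2) ≤ 2 ^ (a - 1/2) :=
          Real.rpow_le_rpow h2 (by linarith) (by linarith)
        have e2 : Real.exp (-(2 * z - w)) ≤ Real.exp (-w) := Real.exp_le_exp.2 (by linarith [h.2])
        calc _ ≤ w ^ (a - 1 / 2) * 2 ^ (a - 1/2) * ((Real.exp (-w) + Real.exp (-w)) / 2) := by gcongr
          _ = _ := by ring
      · rw [indicator_of_notMem h, norm_zero]; positivity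
    · refine (ae_restrict_mem measurableSet_Ioi).mono fun w hw => ?_
      have hw' : (0:ℝ) < w := hw
      have l1 : Tendsto (fun z : ℝ => (2 - w / z) ^ (a - 1 / 2)) atTop (𝓝 (2 ^ (a - 1 / 2))) := by
        have : Tendsto (fun z : ℝ => 2 - w / z) atTop (𝓝 (2 - 0)) :=
          (tendsto_const_nhds.div_atTop tendsto_id).const_sub 2
        rw [sub_zero] at this
        exact this.rpow_const (Or.inl (by norm_num))
      have l2 : Tendsto (fun z : ℝ => (Real.exp (-w) + Real.exp (-(2 * z - w))) / 2) atTop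
          (𝓝 ((Real.exp (-w) + 0) / 2)) := by
        refine Tendsto.div_const (Tendsto.const_add _ ?_) _
        refine Real.tendsto_exp_atBot.comp (tendsto_neg_atTop_atBot.comp ?_)
        exact tendsto_atTop_add_const_right _ _ (tendsto_id.const_mul_atTop (by norm_num : (0:ℝ) < 2))
      rw [add_zero] at l2
      refine ((l1.const_mul (w ^ (a - 1/2))).mul l2).congr' ?_
      filter_upwards [eventually_ge_atTop w] with z hz
      rw [indicator_of_mem (show w ∈ Ioc 0 z from ⟨hw', hz⟩)]
  rw [hgamI] at hlim
  have h2 := hlim.const_mul (2 ^ (-a) * (2 / (√π * Real.Gamma (a + 1 / 2))))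
  have e : 2 ^ (-a) * (2 / (√π * Real.Gamma (a + 1 / 2))) * (2 ^ (a - 1 / 2) / 2 * Real.Gamma (a + 1 / 2))
      = (√(2 * π))⁻¹ := by
    rw [Real.sqrt_mul (by norm_num), Real.sqrt_eq_rpow 2, mul_inv, ← Real.rpow_neg (by norm_num)]
    have : (2:ℝ) ^ (-(1/2) : ℝ) = 2 ^ (-a) * 2 ^ (a - 1/2) := by
      rw [← Real.rpow_add (by norm_num)]; ring_nf
    rw [this]; field_simp
  rw [e] at h2
  refine h2.congr' ?_
  filter_upwards [eventually_gt_atTop 0] with z hz using (normalI_exp_eq_integral ha hz).symm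

/-- `√z e^{-z} I_a(z) → (2π)^{-1/2}` for every real order. -/
lemma tendsto_normalI (a : ℝ) :
    Tendsto (fun z => normalI a z * Real.exp (-z)) atTop (𝓝 (√(2 * π))⁻¹) := by
  -- The recurrence I_a = I_{a+2} + (2(a+1)/z) I_{a+1} extends the limit to lower orders: the last
  -- term vanishes at infinity, so the limit does not depend on the order.
  have key : ∀ n : ℕ, ∀ a : ℝ, 1 / 2 - n ≤ a →
      Tendsto (fun z => normalI a z * Real.exp (-z)) atTop (𝓝 (√(2 * π))⁻¹) := by
    intro n
    induction n with
    | zero => intro a ha; exact tendsto_normalI_of_half_le (by simpa using ha)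
    | succ n ih =>
      intro a ha
      push_cast at ha
      have h1 := ih (a + 1) (by linarith)
      have h2 := ih (a + 1 + 1) (by linarith)
      have h3 : Tendsto (fun z : ℝ => 2 * (a + 1) / z) atTop (𝓝 0) :=
        tendsto_const_nhds.div_atTop tendsto_id
      have h4 := h2.add (h3.mul h1)
      rw [zero_mul, add_zero] at h4
      refine h4.congr' ?_
      filter_upwards [eventually_gt_atTop 0] with z hz
      have := normalI_recurrence (a + 1) hz
      rw [add_sub_cancel_right] at this
      rw [this]; ring
  obtain ⟨n, hn⟩ := exists_nat_ge (1 / 2 - a)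
  exact key n a (by linarith)

lemma continuous_besselPsi (a : ℝ) : Continuous (besselPsi a) :=
  continuous_iff_continuousAt.2 fun x => (hasDerivAt_besselPsi a x).continuousAt

/-- Power series on a compact interval, asymptotics beyond it. The factor (1+z)^m with m ≥ |a + 1/2|
compensates z^{a+1/2}, which may decay at infinity. -/
lemma normalI_bound (a : ℝ) : ∃ (C : ℝ) (m : ℕ), 0 ≤ C ∧ ∀ z, 0 < z →
    |normalI a z| ≤ C * z ^ (a + 1 / 2) * (1 + z) ^ m * Real.exp z := by
  obtain ⟨m, hm⟩ := exists_nat_ge |a + 1 / 2|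
  obtain ⟨Z, hZ1, hZ⟩ : ∃ Z : ℝ, 1 ≤ Z ∧ ∀ z, Z ≤ z → |normalI a z * Real.exp (-z)| ≤ (√(2 * π))⁻¹ + 1 := by
    have h := (tendsto_normalI a).abs.eventually_le_const
      (show |(√(2 * π))⁻¹| < (√(2 * π))⁻¹ + 1 by rw [abs_of_nonneg (by positivity)]; linarith)
    obtain ⟨Z, hZ⟩ := eventually_atTop.1 h
    exact ⟨max Z 1, le_max_right _ _, fun z hz => hZ z ((le_max_left _ _).trans hz)⟩
  obtain ⟨C1, hC1⟩ := (isCompact_Icc (a := (0:ℝ)) (b := Z)).exists_bound_of_continuousOn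
    (f := fun z => besselPsi a (z ^ 2 / 4))
    ((continuous_besselPsi a).comp (by fun_prop : Continuous fun z : ℝ => z ^ 2 / 4)).continuousOn
  have hC10 : 0 ≤ C1 := (norm_nonneg _).trans (hC1 0 ⟨le_refl _, by linarith⟩)
  refine ⟨2 ^ (-a) * C1 + ((√(2 * π))⁻¹ + 1), m, by positivity, fun z hz => ?_⟩
  rcases le_total z Z with h | h
  · rw [normalI_eq a hz, abs_mul, abs_mul, abs_of_nonneg (by positivity : (0:ℝ) ≤ 2 ^ (-a)),
      abs_of_nonneg (by positivity : (0:ℝ) ≤ z ^ (a + 1/2))]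
    have h1 : (1:ℝ) ≤ (1 + z) ^ m := one_le_pow₀ (by linarith)
    have h2 : (1:ℝ) ≤ Real.exp z := Real.one_le_exp hz.le
    calc 2 ^ (-a) * (z ^ (a + 1/2) * |besselPsi a (z ^ 2 / 4)|)
        ≤ 2 ^ (-a) * (z ^ (a + 1/2) * C1) := by gcongr; exact hC1 z ⟨hz.le, h⟩
      _ = 2 ^ (-a) * C1 * z ^ (a + 1/2) * 1 * 1 := by ring
      _ ≤ (2 ^ (-a) * C1 + ((√(2 * π))⁻¹ + 1)) * z ^ (a + 1/2) * (1 + z) ^ m * Real.exp z := by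
        gcongr
        have : 0 ≤ (√(2 * π))⁻¹ := by positivity
        linarith
  · have hz1 : 1 ≤ z := hZ1.trans h
    have hb := hZ z h
    rw [abs_mul, abs_of_pos (Real.exp_pos _), Real.exp_neg, ← div_eq_mul_inv, div_le_iff₀ (Real.exp_pos _)] at hb
    refine hb.trans ?_
    gcongr
    have h1 : (1:ℝ) ≤ z ^ (a + 1/2) * (1 + z) ^ m := by
      calc (1:ℝ) ≤ z ^ (a + 1/2 + m) := Real.one_le_rpow hz1 (by linarith [neg_abs_le (a + 1/2)])
        _ = z ^ (a + 1/2) * z ^ m := by rw [Real.rpow_add hz, Real.rpow_natCast]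
        _ ≤ _ := by gcongr; linarith
    rw [mul_assoc]
    have : 0 ≤ (√(2 * π))⁻¹ := by positivity
    have h2 : 0 ≤ (2:ℝ) ^ (-a) * C1 := by positivity
    calc (√(2 * π))⁻¹ + 1 ≤ (2 ^ (-a) * C1 + ((√(2 * π))⁻¹ + 1)) * 1 := by linarith
      _ ≤ _ := mul_le_mul_of_nonneg_left h1 (by positivity)

/-- Nothing is assumed about the value of f at 0; it is replaced by the one-sided limit. -/
lemma integral_Ioi_eq_zero_of_hasDerivAt {f f' : ℝ → ℝ} (hd : ∀ w ∈ Ioi (0:ℝ), HasDerivAt f (f' w) w)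
    (hi : IntegrableOn f' (Ioi 0)) (h0 : Tendsto f (𝓝[>] 0) (𝓝 0)) (hinf : Tendsto f atTop (𝓝 0)) :
    ∫ w in Ioi (0:ℝ), f' w = 0 := by
  have := integral_Ioi_of_hasDerivAt_of_tendsto (f := Function.update f 0 0) (f' := f') (a := 0) (m := 0)
    (continuousWithinAt_update_same.2 (by rwa [Ici_sdiff_left])) (fun w hw => ?_) hi ?_
  · rw [this]; simp
  · refine (hd w hw).congr_of_eventuallyEq ?_
    filter_upwards [Ioi_mem_nhds hw] with v hv
    exact Function.update_of_ne (ne_of_gt hv) _ _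
  · refine hinf.congr' ?_
    filter_upwards [eventually_gt_atTop 0] with v hv
    exact (Function.update_of_ne (ne_of_gt hv) _ _).symm

/-! ### The function `K_a` -/

/-- The integrand of the integral representation of `K_a`. -/
def macdonaldKernel (a x w : ℝ) : ℝ := w ^ (a - 1) * Real.exp (-w - x / w)

/-- The integral `∫₀^∞ w^{a-1} e^{-w-x/w} dw`. -/
def macdonald (a x : ℝ) : ℝ := ∫ w in Ioi (0:ℝ), macdonaldKernel a x w

lemma measurable_macdonaldKernel (a x : ℝ) : Measurable (macdonaldKernel a x) := by
  unfold macdonaldKernel; fun_prop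

/-- Since e^{-x/w} ≤ n! (w/x)^n, the exponent at w = 0 can be raised by any n, so the integral
converges for every real order. -/
lemma macdonaldKernel_le (a : ℝ) {x w : ℝ} (hx : 0 < x) (hw : 0 < w) (n : ℕ) :
    macdonaldKernel a x w ≤ (n.factorial : ℝ) / x ^ n * (w ^ (a + n - 1) * Real.exp (-(1 * w))) := by
  have h := Real.pow_div_factorial_le_exp (x / w) (by positivity) n
  have h1 : Real.exp (-(x / w)) ≤ (n.factorial : ℝ) / x ^ n * w ^ n := by
    rw [Real.exp_neg, inv_le_comm₀ (Real.exp_pos _) (by positivity)]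
    refine le_trans (le_of_eq ?_) h
    rw [div_pow]; field_simp
  have e : w ^ (a + n - 1) = w ^ (a - 1) * w ^ n := by
    rw [← Real.rpow_natCast, ← Real.rpow_add hw]; ring_nf
  rw [macdonaldKernel, sub_eq_add_neg (-w), Real.exp_add, e, one_mul]
  calc w ^ (a - 1) * (Real.exp (-w) * Real.exp (-(x / w)))
      ≤ w ^ (a - 1) * (Real.exp (-w) * ((n.factorial : ℝ) / x ^ n * w ^ n)) := by gcongr
    _ = _ := by ring

lemma integrableOn_macdonaldKernel (a : ℝ) {x : ℝ} (hx : 0 < x) :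
    IntegrableOn (macdonaldKernel a x) (Ioi 0) := by
  obtain ⟨n, hn⟩ := exists_nat_gt (-a)
  refine Integrable.mono' ((integrableOn_rpow_mul_exp_neg (a := a + n) (by linarith) one_pos).const_mul
    ((n.factorial : ℝ) / x ^ n)) (measurable_macdonaldKernel a x).aestronglyMeasurable ?_
  refine (ae_restrict_mem measurableSet_Ioi).mono fun w hw => ?_
  have hw' : (0:ℝ) < w := hw
  rw [Real.norm_of_nonneg (by unfold macdonaldKernel; positivity)]
  exact macdonaldKernel_le a hx hw' n

lemma macdonald_nonneg (a x : ℝ) : 0 ≤ macdonald a x :=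
  setIntegral_nonneg measurableSet_Ioi fun w hw => by
    have hw' : (0:ℝ) < w := hw
    unfold macdonaldKernel; positivity

lemma macdonaldKernel_anti (a : ℝ) {x y w : ℝ} (hxy : x ≤ y) (hw : 0 < w) :
    macdonaldKernel a y w ≤ macdonaldKernel a x w := by
  unfold macdonaldKernel; gcongr

lemma hasDerivAt_macdonald (a : ℝ) {x : ℝ} (hx : 0 < x) :
    HasDerivAt (macdonald a) (-macdonald (a - 1) x) x := by
  have h := (hasDerivAt_integral_of_dominated_loc_of_deriv_le (μ := volume.restrict (Ioi (0:ℝ)))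
      (F := fun x w => macdonaldKernel a x w) (F' := fun x w => -macdonaldKernel (a - 1) x w)
      (x₀ := x) (s := Ioi (x / 2)) (bound := fun w => macdonaldKernel (a - 1) (x / 2) w)
      (Ioi_mem_nhds (by linarith))
      (Eventually.of_forall fun x => (measurable_macdonaldKernel a x).aestronglyMeasurable)
      (integrableOn_macdonaldKernel a hx) (measurable_macdonaldKernel (a - 1) x).neg.aestronglyMeasurable ?_
      (integrableOn_macdonaldKernel (a - 1) (by linarith)) ?_).2
  · rw [integral_neg] at h; exact h
  · refine (ae_restrict_mem measurableSet_Ioi).mono fun w hw y hy => ?_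
    have hw' : (0:ℝ) < w := hw
    rw [norm_neg, Real.norm_of_nonneg (by unfold macdonaldKernel; positivity)]
    exact macdonaldKernel_anti _ (le_of_lt hy) hw'
  · refine (ae_restrict_mem measurableSet_Ioi).mono fun w hw y hy => ?_
    have hw' : (0:ℝ) < w := hw
    have : HasDerivAt (fun y => -w - y / w) (-(1 / w)) y := by
      simpa using ((hasDerivAt_id y).div_const w).const_sub (-w)
    refine (this.exp.const_mul (w ^ (a - 1))).congr_deriv ?_
    rw [macdonaldKernel, Real.rpow_sub_one hw'.ne' (a - 1)]; field_simp

/-- Integrate the derivative of w^a e^{-w-x/w} over (0, ∞); the boundary values vanish at both ends.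
-/
lemma macdonald_recurrence (a : ℝ) {x : ℝ} (hx : 0 < x) :
    macdonald (a + 1) x = a * macdonald a x + x * macdonald (a - 1) x := by
  have hd : ∀ w ∈ Ioi (0:ℝ), HasDerivAt (fun w => w ^ a * Real.exp (-w - x / w))
      (a * macdonaldKernel a x w + x * macdonaldKernel (a - 1) x w - macdonaldKernel (a + 1) x w) w := by
    intro w hw
    have hw' : (0:ℝ) < w := hw
    have h1 : HasDerivAt (fun w : ℝ => -w - x / w) (-1 + x / w ^ 2) w := by
      have := ((hasDerivAt_id w).neg).sub ((hasDerivAt_inv hw'.ne').const_mul x)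
      refine (this.congr_of_eventuallyEq ?_).congr_deriv ?_
      · exact Eventually.of_forall fun w => by simp [div_eq_mul_inv]
      · field_simp; ring
    refine ((Real.hasDerivAt_rpow_const (p := a) (Or.inl hw'.ne')).mul h1.exp).congr_deriv ?_
    simp only [macdonaldKernel]
    rw [Real.rpow_sub_one hw'.ne' (a - 1), add_sub_cancel_right, Real.rpow_sub_one hw'.ne']
    field_simp
    ring
  have hi : IntegrableOn (fun w => a * macdonaldKernel a x w + x * macdonaldKernel (a - 1) x w
      - macdonaldKernel (a + 1) x w) (Ioi 0) :=
    (((integrableOn_macdonaldKernel a hx).const_mul a).add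
      ((integrableOn_macdonaldKernel (a - 1) hx).const_mul x)).sub (integrableOn_macdonaldKernel (a + 1) hx)
  have hle : ∀ (n : ℕ), ∀ w ∈ Ioi (0:ℝ), w ^ a * Real.exp (-w - x / w)
      ≤ (n.factorial : ℝ) / x ^ n * (w ^ (a + n) * Real.exp (-(1 * w))) := by
    intro n w hw
    have := macdonaldKernel_le (a + 1) hx hw n
    rw [macdonaldKernel, add_sub_cancel_right] at this
    refine this.trans (le_of_eq ?_)
    congr 3; ring
  have h0 : Tendsto (fun w => w ^ a * Real.exp (-w - x / w)) (𝓝[>] 0) (𝓝 0) := by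
    obtain ⟨n, hn⟩ := exists_nat_gt (-a)
    have hl : Tendsto (fun w : ℝ => (n.factorial : ℝ) / x ^ n * (w ^ (a + n) * Real.exp (-(1 * w)))) (𝓝[>] 0)
        (𝓝 0) := by
      have h1 : Tendsto (fun w : ℝ => w ^ (a + n)) (𝓝[>] 0) (𝓝 0) := by
        have := (Real.continuousAt_rpow_const 0 (a + n) (Or.inr (by linarith))).tendsto
        rw [Real.zero_rpow (by linarith)] at this
        exact this.mono_left nhdsWithin_le_nhds
      have h2 : Tendsto (fun w : ℝ => Real.exp (-(1 * w))) (𝓝[>] 0) (𝓝 (Real.exp (-(1 * 0)))) :=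
        (Continuous.tendsto (by fun_prop) 0).mono_left nhdsWithin_le_nhds
      simpa using (h1.mul h2).const_mul ((n.factorial : ℝ) / x ^ n)
    refine tendsto_of_tendsto_of_tendsto_of_le_of_le' tendsto_const_nhds hl ?_ ?_
    · filter_upwards [self_mem_nhdsWithin] with w hw
      have hw' : (0:ℝ) < w := hw
      positivity
    · filter_upwards [self_mem_nhdsWithin] with w hw using hle n w hw
  have hinf : Tendsto (fun w => w ^ a * Real.exp (-w - x / w)) atTop (𝓝 0) := by
    have hl := (tendsto_rpow_mul_exp_neg_mul_atTop_nhds_zero a 1 one_pos)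
    refine tendsto_of_tendsto_of_tendsto_of_le_of_le' tendsto_const_nhds hl ?_ ?_
    · filter_upwards [eventually_gt_atTop 0] with w hw
      positivity
    · filter_upwards [eventually_gt_atTop 0] with w hw
      have := hle 0 w hw
      simpa using this
  have hFTC := integral_Ioi_eq_zero_of_hasDerivAt hd hi h0 hinf
  have e := integral_sub (μ := volume.restrict (Ioi (0:ℝ)))
    (((integrableOn_macdonaldKernel a hx).const_mul a).add
      ((integrableOn_macdonaldKernel (a - 1) hx).const_mul x)) (integrableOn_macdonaldKernel (a + 1) hx)
  have e2 := integral_add (μ := volume.restrict (Ioi (0:ℝ)))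
    ((integrableOn_macdonaldKernel a hx).const_mul a) ((integrableOn_macdonaldKernel (a - 1) hx).const_mul x)
  rw [integral_const_mul, integral_const_mul] at e2
  simp only [Pi.add_apply] at e
  rw [e2, hFTC] at e
  simp only [macdonald]
  linarith

/-- `√z K_a(z)`, by the integral representation. -/
def normalK (a z : ℝ) : ℝ := 2 ^ (a - 1) * (z ^ (-a + 1 / 2) * macdonald a (z ^ 2 / 4))

/-- The derivative of `√z K_a(z)`. -/
def normalK' (a z : ℝ) : ℝ := 2 ^ (a - 1) * ((-a + 1 / 2) * z ^ (-a - 1 / 2) * macdonald a (z ^ 2 / 4)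
  + z ^ (-a + 3 / 2) / 2 * (-macdonald (a - 1) (z ^ 2 / 4)))

lemma solves_normalK (a : ℝ) : SolvesNormalBessel (a ^ 2 - 1 / 4) (normalK a) (normalK' a) := by
  have := (solvesNormalBessel_rpow_mul (c := -a) (Ψ := macdonald a) (Ψ₁ := fun x => -macdonald (a - 1) x)
    (Ψ₂ := fun x => -(-macdonald (a - 1 - 1) x)) (fun x hx => hasDerivAt_macdonald a hx)
    (fun x hx => (hasDerivAt_macdonald (a - 1) hx).neg) (fun x hx => by
      have := macdonald_recurrence (a - 1) hx
      rw [sub_add_cancel] at this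
      rw [this]; ring)).const_mul (2 ^ (a - 1))
  rw [neg_sq] at this
  exact this

lemma macdonald_le_Gamma {a : ℝ} (ha : 0 < a) {x : ℝ} (hx : 0 < x) : macdonald a x ≤ Real.Gamma a := by
  have h := Real.integral_rpow_mul_exp_neg_mul_Ioi (r := 1) ha one_pos
  rw [div_one, Real.one_rpow, one_mul] at h
  rw [← h, macdonald]
  refine setIntegral_mono_on (integrableOn_macdonaldKernel a hx) (integrableOn_rpow_mul_exp_neg ha one_pos)
    measurableSet_Ioi fun w hw => ?_
  have hw' : (0:ℝ) < w := hw
  have : 0 < x / w := by positivity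
  rw [macdonaldKernel]
  gcongr
  linarith

lemma tendsto_macdonald_zero {a : ℝ} (ha : 0 < a) :
    Tendsto (macdonald a) (𝓝[>] 0) (𝓝 (Real.Gamma a)) := by
  have h := Real.integral_rpow_mul_exp_neg_mul_Ioi (r := 1) ha one_pos
  rw [div_one, Real.one_rpow, one_mul] at h
  rw [← h]
  refine tendsto_integral_filter_of_dominated_convergence _
    (Eventually.of_forall fun x => (measurable_macdonaldKernel a x).aestronglyMeasurable) ?_
    (integrableOn_rpow_mul_exp_neg ha one_pos) ?_
  · filter_upwards [self_mem_nhdsWithin] with x hx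
    refine (ae_restrict_mem measurableSet_Ioi).mono fun w hw => ?_
    have hw' : (0:ℝ) < w := hw
    have hx' : (0:ℝ) < x := hx
    have : 0 < x / w := by positivity
    rw [macdonaldKernel, Real.norm_of_nonneg (by positivity)]
    gcongr
    linarith
  · refine (ae_restrict_mem measurableSet_Ioi).mono fun w hw => ?_
    have : Tendsto (fun x : ℝ => w ^ (a - 1) * Real.exp (-w - x / w)) (𝓝 0)
        (𝓝 (w ^ (a - 1) * Real.exp (-w - 0 / w))) := Continuous.tendsto (by fun_prop) 0
    have := this.mono_left (nhdsWithin_le_nhds (s := Ioi 0))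
    simpa [macdonaldKernel] using this

/-- On (0, ∞) the function `macdonald 0 y + log y` is increasing: its derivative is 1/y - `macdonald
(-1) y`, and y `macdonald (-1) y` = `macdonald 1 y` ≤ Γ(1) = 1. For x ≥ 1 monotonicity of the kernel
in x suffices. -/
lemma macdonald_zero_le {x : ℝ} (hx : 0 < x) : macdonald 0 x ≤ macdonald 0 1 + |Real.log x| := by
  rcases le_total 1 x with h | h
  · have : macdonald 0 x ≤ macdonald 0 1 :=
      setIntegral_mono_on (integrableOn_macdonaldKernel 0 hx) (integrableOn_macdonaldKernel 0 one_pos)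
        measurableSet_Ioi fun w hw => macdonaldKernel_anti 0 h hw
    linarith [abs_nonneg (Real.log x)]
  · have hd : ∀ y, 0 < y → HasDerivAt (fun y => macdonald 0 y + Real.log y) (-macdonald (0 - 1) y + y⁻¹) y :=
      fun y hy => (hasDerivAt_macdonald 0 hy).add (Real.hasDerivAt_log hy.ne')
    have hmono : MonotoneOn (fun y => macdonald 0 y + Real.log y) (Ioi 0) := by
      refine monotoneOn_of_deriv_nonneg (convex_Ioi 0)
        (fun y hy => (hd y hy).continuousAt.continuousWithinAt) ?_ ?_
      · rw [interior_Ioi]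
        exact fun y hy => (hd y hy).differentiableAt.differentiableWithinAt
      · rw [interior_Ioi]
        intro y hy
        have hy' : (0:ℝ) < y := hy
        rw [(hd y hy).deriv]
        have h1 := macdonald_recurrence 0 hy'
        have h2 := macdonald_le_Gamma (a := 0 + 1) (by norm_num) hy'
        rw [h1] at h2
        simp only [zero_mul, zero_add, Real.Gamma_one] at h2
        have : macdonald (0 - 1) y ≤ y⁻¹ := by
          rw [← one_div, le_div_iff₀ hy']; linarith
        linarith
    have := hmono hx (mem_Ioi.2 one_pos) h
    simp only [Real.log_one, add_zero] at this
    linarith [neg_le_abs (Real.log x)]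

lemma normalK_nonneg (a : ℝ) {z : ℝ} (hz : 0 < z) : 0 ≤ normalK a z := by
  have := macdonald_nonneg a (z ^ 2 / 4)
  unfold normalK; positivity

/-- The logarithm is needed only at a = 0; for a > 0 the bound by Γ(a) suffices. -/
lemma normalK_bound {a : ℝ} (ha : 0 ≤ a) : ∃ C, 0 ≤ C ∧ ∀ z, 0 < z →
    |normalK a z| ≤ C * (z ^ (-a + 1 / 2) * (1 + |Real.log z|)) := by
  have key : ∃ C, 0 ≤ C ∧ ∀ z : ℝ, 0 < z → macdonald a (z ^ 2 / 4) ≤ C * (1 + |Real.log z|) := by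
    rcases ha.eq_or_lt with rfl | ha
    · refine ⟨macdonald 0 1 + |Real.log 4| + 2, by have := macdonald_nonneg 0 1; positivity, fun z hz => ?_⟩
      have h := macdonald_zero_le (show 0 < z ^ 2 / 4 by positivity)
      have e : Real.log (z ^ 2 / 4) = 2 * Real.log z - Real.log 4 := by
        rw [Real.log_div (by positivity) (by norm_num), Real.log_pow]; norm_num
      have h3 : |Real.log (z ^ 2 / 4)| ≤ 2 * |Real.log z| + |Real.log 4| := by
        rw [e]; refine (abs_sub _ _).trans ?_; rw [abs_mul]; norm_num
      have := macdonald_nonneg 0 1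
      nlinarith [abs_nonneg (Real.log z), abs_nonneg (Real.log 4),
        mul_nonneg (add_nonneg this (abs_nonneg (Real.log 4))) (abs_nonneg (Real.log z))]
    · have hΓ := (Real.Gamma_pos_of_pos ha).le
      refine ⟨Real.Gamma a, hΓ, fun z hz => (macdonald_le_Gamma ha (by positivity)).trans ?_⟩
      exact le_mul_of_one_le_right hΓ (by linarith [abs_nonneg (Real.log z)])
  obtain ⟨C, hC0, hC⟩ := key
  refine ⟨2 ^ (a - 1) * C, by positivity, fun z hz => ?_⟩
  rw [abs_of_nonneg (normalK_nonneg a hz), normalK]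
  calc _ ≤ 2 ^ (a - 1) * (z ^ (-a + 1/2) * (C * (1 + |Real.log z|))) := by gcongr; exact hC z hz
    _ = _ := by ring

/-- The decay of K_a itself is not needed: its polynomial bound already loses against e^{-z}. -/
lemma tendsto_normalK {a : ℝ} (ha : 0 ≤ a) :
    Tendsto (fun z => normalK a z * Real.exp (-z)) atTop (𝓝 0) := by
  obtain ⟨C, hC0, hC⟩ := normalK_bound ha
  have h1 : Tendsto (fun z : ℝ => C * (z ^ (-a + 1/2 + 1) * Real.exp (-1 * z))) atTop (𝓝 (C * 0)) :=
    (tendsto_rpow_mul_exp_neg_mul_atTop_nhds_zero _ 1 one_pos).const_mul C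
  rw [mul_zero] at h1
  refine squeeze_zero_norm' ?_ h1
  filter_upwards [eventually_ge_atTop 1] with z hz
  have hz0 : 0 < z := by linarith
  rw [norm_mul, Real.norm_eq_abs, Real.norm_of_nonneg (Real.exp_pos _).le, Real.rpow_add_one hz0.ne', ← mul_assoc,
    neg_one_mul]
  gcongr
  refine (hC z hz0).trans ?_
  gcongr
  rw [abs_of_nonneg (Real.log_nonneg hz)]
  linarith [Real.log_le_sub_one_of_pos hz0]

/-! ### Identification of the integral with the quotient defining K_a -/

lemma SolvesNormalBessel.wronskian {κ : ℝ} {g g' h h' : ℝ → ℝ} (hg : SolvesNormalBessel κ g g')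
    (hh : SolvesNormalBessel κ h h') : ∃ c, ∀ z ∈ Ioi (0:ℝ), g z * h' z - g' z * h z = c := by
  have hd : ∀ z ∈ Ioi (0:ℝ), HasDerivAt (fun z => g z * h' z - g' z * h z) 0 z := fun z hz =>
    (((hg z hz).1.mul (hh z hz).2).sub ((hg z hz).2.mul (hh z hz).1)).congr_deriv (by ring)
  exact isOpen_Ioi.exists_is_const_of_deriv_eq_zero isPreconnected_Ioi
    (fun z hz => (hd z hz).differentiableAt.differentiableWithinAt) fun z hz => (hd z hz).deriv

lemma besselPsi_zero (a : ℝ) : besselPsi a 0 = (Real.Gamma (a + 1))⁻¹ := by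
  rw [besselPsi, tsum_eq_single 0 (fun m hm => by simp [hm])]
  simp [besselCoeff]

lemma tendsto_besselPsi_sq (a : ℝ) :
    Tendsto (fun z : ℝ => besselPsi a (z ^ 2 / 4)) (𝓝[>] 0) (𝓝 (Real.Gamma (a + 1))⁻¹) := by
  rw [← besselPsi_zero]
  have : Continuous fun z : ℝ => besselPsi a (z ^ 2 / 4) :=
    (continuous_besselPsi a).comp (by fun_prop)
  exact (this.tendsto' 0 _ (by norm_num)).mono_left nhdsWithin_le_nhds

/-- The real powers of z cancel, leaving entire functions of z whose value at 0 is 2a / (Γ(a+1)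
Γ(1-a)). -/
lemma wronskian_normalI {a z : ℝ} (hz : 0 < z) :
    normalI (-a) z * normalI' a z - normalI' (-a) z * normalI a z
      = 2 * a * besselPsi a (z ^ 2 / 4) * besselPsi (-a) (z ^ 2 / 4) + z ^ 2 / 2 *
        (besselPsi (-a) (z ^ 2 / 4) * besselPsi (a + 1) (z ^ 2 / 4)
          - besselPsi a (z ^ 2 / 4) * besselPsi (-a + 1) (z ^ 2 / 4)) := by
  rw [normalI_eq _ hz, normalI_eq _ hz, normalI', normalI']
  have e0 : (2:ℝ) ^ (-(-a)) = (2 ^ (-a))⁻¹ := by rw [Real.rpow_neg (by norm_num) (-a)]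
  have e1 : z ^ (a + 1 / 2) = z ^ (a - 1/2) * z := by rw [← Real.rpow_add_one hz.ne']; ring_nf
  have e2 : z ^ (a + 3 / 2) = z ^ (a - 1/2) * z ^ 2 := by
    rw [← Real.rpow_add_natCast hz.ne']; push_cast; ring_nf
  have e3 : z ^ (-a + 1 / 2) = (z ^ (a - 1/2))⁻¹ := by rw [← Real.rpow_neg hz.le]; ring_nf
  have e4 : z ^ (-a - 1 / 2) = (z ^ (a - 1/2))⁻¹ / z := by
    rw [← Real.rpow_neg hz.le, ← Real.rpow_sub_one hz.ne']; ring_nf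
  have e5 : z ^ (-a + 3 / 2) = (z ^ (a - 1/2))⁻¹ * z := by
    rw [← Real.rpow_neg hz.le, ← Real.rpow_add_one hz.ne']; ring_nf
  have n1 : z ^ (a - 1/2) ≠ 0 := by positivity
  have n2 : (2:ℝ) ^ (-a) ≠ 0 := by positivity
  rw [e0, e1, e2, e3, e4, e5]
  field_simp
  ring

/-- The integral representation agrees with the quotient for non-integer orders. -/
lemma normalK_eq {a z : ℝ} (ha : 0 < a) (hs : Real.sin (a * π) ≠ 0) (hz : 0 < z) :
    normalK a z = π / 2 * ((normalI (-a) z - normalI a z) / Real.sin (a * π)) := by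
  have hπ := Real.pi_pos
  have s1 := solves_normalI (-a)
  rw [neg_sq] at s1
  have s2 := solves_normalI a
  have s3 := solves_normalK a
  obtain ⟨w0, hw0⟩ := s1.wronskian s2
  obtain ⟨w1, hw1⟩ := s3.wronskian s2
  obtain ⟨w2, hw2⟩ := s3.wronskian s1
  have hΓa := Real.Gamma_pos_of_pos ha
  have hrefl := Real.Gamma_mul_Gamma_one_sub a
  rw [mul_comm π a] at hrefl
  have hΓ1 : Real.Gamma (1 - a) = π / Real.sin (a * π) / Real.Gamma a := by
    rw [← hrefl]; field_simp
  -- By the reflection formula the Wronskian of the orders -a and a is 2 sin(aπ)/π, which is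
  -- non-zero: they form a fundamental system.
  have hw0v : w0 = 2 * Real.sin (a * π) / π := by
    have l1 : Tendsto (fun z : ℝ => 2 * a * besselPsi a (z ^ 2 / 4) * besselPsi (-a) (z ^ 2 / 4) + z ^ 2 / 2 *
        (besselPsi (-a) (z ^ 2 / 4) * besselPsi (a + 1) (z ^ 2 / 4)
          - besselPsi a (z ^ 2 / 4) * besselPsi (-a + 1) (z ^ 2 / 4))) (𝓝[>] 0)
        (𝓝 (2 * a * (Real.Gamma (a + 1))⁻¹ * (Real.Gamma (-a + 1))⁻¹ + 0 ^ 2 / 2 *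
          ((Real.Gamma (-a + 1))⁻¹ * (Real.Gamma (a + 1 + 1))⁻¹
            - (Real.Gamma (a + 1))⁻¹ * (Real.Gamma (-a + 1 + 1))⁻¹))) := by
      have hz2 : Tendsto (fun z : ℝ => z ^ 2 / 2) (𝓝[>] 0) (𝓝 (0 ^ 2 / 2)) :=
        (Continuous.tendsto (by fun_prop) 0).mono_left nhdsWithin_le_nhds
      exact (((tendsto_besselPsi_sq a).const_mul (2 * a)).mul (tendsto_besselPsi_sq (-a))).add
        (hz2.mul (((tendsto_besselPsi_sq (-a)).mul (tendsto_besselPsi_sq (a + 1))).sub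
          ((tendsto_besselPsi_sq a).mul (tendsto_besselPsi_sq (-a + 1)))))
    have l2 : Tendsto (fun _ : ℝ => w0) (𝓝[>] 0) (𝓝 w0) := tendsto_const_nhds
    have l3 := tendsto_nhds_unique (l2.congr' (by
      filter_upwards [self_mem_nhdsWithin] with z hz
      rw [← hw0 z hz, wronskian_normalI hz])) l1
    rw [l3, Real.Gamma_add_one ha.ne', neg_add_eq_sub, hΓ1]
    field_simp
    ring
  have hw0n : w0 ≠ 0 := by rw [hw0v]; positivity
  set c1 := w1 / w0 with hc1
  set c2 := -(w2 / w0) with hc2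
  -- Cramer's rule with the three constant Wronskians.
  have hG : ∀ z, 0 < z → normalK a z = c1 * normalI (-a) z + c2 * normalI a z := by
    intro z hz
    have h0 := hw0 z hz
    have h1 := hw1 z hz
    have h2 := hw2 z hz
    rw [hc1, hc2]
    field_simp
    rw [← h0, ← h1, ← h2]; ring
  have hL : (√(2 * π))⁻¹ ≠ 0 := by positivity
  -- After multiplication by e^{-z} both I-terms have the same non-zero limit at infinity, while K_a
  -- gives 0.
  have hc : c1 + c2 = 0 := by
    have l1 := ((tendsto_normalI (-a)).const_mul c1).add ((tendsto_normalI a).const_mul c2)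
    have l2 := tendsto_nhds_unique ((tendsto_normalK ha.le).congr' (by
      filter_upwards [eventually_gt_atTop 0] with z hz
      rw [hG z hz, add_mul, mul_assoc, mul_assoc])) l1
    rw [← add_mul] at l2
    exact (mul_eq_zero.1 l2.symm).resolve_right hL
  -- Leading behaviour at 0 after division by z^{-a+1/2}: the integral tends to Γ(a), and the
  -- I_a-term vanishes like z^{2a}.
  have hc1v : c1 = π / (2 * Real.sin (a * π)) := by
    have hpow : Tendsto (fun z : ℝ => z ^ (2 * a)) (𝓝[>] 0) (𝓝 0) := by
      have := (Real.continuousAt_rpow_const 0 (2 * a) (Or.inr (by linarith))).tendsto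
      rw [Real.zero_rpow (by linarith)] at this
      exact this.mono_left nhdsWithin_le_nhds
    have hsq : Tendsto (fun z : ℝ => z ^ 2 / 4) (𝓝[>] 0) (𝓝[>] 0) := by
      refine tendsto_nhdsWithin_of_tendsto_nhds_of_eventually_within _ ?_ ?_
      · exact (Continuous.tendsto' (by fun_prop) 0 0 (by norm_num)).mono_left nhdsWithin_le_nhds
      · filter_upwards [self_mem_nhdsWithin] with z hz
        have hz' : (0:ℝ) < z := hz
        exact show 0 < z ^ 2 / 4 by positivity
    have l1 : Tendsto (fun z : ℝ => 2 ^ (a - 1) * macdonald a (z ^ 2 / 4)) (𝓝[>] 0)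
        (𝓝 (2 ^ (a - 1) * Real.Gamma a)) := ((tendsto_macdonald_zero ha).comp hsq).const_mul _
    have l2 : Tendsto (fun z : ℝ => c1 * (2 ^ (-(-a)) * besselPsi (-a) (z ^ 2 / 4)) +
        c2 * (2 ^ (-a) * (z ^ (2 * a) * besselPsi a (z ^ 2 / 4)))) (𝓝[>] 0)
        (𝓝 (c1 * (2 ^ (-(-a)) * (Real.Gamma (-a + 1))⁻¹) +
          c2 * (2 ^ (-a) * (0 * (Real.Gamma (a + 1))⁻¹)))) :=
      (((tendsto_besselPsi_sq (-a)).const_mul _).const_mul c1).add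
        (((hpow.mul (tendsto_besselPsi_sq a)).const_mul _).const_mul c2)
    have l3 := tendsto_nhds_unique (l1.congr' (by
      filter_upwards [self_mem_nhdsWithin] with z hz
      have hz' : (0:ℝ) < z := hz
      have h := hG z hz'
      rw [normalK, normalI_eq _ hz', normalI_eq _ hz'] at h
      have e : z ^ (a + 1/2) = z ^ (-a + 1/2) * z ^ (2 * a) := by rw [← Real.rpow_add hz']; ring_nf
      rw [e] at h
      have n1 : z ^ (-a + 1/2) ≠ 0 := by positivity
      apply mul_left_cancel₀ n1
      linear_combination h)) l2
    rw [neg_add_eq_sub, hΓ1, neg_neg, zero_mul, mul_zero, mul_zero, add_zero, Real.rpow_sub_one (by norm_num)] at l3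
    have n2 : (2:ℝ) ^ a ≠ 0 := by positivity
    field_simp at l3
    rw [eq_div_iff (mul_ne_zero two_ne_zero hs), mul_comm a π]
    linarith
  have hc2v : c2 = -c1 := by linarith
  rw [hG z hz, hc2v, hc1v]
  field_simp
  ring

/-- For |b - a| < 1 one has w^{b-1} ≤ w^{a-2} + w^a. Continuity in the order is what evaluates the
limit defining K_a at integers. -/
lemma continuousAt_macdonald_order {a x : ℝ} (hx : 0 < x) : ContinuousAt (fun b => macdonald b x) a := by
  refine continuousAt_of_dominated (bound := fun w => macdonaldKernel (a - 1) x w + macdonaldKernel (a + 1) x w)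
    (Eventually.of_forall fun b => (measurable_macdonaldKernel b x).aestronglyMeasurable) ?_
    ((integrableOn_macdonaldKernel (a - 1) hx).add (integrableOn_macdonaldKernel (a + 1) hx)) ?_
  · filter_upwards [Ioo_mem_nhds (show a - 1 < a by linarith) (show a < a + 1 by linarith)] with b hb
    refine (ae_restrict_mem measurableSet_Ioi).mono fun w hw => ?_
    have hw' : (0:ℝ) < w := hw
    rw [Real.norm_of_nonneg (by unfold macdonaldKernel; positivity)]
    simp only [macdonaldKernel]
    rw [← add_mul]
    gcongr
    rcases le_total w 1 with h | h
    · have := Real.rpow_le_rpow_of_exponent_ge hw' h (show a - 1 - 1 ≤ b - 1 by linarith [hb.1])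
      have h2 : 0 ≤ w ^ (a + 1 - 1) := by positivity
      linarith
    · have := Real.rpow_le_rpow_of_exponent_le h (show b - 1 ≤ a + 1 - 1 by linarith [hb.2])
      have h2 : 0 ≤ w ^ (a - 1 - 1) := by positivity
      linarith
  · refine (ae_restrict_mem measurableSet_Ioi).mono fun w hw => ?_
    have hw' : (0:ℝ) < w := hw
    unfold macdonaldKernel
    refine ContinuousAt.mul_const ?_ _
    exact (Real.continuousAt_const_rpow hw'.ne').comp (by fun_prop)

/-- The quotient is even in the order, whereas the integral formula is used for a > 0; hence |a|. -/
lemma sqrt_mul_besselKQuot {a z : ℝ} (hs : Real.sin (a * π) ≠ 0) (hz : 0 < z) :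
    √z * besselKQuot a z = normalK |a| z := by
  have ha0 : a ≠ 0 := by rintro rfl; simp at hs
  have e : ∀ b, √z * besselKQuot b z = π / 2 * ((normalI (-b) z - normalI b z) / Real.sin (b * π)) := by
    intro b; rw [besselKQuot, normalI, normalI]; ring
  rw [e]
  rcases lt_or_gt_of_ne ha0 with h | h
  · rw [abs_of_neg h, normalK_eq (by linarith) (by rwa [neg_mul, Real.sin_neg, neg_ne_zero]) hz, neg_neg,
      neg_mul, Real.sin_neg, div_neg, ← neg_div, neg_sub]
  · rw [abs_of_pos h, normalK_eq h hs hz]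

/-- The defined function `K_a`, as a limit for integer orders, is given by the integral. -/
lemma sqrt_mul_besselK (a : ℝ) {z : ℝ} (hz : 0 < z) : √z * besselK a z = normalK |a| z := by
  have hsz : √z ≠ 0 := (Real.sqrt_pos.2 hz).ne'
  rw [besselK]
  split_ifs with hs
  · exact sqrt_mul_besselKQuot hs hz
  · rw [not_not] at hs
    have hcont : ContinuousAt (fun b => normalK |b| z) a := by
      unfold normalK
      have h1 : ContinuousAt (fun b => macdonald |b| (z ^ 2 / 4)) a :=
        ContinuousAt.comp (f := fun b : ℝ => |b|) (continuousAt_macdonald_order (by positivity))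
          continuous_abs.continuousAt
      have h2 : ContinuousAt (fun b : ℝ => (2:ℝ) ^ (|b| - 1)) a :=
        ((Real.continuous_const_rpow (by norm_num)).comp (by fun_prop)).continuousAt
      have h3 : ContinuousAt (fun b : ℝ => z ^ (-|b| + 1/2)) a :=
        ((Real.continuous_const_rpow hz.ne').comp (by fun_prop)).continuousAt
      exact h2.mul (h3.mul h1)
    -- The zeros of sin(bπ) are simple, so near the integer a all other orders are given by the
    -- integral.
    have hne : ∀ᶠ b in 𝓝[≠] a, Real.sin (b * π) ≠ 0 := by
      have hd : HasDerivAt (fun b => Real.sin (b * π)) (Real.cos (a * π) * π) a := by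
        have := (hasDerivAt_id a).mul_const π
        rw [one_mul] at this
        exact this.sin
      have := hd.eventually_ne (c := 0) (mul_ne_zero (fun h => by
        have := Real.sin_sq_add_cos_sq (a * π)
        rw [hs, h] at this; norm_num at this) Real.pi_ne_zero)
      exact this
    have hlim : Tendsto (fun b => besselKQuot b z) (𝓝[≠] a) (𝓝 (normalK |a| z / √z)) := by
      refine ((hcont.tendsto.mono_left nhdsWithin_le_nhds).div_const (√z)).congr' ?_
      filter_upwards [hne] with b hb
      rw [← sqrt_mul_besselKQuot hb hz]; field_simp
    rw [hlim.limUnder_eq]; field_simp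

/-! ### Bessel profiles and the control of their derivatives -/

/-- A function with bounded values and bounded second derivative has a bounded derivative. -/
lemma abs_deriv_le_of_abs_le {f f' f'' : ℝ → ℝ} {x h A B : ℝ} (hh : 0 < h)
    (h1 : ∀ y ∈ Icc x (x + h), HasDerivAt f (f' y) y) (h2 : ∀ y ∈ Icc x (x + h), HasDerivAt f' (f'' y) y)
    (hA : ∀ y ∈ Icc x (x + h), |f y| ≤ A) (hB : ∀ y ∈ Icc x (x + h), |f'' y| ≤ B) :
    |f' x| ≤ 2 * A / h + B * h := by
  have hlt : x < x + h := by linarith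
  have hx : x ∈ Icc x (x + h) := ⟨le_refl _, hlt.le⟩
  have hxh : x + h ∈ Icc x (x + h) := ⟨hlt.le, le_refl _⟩
  -- Landau's argument: some ξ has |f'(ξ)| ≤ 2A/h, and f' varies by at most Bh between x and ξ.
  obtain ⟨ξ, hξ, e⟩ := exists_hasDerivAt_eq_slope f f' hlt
    (fun y hy => (h1 y hy).continuousAt.continuousWithinAt) fun y hy => h1 y (Ioo_subset_Icc_self hy)
  obtain ⟨η, hη, e'⟩ := exists_hasDerivAt_eq_slope f' f'' hξ.1
    (fun y hy => (h2 y ⟨hy.1, hy.2.trans hξ.2.le⟩).continuousAt.continuousWithinAt)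
    fun y hy => h2 y ⟨hy.1.le, hy.2.le.trans hξ.2.le⟩
  have hηB := hB η ⟨hη.1.le, hη.2.le.trans hξ.2.le⟩
  have hB0 : 0 ≤ B := (abs_nonneg _).trans hηB
  have a1 : |f' ξ| ≤ 2 * A / h := by
    rw [e, add_sub_cancel_left, abs_div, abs_of_pos hh]
    gcongr
    refine (abs_sub _ _).trans ?_
    linarith [hA _ hx, hA _ hxh]
  have a2 : |f' ξ - f' x| ≤ B * h := by
    have hpos : 0 < ξ - x := sub_pos.2 hξ.1
    have : f' ξ - f' x = f'' η * (ξ - x) := by rw [e']; field_simp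
    rw [this, abs_mul, abs_of_pos hpos]
    exact mul_le_mul hηB (by linarith [hξ.2]) hpos.le hB0
  have : f' x = f' ξ - (f' ξ - f' x) := by ring
  rw [this]
  exact (abs_sub _ _).trans (add_le_add a1 a2)

/-- `g` is a solution of the normal form of the modified Bessel equation which is bounded by the
submultiplicative weight `ρ` at the origin, and asymptotic to `L e^z` at infinity. -/
structure BesselProfile (κ L : ℝ) (g g' ρ : ℝ → ℝ) : Prop where
  weight_pos : ∀ z, 0 < z → 0 < ρ z
  weight_mul : ∀ a z, 0 < a → 0 < z → ρ (a * z) ≤ ρ a * ρ z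
  weight_le : ∃ (C : ℝ) (m : ℕ), 0 ≤ C ∧ ∀ z, 0 < z → ρ z ≤ C * (z + 1 / z) ^ m
  solves : SolvesNormalBessel κ g g'
  bound : ∃ (C : ℝ) (m : ℕ), 0 ≤ C ∧ ∀ z, 0 < z → |g z| ≤ C * ρ z * (1 + z) ^ m * Real.exp z
  lim : Tendsto (fun z => g z * Real.exp (-z)) atTop (𝓝 L)

namespace BesselProfile

variable {κ L : ℝ} {g g' ρ : ℝ → ℝ}

/-- Landau's inequality on [z, z + δ] with δ = min(1, z), the second derivative being bounded
through the equation. Points y of this interval satisfy 1 ≤ y/z ≤ 2, so submultiplicativity makes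
ρ(y) comparable to ρ(z). -/
lemma bound_deriv (h : BesselProfile κ L g g' ρ) : ∃ (C : ℝ) (m : ℕ), 0 ≤ C ∧ ∀ z, 0 < z →
    |z * g' z| ≤ C * ρ z * (1 + z) ^ m * Real.exp z := by
  obtain ⟨C, m, hC0, hC⟩ := h.bound
  obtain ⟨D, n, hD0, hD⟩ := h.weight_le
  set K := C * (D * 3 ^ n) * 2 ^ m * Real.exp 1 with hK
  refine ⟨K * (3 + |κ|), m + 1, by positivity, fun z hz => ?_⟩
  have hρ := h.weight_pos z hz
  set δ := min 1 z with hδ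
  have hδ0 : 0 < δ := lt_min one_pos hz
  have hδ1 : δ ≤ 1 := min_le_left _ _
  have hδz : δ ≤ z := min_le_right _ _
  set A := K * ρ z * (1 + z) ^ m * Real.exp z with hA
  have hA0 : 0 ≤ A := by positivity
  have hpos : ∀ y ∈ Icc z (z + δ), 0 < y := fun y hy => hz.trans_le hy.1
  have hb : ∀ y ∈ Icc z (z + δ), |g y| ≤ A := by
    intro y hy
    have hy0 := hpos y hy
    have hq1 : 1 ≤ y / z := (one_le_div hz).2 hy.1
    have hq2 : y / z ≤ 2 := (div_le_iff₀ hz).2 (by linarith [hy.2])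
    have hρy : ρ y ≤ D * 3 ^ n * ρ z := by
      have h1 := h.weight_mul (y / z) z (by positivity) hz
      rw [div_mul_cancel₀ _ hz.ne'] at h1
      refine h1.trans ?_
      gcongr
      refine (hD _ (by positivity)).trans ?_
      gcongr
      have : 1 / (y / z) ≤ 1 := (div_le_one (by positivity)).2 hq1
      linarith
    calc |g y| ≤ C * ρ y * (1 + y) ^ m * Real.exp y := hC y hy0
      _ ≤ C * (D * 3 ^ n * ρ z) * (2 * (1 + z)) ^ m * Real.exp (1 + z) := by
        gcongr <;> linarith [hy.2]
      _ = A := by rw [Real.exp_add, mul_pow, hA, hK]; ring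
  have hb2 : ∀ y ∈ Icc z (z + δ), |(1 + κ / y ^ 2) * g y| ≤ (1 + |κ| / z ^ 2) * A := by
    intro y hy
    have hy0 := hpos y hy
    rw [abs_mul]
    have : |1 + κ / y ^ 2| ≤ 1 + |κ| / z ^ 2 := by
      refine (abs_add_le _ _).trans ?_
      rw [abs_one, abs_div, abs_of_pos (by positivity : 0 < y ^ 2)]
      have := hy.1
      gcongr
    exact mul_le_mul this (hb y hy) (abs_nonneg _) (by positivity)
  have key := abs_deriv_le_of_abs_le hδ0 (fun y hy => (h.solves y (hpos y hy)).1)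
    (fun y hy => (h.solves y (hpos y hy)).2) hb hb2
  rw [abs_mul, abs_of_pos hz]
  have e1 : z / δ ≤ 1 + z := by
    rw [div_le_iff₀ hδ0, hδ]
    rcases min_cases 1 z with ⟨h1, _⟩ | ⟨h1, _⟩ <;> rw [h1] <;> nlinarith
  have e2 : δ / z ≤ 1 := (div_le_one hz).2 hδz
  calc z * |g' z| ≤ z * (2 * A / δ + (1 + |κ| / z ^ 2) * A * δ) := by gcongr
    _ = A * (2 * (z / δ) + z * δ + |κ| * (δ / z)) := by field_simp; ring
    _ ≤ A * (2 * (1 + z) + z * 1 + |κ| * 1) := by gcongr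
    _ ≤ A * ((3 + |κ|) * (1 + z)) := by
      gcongr
      nlinarith [abs_nonneg κ]
    _ = _ := by rw [hA, pow_succ]; ring

end BesselProfile

/-! ### The Bessel heat kernel -/

/-- The Bessel heat kernel built from the solution `g` of the normal form. -/
def heatK (g : ℝ → ℝ) (X T y : ℝ) : ℝ :=
  (2 * T) ^ (-(1 / 2) : ℝ) * g (X * y / (2 * T)) * Real.exp (-((X ^ 2 + y ^ 2) / (4 * T)))

/-- The derivative of the heat kernel in space. -/
def heatKX (g g' : ℝ → ℝ) (X T y : ℝ) : ℝ :=
  (2 * T) ^ (-(1 / 2) : ℝ) * (y / (2 * T) * g' (X * y / (2 * T)) - X / (2 * T) * g (X * y / (2 * T))) *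
    Real.exp (-((X ^ 2 + y ^ 2) / (4 * T)))

/-- The derivative of the heat kernel in time. -/
def heatKT (g g' : ℝ → ℝ) (X T y : ℝ) : ℝ :=
  (2 * T) ^ (-(1 / 2) : ℝ) * (((X ^ 2 + y ^ 2) / (4 * T ^ 2) - 1 / (2 * T)) * g (X * y / (2 * T))
    - X * y / (2 * T ^ 2) * g' (X * y / (2 * T))) * Real.exp (-((X ^ 2 + y ^ 2) / (4 * T)))

lemma heatK_symm (g : ℝ → ℝ) (X T y : ℝ) : heatK g X T y = heatK g y T X := by
  rw [heatK, heatK, mul_comm X y, add_comm]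

lemma heatKT_symm (g g' : ℝ → ℝ) (X T y : ℝ) : heatKT g g' X T y = heatKT g g' y T X := by
  rw [heatKT, heatKT, mul_comm X y, add_comm (X ^ 2)]

section Derivatives

variable {κ : ℝ} {g g' : ℝ → ℝ}

/-- Stated along a curve (X(t), T(t)) to serve both the space derivative, with T constant, and the
time derivative along the time change. -/
lemma hasDerivAt_heatK_comp (hg : SolvesNormalBessel κ g g') {X T : ℝ → ℝ} {X' T' t y : ℝ}
    (hX : HasDerivAt X X' t) (hT : HasDerivAt T T' t) (hX0 : 0 < X t) (hT0 : 0 < T t) (hy : 0 < y) :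
    HasDerivAt (fun t => heatK g (X t) (T t) y)
      (heatKX g g' (X t) (T t) y * X' + heatKT g g' (X t) (T t) y * T') t := by
  have hz : 0 < X t * y / (2 * T t) := by positivity
  have d1 := (hT.const_mul 2).rpow_const (p := (-(1/2) : ℝ)) (Or.inl (by positivity : 2 * T t ≠ 0))
  have d2 := (hX.mul_const y).fun_div (hT.const_mul 2) (by positivity : 2 * T t ≠ 0)
  have d3 : HasDerivAt (fun t => g (X t * y / (2 * T t))) _ t := HasDerivAt.comp t (hg _ hz).1 d2
  have d4 := (((hX.fun_pow 2).add_const (y ^ 2)).fun_div (hT.const_mul 4) (by positivity : 4 * T t ≠ 0)).fun_neg.exp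
  refine ((d1.mul d3).mul d4).congr_deriv ?_
  rw [heatKX, heatKT, Real.rpow_sub_one (by positivity)]
  simp only [Pi.mul_apply]
  have hTn := hT0.ne'
  field_simp
  push_cast
  ring

/-- This is the Bessel heat equation K_XX = K_T + (κ/X²) K; the normal form eliminates g''. -/
lemma hasDerivAt_heatKX (hg : SolvesNormalBessel κ g g') {X T y : ℝ} (hX : 0 < X) (hT : 0 < T) (hy : 0 < y) :
    HasDerivAt (fun X => heatKX g g' X T y) (heatKT g g' X T y + κ / X ^ 2 * heatK g X T y) X := by
  have hz : 0 < X * y / (2 * T) := by positivity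
  have d2 : HasDerivAt (fun X : ℝ => X * y / (2 * T)) (y / (2 * T)) X := by
    simpa using ((hasDerivAt_id X).mul_const y).div_const (2 * T)
  have d3 : HasDerivAt (fun X => g (X * y / (2 * T))) _ X := HasDerivAt.comp X (hg _ hz).1 d2
  have d4 : HasDerivAt (fun X => g' (X * y / (2 * T))) _ X := HasDerivAt.comp X (hg _ hz).2 d2
  have d5 : HasDerivAt (fun X : ℝ => Real.exp (-((X ^ 2 + y ^ 2) / (4 * T)))) _ X :=
    ((((hasDerivAt_id' X).fun_pow 2).add_const (y ^ 2)).div_const (4 * T)).fun_neg.exp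
  have d6 : HasDerivAt (fun X : ℝ => X / (2 * T)) (1 / (2 * T)) X := (hasDerivAt_id' X).div_const _
  refine ((((d4.const_mul (y / (2 * T))).sub (d6.mul d3)).const_mul ((2 * T) ^ (-(1/2) : ℝ))).mul d5).congr_deriv ?_
  rw [heatK, heatKT]
  simp only [Pi.mul_apply, Pi.sub_apply]
  field_simp
  push_cast
  ring

end Derivatives

/-! ### Global bounds for the heat kernel -/

/-- A measure for the distance of `(X, T)` from the boundary of the open quadrant. -/
def quadSize (X T : ℝ) : ℝ := X + 1 / X + (T + 1 / T)

section Bounds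

variable {X T y : ℝ}

lemma two_le_add_one_div (hX : 0 < X) : 2 ≤ X + 1 / X := by
  have : X + 1 / X - 2 = (X - 1) ^ 2 / X := by field_simp; ring
  have h2 : 0 ≤ (X - 1) ^ 2 / X := by positivity
  linarith

lemma quadSize_bounds (hX : 0 < X) (hT : 0 < T) : 4 ≤ quadSize X T ∧ X ≤ quadSize X T ∧
    1 / X ≤ quadSize X T ∧ T ≤ quadSize X T ∧ 1 / T ≤ quadSize X T := by
  have h1 := two_le_add_one_div hX
  have h2 := two_le_add_one_div hT
  have h3 : 0 < 1 / X := by positivity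
  have h4 : 0 < 1 / T := by positivity
  unfold quadSize
  refine ⟨?_, ?_, ?_, ?_, ?_⟩ <;> linarith

/-- The first factor pays for the growth e^z of g at z = Xy/2T, and a full Gaussian in X - y
remains. -/
lemma exp_heat_split (hT : 0 < T) :
    Real.exp (-((X ^ 2 + y ^ 2) / (4 * T))) = Real.exp (-(X * y / (2 * T))) * Real.exp (-((X - y) ^ 2 / (4 * T))) := by
  rw [← Real.exp_add]; congr 1; field_simp; ring

/-- Polynomial growth is absorbed by half of the Gaussian. -/
lemma one_add_pow_mul_exp_le (M : ℕ) : ∃ C, 0 ≤ C ∧ ∀ X T y : ℝ, 0 < X → 0 < T → 0 < y →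
    (1 + y) ^ M * Real.exp (-((X - y) ^ 2 / (4 * T)))
      ≤ C * quadSize X T ^ (3 * M) * Real.exp (-((X - y) ^ 2 / (8 * T))) := by
  refine ⟨(M.factorial : ℝ) * Real.exp 1 * 4 ^ M, by positivity, fun X T y hX hT hy => ?_⟩
  obtain ⟨hS4, hSX, -, hST, -⟩ := quadSize_bounds hX hT
  set S := quadSize X T with hS
  have hu : 0 ≤ (X - y) ^ 2 / (8 * T) := by positivity
  have h1 : Real.exp (-((X - y) ^ 2 / (4 * T))) =
      Real.exp (-((X - y) ^ 2 / (8 * T))) * Real.exp (-((X - y) ^ 2 / (8 * T))) := by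
    rw [← Real.exp_add]; congr 1; field_simp; ring
  -- With u = (X-y)²/8T the polynomial is at most a power of 4S³ times (1 + u)^M, and one half
  -- e^{-u} of the Gaussian absorbs (1 + u)^M.
  have h2 : (1 + y) ≤ 4 * S ^ 3 * (1 + (X - y) ^ 2 / (8 * T)) := by
    have e : (X - y) ^ 2 = 8 * T * ((X - y) ^ 2 / (8 * T)) := by field_simp
    have h3 : y ≤ X + 1 + (X - y) ^ 2 := by nlinarith [sq_nonneg (X - y - 1), sq_nonneg (X - y + 1)]
    have h4 : 1 + y ≤ 2 + X + 8 * T * ((X - y) ^ 2 / (8 * T)) := by rw [← e]; linarith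
    have h5 : 8 * T ≤ 4 * S ^ 3 := by
      have : S ^ 3 ≥ 16 * S := by nlinarith [mul_self_nonneg S, mul_nonneg (by linarith : 0 ≤ S) (by nlinarith : 0 ≤ S ^ 2 - 16)]
      nlinarith
    have h6 : 2 + X ≤ 4 * S ^ 3 := by
      have : S ^ 3 ≥ 16 * S := by nlinarith [mul_self_nonneg S, mul_nonneg (by linarith : 0 ≤ S) (by nlinarith : 0 ≤ S ^ 2 - 16)]
      nlinarith
    calc 1 + y ≤ 2 + X + 8 * T * ((X - y) ^ 2 / (8 * T)) := h4
      _ ≤ 4 * S ^ 3 + 4 * S ^ 3 * ((X - y) ^ 2 / (8 * T)) := by gcongr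
      _ = _ := by ring
  have h7 : (1 + (X - y) ^ 2 / (8 * T)) ^ M * Real.exp (-((X - y) ^ 2 / (8 * T))) ≤ M.factorial * Real.exp 1 := by
    have := Real.pow_div_factorial_le_exp (1 + (X - y) ^ 2 / (8 * T)) (by positivity) M
    rw [div_le_iff₀ (by positivity), Real.exp_add] at this
    rw [Real.exp_neg, ← div_eq_mul_inv, div_le_iff₀ (Real.exp_pos _)]
    linarith
  have hS0 : 0 < S := by linarith
  rw [h1, ← mul_assoc]
  refine mul_le_mul_of_nonneg_right ?_ (Real.exp_pos _).le
  calc (1 + y) ^ M * Real.exp (-((X - y) ^ 2 / (8 * T)))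
      ≤ (4 * S ^ 3 * (1 + (X - y) ^ 2 / (8 * T))) ^ M * Real.exp (-((X - y) ^ 2 / (8 * T))) := by
        gcongr
    _ = (4 * S ^ 3) ^ M * ((1 + (X - y) ^ 2 / (8 * T)) ^ M * Real.exp (-((X - y) ^ 2 / (8 * T)))) := by
        rw [mul_pow]; ring
    _ ≤ (4 * S ^ 3) ^ M * (M.factorial * Real.exp 1) := by gcongr
    _ = _ := by rw [mul_pow, ← pow_mul]; ring

end Bounds

lemma le_one_add_sq (x : ℝ) : x ≤ 1 + x ^ 2 := by nlinarith [sq_nonneg (x - 1)]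

lemma pow_le_pow_mul {S w : ℝ} (hS : 1 ≤ S) (hw : 1 ≤ w) {p q : ℕ} (h : p ≤ q) : S ^ p ≤ S ^ q * w :=
  (pow_le_pow_right₀ hS h).trans (le_mul_of_one_le_right (by positivity) hw)

lemma sq_add_sq_div_four_le {S y : ℝ} (hS : 1 ≤ S) (hy : 0 < y) : (S ^ 2 + y ^ 2) / 4 ≤ S ^ 2 * (1 + y) ^ 2 := by
  have h1 : 1 ≤ S ^ 2 := one_le_pow₀ hS
  have h2 : y ^ 2 ≤ S ^ 2 * y ^ 2 := le_mul_of_one_le_left (sq_nonneg y) h1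
  have h3 : 0 < S ^ 2 * y := by positivity
  nlinarith [sq_nonneg y]

set_option maxHeartbeats 1000000 in
/-- The heat kernel and its derivatives are dominated by the weight, with an arbitrary polynomial
decay and with constants that grow polynomially at the boundary of the quadrant. -/
lemma BesselProfile.heat_bounds {κ L : ℝ} {g g' ρ : ℝ → ℝ} (h : BesselProfile κ L g g' ρ) (N : ℕ) :
    ∃ (C : ℝ) (m : ℕ), 0 ≤ C ∧ ∀ X T y : ℝ, 0 < X → 0 < T → 0 < y →
      |heatK g X T y| ≤ C * quadSize X T ^ m * (ρ y / (1 + y) ^ N) * Real.exp (-((X - y) ^ 2 / (8 * T))) ∧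
      |heatKX g g' X T y| ≤ C * quadSize X T ^ m * (ρ y / (1 + y) ^ N) * Real.exp (-((X - y) ^ 2 / (8 * T))) ∧
      |heatKT g g' X T y| ≤ C * quadSize X T ^ m * (ρ y / (1 + y) ^ N) * Real.exp (-((X - y) ^ 2 / (8 * T))) := by
  obtain ⟨C₁, m₁, hC₁, b₁⟩ := h.bound
  obtain ⟨C₂, m₂, hC₂, b₂⟩ := h.bound_deriv
  obtain ⟨D, n, hD0, hD⟩ := h.weight_le
  set m := m₁ + m₂ with hm
  obtain ⟨G, hG0, hG⟩ := one_add_pow_mul_exp_le (m + 2 + N)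
  set C₀ := C₁ + C₂ with hC₀
  have b : ∀ z, 0 < z → |g z| ≤ C₀ * ρ z * (1 + z) ^ m * Real.exp z ∧
      |z * g' z| ≤ C₀ * ρ z * (1 + z) ^ m * Real.exp z := by
    intro z hz
    have hρ := h.weight_pos z hz
    have h1 : (1 : ℝ) ≤ 1 + z := by linarith
    refine ⟨(b₁ z hz).trans ?_, (b₂ z hz).trans ?_⟩
    · gcongr <;> linarith
    · gcongr <;> linarith
  -- Powers of S: 5 for the prefactors of the derivatives, 2n from ρ(z) ≤ ρ(X/2T) ρ(y), 2m from 1 +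
  -- z ≤ S²(1+y), and 3(m+2+N) from absorbing (1+y)^{m+2+N}. The N spare powers of 1 + y become the
  -- decay (1+y)^{-N}.
  refine ⟨3 * (C₀ * (D * 3 ^ n)) * G, 5 + (2 * n + 2 * m) + 3 * (m + 2 + N), by positivity,
    fun X T y hX hT hy => ?_⟩
  obtain ⟨hS4, hSX, hSX', hST, hST'⟩ := quadSize_bounds hX hT
  set S := quadSize X T with hS
  have hS0 : 0 < S := by linarith
  have hS1 : 1 ≤ S := by linarith
  have hρ := h.weight_pos y hy
  set z := X * y / (2 * T) with hzdef
  have hz : 0 < z := by positivity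
  have hXT : X * (1 / T) ≤ S * S := by gcongr
  have hTX : T * (1 / X) ≤ S * S := by gcongr
  have hρz : ρ z ≤ D * (3 * S ^ 2) ^ n * ρ y := by
    have e : z = X / (2 * T) * y := by rw [hzdef]; ring
    rw [e]
    refine (h.weight_mul _ _ (by positivity) hy).trans ?_
    gcongr
    refine (hD _ (by positivity)).trans ?_
    gcongr
    have e1 : X / (2 * T) = X * (1 / T) / 2 := by field_simp
    have e2 : 1 / (X / (2 * T)) = 2 * (T * (1 / X)) := by field_simp
    rw [e2, e1, sq]
    linarith [mul_pos hS0 hS0]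
  have h1z : 1 + z ≤ S ^ 2 * (1 + y) := by
    have e : z = X * (1 / T) * y / 2 := by rw [hzdef]; field_simp
    rw [e]
    have : X * (1 / T) * y ≤ S * S * y := by gcongr
    rw [mul_one_add, sq]
    linarith [mul_pos (mul_pos hS0 hS0) hy, one_le_mul_of_one_le_of_one_le hS1 hS1]
  set q := Real.exp (-((X - y) ^ 2 / (4 * T))) with hq
  set E := C₀ * (D * 3 ^ n) * S ^ (2 * n + 2 * m) * ρ y * (1 + y) ^ m * q with hE
  have hE0 : 0 ≤ E := by positivity
  have hexp := exp_heat_split (X := X) (y := y) hT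
  rw [← hzdef, ← hq] at hexp
  have hcom : C₀ * ρ z * (1 + z) ^ m * Real.exp z * Real.exp (-((X ^ 2 + y ^ 2) / (4 * T))) ≤ E := by
    have e : Real.exp z * (Real.exp (-z) * q) = q := by rw [← mul_assoc, ← Real.exp_add]; simp
    rw [hexp, mul_assoc _ (Real.exp z), e, hE]
    calc C₀ * ρ z * (1 + z) ^ m * q ≤ C₀ * (D * (3 * S ^ 2) ^ n * ρ y) * (S ^ 2 * (1 + y)) ^ m * q := by gcongr
      _ = _ := by rw [mul_pow, mul_pow, ← pow_mul, ← pow_mul, pow_add]; ring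
  have hg : |g z| * Real.exp (-((X ^ 2 + y ^ 2) / (4 * T))) ≤ E :=
    (mul_le_mul_of_nonneg_right (b z hz).1 (Real.exp_pos _).le).trans hcom
  have hg' : |z * g' z| * Real.exp (-((X ^ 2 + y ^ 2) / (4 * T))) ≤ E :=
    (mul_le_mul_of_nonneg_right (b z hz).2 (Real.exp_pos _).le).trans hcom
  have hT2 : (2 * T) ^ (-(1 / 2) : ℝ) ≤ S := by
    rw [Real.rpow_neg (by positivity), ← Real.sqrt_eq_rpow]
    have h2 : 0 < √(2 * T) := by positivity
    have h3 : √(2 * T) ^ 2 = 2 * T := Real.sq_sqrt (by positivity)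
    have h4 : (√(2 * T))⁻¹ ≤ 1 + ((√(2 * T))⁻¹) ^ 2 := le_one_add_sq _
    rw [inv_pow, h3] at h4
    have h5 : (2 * T)⁻¹ ≤ 1 / T := by rw [inv_eq_one_div]; gcongr; linarith
    have h6 := two_le_add_one_div hX
    have : S = X + 1 / X + (T + 1 / T) := rfl
    linarith
  have hT2' : 0 < (2 * T) ^ (-(1 / 2) : ℝ) := by positivity
  have fin : 3 * S ^ 5 * (1 + y) ^ 2 * E ≤ 3 * (C₀ * (D * 3 ^ n)) * G * S ^ (5 + (2 * n + 2 * m) + 3 * (m + 2 + N)) *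
      (ρ y / (1 + y) ^ N) * Real.exp (-((X - y) ^ 2 / (8 * T))) := by
    have := hG X T y hX hT hy
    rw [← hq, ← hS] at this
    calc 3 * S ^ 5 * (1 + y) ^ 2 * E = 3 * (C₀ * (D * 3 ^ n)) * S ^ (5 + (2 * n + 2 * m)) * (ρ y / (1 + y) ^ N) *
        ((1 + y) ^ (m + 2 + N) * q) := by
          rw [hE, pow_add (1 + y) (m + 2) N, pow_add (1 + y) m 2, pow_add S 5]; field_simp
      _ ≤ 3 * (C₀ * (D * 3 ^ n)) * S ^ (5 + (2 * n + 2 * m)) * (ρ y / (1 + y) ^ N) *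
        (G * S ^ (3 * (m + 2 + N)) * Real.exp (-((X - y) ^ 2 / (8 * T)))) := by gcongr
      _ = _ := by rw [pow_add S (5 + (2 * n + 2 * m))]; ring
  have hy1 : (1 : ℝ) ≤ (1 + y) ^ 2 := one_le_pow₀ (by linarith)
  set e := Real.exp (-((X ^ 2 + y ^ 2) / (4 * T))) with he
  have he0 : 0 < e := Real.exp_pos _
  clear_value e E q z S
  refine ⟨le_trans ?_ fin, le_trans ?_ fin, le_trans ?_ fin⟩
  · rw [heatK, ← hzdef, ← he, abs_mul, abs_mul, abs_of_pos hT2', abs_of_pos he0, mul_assoc]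
    have h5 : S ≤ 3 * S ^ 5 * (1 + y) ^ 2 := by
      linarith [pow_le_pow_mul hS1 hy1 (by norm_num : 1 ≤ 5), pow_pos hS0 5, mul_pos (pow_pos hS0 5) (zero_lt_one.trans_le hy1)]
    calc _ ≤ S * E := mul_le_mul hT2 hg (by positivity) hS0.le
      _ ≤ 3 * S ^ 5 * (1 + y) ^ 2 * E := by
        gcongr
  -- The factor y/(2T) equals z/X, so the bound for z g'(z) applies.
  · have e1 : y / (2 * T) * g' z - X / (2 * T) * g z = 1 / X * (z * g' z) - X * (1 / T) / 2 * g z := by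
      rw [hzdef]; field_simp
    rw [heatKX, ← hzdef, ← he, e1, abs_mul, abs_mul, abs_of_pos hT2', abs_of_pos he0, mul_assoc]
    have h5 : S * (S + S ^ 2) ≤ 3 * S ^ 5 * (1 + y) ^ 2 := by
      linarith [pow_le_pow_mul hS1 hy1 (by norm_num : 2 ≤ 5), pow_le_pow_mul hS1 hy1 (by norm_num : 3 ≤ 5),
        mul_pos (pow_pos hS0 5) (zero_lt_one.trans_le hy1)]
    calc _ ≤ S * ((S + S ^ 2) * E) := by
          refine mul_le_mul hT2 ?_ (by positivity) hS0.le
          calc _ ≤ (1 / X * |z * g' z| + X * (1 / T) / 2 * |g z|) * e := by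
                gcongr
                refine (abs_sub _ _).trans_eq ?_
                rw [abs_mul (1 / X), abs_mul (_ / 2), abs_of_pos (by positivity : 0 < 1 / X),
                  abs_of_pos (by positivity : 0 < X * (1 / T) / 2)]
            _ = 1 / X * (|z * g' z| * e) + X * (1 / T) / 2 * (|g z| * e) := by ring
            _ ≤ S * E + S ^ 2 * E := by
                gcongr
                linarith [mul_pos hX (one_div_pos.2 hT)]
            _ = _ := by ring
      _ = S * (S + S ^ 2) * E := by ring
      _ ≤ _ := by gcongr
  · have e1 : ((X ^ 2 + y ^ 2) / (4 * T ^ 2) - 1 / (2 * T)) * g z - X * y / (2 * T ^ 2) * g' z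
        = ((X ^ 2 + y ^ 2) / 4 * (1 / T) ^ 2 - 1 / T / 2) * g z - 1 / T * (z * g' z) := by
      rw [hzdef]; field_simp
    rw [heatKT, ← hzdef, ← he, e1, abs_mul, abs_mul, abs_of_pos hT2', abs_of_pos he0, mul_assoc]
    have hT0 : 0 < 1 / T := by positivity
    have hco : |(X ^ 2 + y ^ 2) / 4 * (1 / T) ^ 2 - 1 / T / 2| ≤ 2 * S ^ 4 * (1 + y) ^ 2 := by
      refine (abs_sub _ _).trans ?_
      rw [abs_of_pos (by positivity), abs_of_pos (by positivity)]
      have h6 : (X ^ 2 + y ^ 2) / 4 * (1 / T) ^ 2 ≤ S ^ 4 * (1 + y) ^ 2 := by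
        calc (X ^ 2 + y ^ 2) / 4 * (1 / T) ^ 2 ≤ (S ^ 2 + y ^ 2) / 4 * S ^ 2 := by gcongr
          _ ≤ S ^ 2 * (1 + y) ^ 2 * S ^ 2 := by
            gcongr
            exact sq_add_sq_div_four_le hS1 hy
          _ = _ := by ring
      have h7 : 1 / T / 2 ≤ S ^ 4 * (1 + y) ^ 2 := by
        linarith [pow_le_pow_mul hS1 hy1 (by norm_num : 1 ≤ 4)]
      linarith
    calc _ ≤ S * ((2 * S ^ 4 * (1 + y) ^ 2 + S) * E) := by
          refine mul_le_mul hT2 ?_ (by positivity) hS0.le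
          calc _ ≤ (|(X ^ 2 + y ^ 2) / 4 * (1 / T) ^ 2 - 1 / T / 2| * |g z| + 1 / T * |z * g' z|) * e := by
                gcongr
                refine (abs_sub _ _).trans_eq ?_
                rw [abs_mul, abs_mul (1 / T), abs_of_pos hT0]
            _ = |(X ^ 2 + y ^ 2) / 4 * (1 / T) ^ 2 - 1 / T / 2| * (|g z| * e) + 1 / T * (|z * g' z| * e) := by ring
            _ ≤ 2 * S ^ 4 * (1 + y) ^ 2 * E + S * E := by gcongr
            _ = _ := by ring
      _ ≤ S * (3 * S ^ 4 * (1 + y) ^ 2 * E) := by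
          gcongr
          linarith [pow_le_pow_mul hS1 hy1 (by norm_num : 1 ≤ 4)]
      _ = _ := by ring

/-! ### Integrals against kernels with Gaussian domination -/

/-- A kernel on the octant which is dominated by the weight `w` times a Gaussian. -/
structure HeatDominated (w : ℝ → ℝ) (k : ℝ → ℝ → ℝ → ℝ) : Prop where
  cont : ContinuousOn (fun p : ℝ × ℝ × ℝ => k p.1 p.2.1 p.2.2) (Ioi 0 ×ˢ Ioi 0 ×ˢ Ioi 0)
  bound : ∃ (C : ℝ) (m : ℕ), 0 ≤ C ∧ ∀ X T y : ℝ, 0 < X → 0 < T → 0 < y →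
    |k X T y| ≤ C * quadSize X T ^ m * w y * Real.exp (-((X - y) ^ 2 / (8 * T)))

/-- The integral of a density against a kernel. -/
def heatInt (k : ℝ → ℝ → ℝ → ℝ) (α : ℝ → ℝ) (X T : ℝ) : ℝ := ∫ y in Ioi (0 : ℝ), k X T y * α y

section Dominated

variable {w α : ℝ → ℝ} {k : ℝ → ℝ → ℝ → ℝ}

lemma quadSize_nonneg {X T : ℝ} (hX : 0 < X) (hT : 0 < T) : 0 ≤ quadSize X T := by
  linarith [(quadSize_bounds hX hT).1]

lemma HeatDominated.continuousOn (hk : HeatDominated w k) {X T : ℝ} (hX : 0 < X) (hT : 0 < T) :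
    ContinuousOn (k X T) (Ioi 0) := by
  have : ContinuousOn (fun y : ℝ => (X, T, y)) (Ioi 0) := by fun_prop
  exact hk.cont.comp this fun y hy => ⟨hX, hT, hy⟩

lemma HeatDominated.aestronglyMeasurable (hk : HeatDominated w k) (hα : ContinuousOn α (Ioi 0)) {X T : ℝ}
    (hX : 0 < X) (hT : 0 < T) : AEStronglyMeasurable (fun y => k X T y * α y) (volume.restrict (Ioi 0)) :=
  ((hk.continuousOn hX hT).mul hα).aestronglyMeasurable measurableSet_Ioi

lemma HeatDominated.abs_le (hk : HeatDominated w k) : ∃ (C : ℝ) (m : ℕ), 0 ≤ C ∧ ∀ X T y : ℝ, 0 < X → 0 < T → 0 < y →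
    |k X T y * α y| ≤ C * quadSize X T ^ m * |w y * α y| * Real.exp (-((X - y) ^ 2 / (8 * T))) := by
  obtain ⟨C, m, hC, h⟩ := hk.bound
  refine ⟨C, m, hC, fun X T y hX hT hy => ?_⟩
  have hS := quadSize_nonneg hX hT
  rw [abs_mul, abs_mul]
  calc |k X T y| * |α y| ≤ C * quadSize X T ^ m * w y * Real.exp (-((X - y) ^ 2 / (8 * T))) * |α y| := by
        gcongr; exact h X T y hX hT hy
    _ ≤ C * quadSize X T ^ m * |w y| * Real.exp (-((X - y) ^ 2 / (8 * T))) * |α y| := by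
        gcongr; exact le_abs_self _
    _ = _ := by ring

lemma exp_neg_sq_div_le_one {a T : ℝ} (hT : 0 < T) : Real.exp (-(a ^ 2 / (8 * T))) ≤ 1 :=
  Real.exp_le_one_iff.2 (neg_nonpos.2 (by positivity))

lemma HeatDominated.integrableOn (hk : HeatDominated w k) (hα : ContinuousOn α (Ioi 0))
    (hw : IntegrableOn (fun y => w y * α y) (Ioi 0)) {X T : ℝ} (hX : 0 < X) (hT : 0 < T) :
    IntegrableOn (fun y => k X T y * α y) (Ioi 0) := by
  obtain ⟨C, m, hC, h⟩ := hk.abs_le (α := α)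
  refine Integrable.mono' (hw.abs.const_mul (C * quadSize X T ^ m)) (hk.aestronglyMeasurable hα hX hT) ?_
  filter_upwards [ae_restrict_mem measurableSet_Ioi] with y hy
  have hS := quadSize_nonneg hX hT
  exact (h X T y hX hT hy).trans (mul_le_of_le_one_right (by positivity) (exp_neg_sq_div_le_one hT))

lemma HeatDominated.abs_heatInt_le (hk : HeatDominated w k) (hw : IntegrableOn (fun y => w y * α y) (Ioi 0)) :
    ∃ (C : ℝ) (m : ℕ), 0 ≤ C ∧ ∀ X T : ℝ, 0 < X → 0 < T → |heatInt k α X T| ≤ C * quadSize X T ^ m := by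
  obtain ⟨C, m, hC, h⟩ := hk.abs_le (α := α)
  refine ⟨C * ∫ y in Ioi (0 : ℝ), |w y * α y|, m, mul_nonneg hC (integral_nonneg fun y => abs_nonneg _),
    fun X T hX hT => ?_⟩
  have hS := quadSize_nonneg hX hT
  have : ‖heatInt k α X T‖ ≤ ∫ y in Ioi (0 : ℝ), C * quadSize X T ^ m * |w y * α y| := by
    refine norm_integral_le_of_norm_le (hw.abs.const_mul _) ?_
    filter_upwards [ae_restrict_mem measurableSet_Ioi] with y hy
    exact (h X T y hX hT hy).trans (mul_le_of_le_one_right (by positivity) (exp_neg_sq_div_le_one hT))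
  rw [integral_const_mul, Real.norm_eq_abs] at this
  linarith

lemma continuousAt_quadSize {X T : ℝ} (hX : 0 < X) (hT : 0 < T) :
    ContinuousAt (fun p : ℝ × ℝ => quadSize p.1 p.2) (X, T) := by
  unfold quadSize
  fun_prop (disch := first | exact hX.ne' | exact hT.ne')

/-- The Gaussian is discarded and the constant made uniform near (X, T), so that |w α| becomes a
majorant independent of (X, T). -/
lemma HeatDominated.eventually_le (hk : HeatDominated w k) {X T : ℝ} (hX : 0 < X) (hT : 0 < T) :
    ∃ K, 0 ≤ K ∧ ∀ᶠ p : ℝ × ℝ in 𝓝 (X, T), 0 < p.1 ∧ 0 < p.2 ∧ ∀ y, 0 < y →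
      |k p.1 p.2 y * α y| ≤ K * |w y * α y| := by
  obtain ⟨C, m, hC, h⟩ := hk.abs_le (α := α)
  have hS := quadSize_nonneg hX hT
  refine ⟨C * (quadSize X T + 1) ^ m, by positivity, ?_⟩
  have e1 : ∀ᶠ p : ℝ × ℝ in 𝓝 (X, T), 0 < p.1 := continuousAt_fst.eventually (lt_mem_nhds hX)
  have e2 : ∀ᶠ p : ℝ × ℝ in 𝓝 (X, T), 0 < p.2 := continuousAt_snd.eventually (lt_mem_nhds hT)
  have e3 := (continuousAt_quadSize hX hT).eventually (gt_mem_nhds (lt_add_one _))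
  filter_upwards [e1, e2, e3] with p h1 h2 h3
  refine ⟨h1, h2, fun y hy => ?_⟩
  have hS' := quadSize_nonneg h1 h2
  refine ((h p.1 p.2 y h1 h2 hy).trans (mul_le_of_le_one_right (by positivity) (exp_neg_sq_div_le_one h2))).trans ?_
  gcongr

lemma HeatDominated.continuousAt_heatInt (hk : HeatDominated w k) (hα : ContinuousOn α (Ioi 0))
    (hw : IntegrableOn (fun y => w y * α y) (Ioi 0)) {X T : ℝ} (hX : 0 < X) (hT : 0 < T) :
    ContinuousAt (fun p : ℝ × ℝ => heatInt k α p.1 p.2) (X, T) := by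
  obtain ⟨K, hK, h⟩ := hk.eventually_le (α := α) hX hT
  refine continuousAt_of_dominated (bound := fun y => K * |w y * α y|) ?_ ?_ (hw.abs.const_mul K) ?_
  · filter_upwards [h] with p hp using hk.aestronglyMeasurable hα hp.1 hp.2.1
  · filter_upwards [h] with p hp
    filter_upwards [ae_restrict_mem measurableSet_Ioi] with y hy using hp.2.2 y hy
  · filter_upwards [ae_restrict_mem measurableSet_Ioi] with y hy
    refine ContinuousAt.mul ?_ continuousAt_const
    have h1 : ContinuousAt (fun p : ℝ × ℝ × ℝ => k p.1 p.2.1 p.2.2) (X, T, y) :=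
      hk.cont.continuousAt ((isOpen_Ioi.prod (isOpen_Ioi.prod isOpen_Ioi)).mem_nhds ⟨hX, hT, hy⟩)
    have h2 : ContinuousAt (fun p : ℝ × ℝ => (p.1, p.2, y)) (X, T) := by fun_prop
    exact ContinuousAt.comp (f := fun p : ℝ × ℝ => (p.1, p.2, y)) (x := (X, T)) h1 h2

end Dominated

section Kernels

variable {κ L : ℝ} {g g' ρ α : ℝ → ℝ}

lemma BesselProfile.continuousOn_comp {γ : ℝ → ℝ} (hγ : ContinuousOn γ (Ioi 0)) :
    ContinuousOn (fun p : ℝ × ℝ × ℝ => γ (p.1 * p.2.2 / (2 * p.2.1))) (Ioi 0 ×ˢ Ioi 0 ×ˢ Ioi 0) := by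
  refine hγ.comp ?_ ?_
  · refine ContinuousOn.div (by fun_prop) (by fun_prop) ?_
    rintro ⟨X, T, y⟩ ⟨_, hT : 0 < T, _⟩
    positivity
  · rintro ⟨X, T, y⟩ ⟨hX : 0 < X, hT : 0 < T, hy : 0 < y⟩
    exact mem_Ioi.2 (by positivity)

lemma continuousOn_heat_factors :
    ContinuousOn (fun p : ℝ × ℝ × ℝ => (2 * p.2.1) ^ (-(1 / 2) : ℝ)) (Ioi 0 ×ˢ Ioi 0 ×ˢ Ioi 0) ∧
    ContinuousOn (fun p : ℝ × ℝ × ℝ => Real.exp (-((p.1 ^ 2 + p.2.2 ^ 2) / (4 * p.2.1)))) (Ioi 0 ×ˢ Ioi 0 ×ˢ Ioi 0) := by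
  constructor
  · refine ContinuousOn.rpow_const (by fun_prop) ?_
    rintro ⟨X, T, y⟩ ⟨_, hT : 0 < T, _⟩
    exact Or.inl (by positivity)
  · refine Real.continuous_exp.comp_continuousOn (ContinuousOn.neg (ContinuousOn.div (by fun_prop) (by fun_prop) ?_))
    rintro ⟨X, T, y⟩ ⟨_, hT : 0 < T, _⟩
    positivity

namespace BesselProfile

lemma continuousOn_deriv (h : BesselProfile κ L g g' ρ) : ContinuousOn g' (Ioi 0) := fun z hz =>
  (h.solves z hz).2.continuousAt.continuousWithinAt

lemma dominated_heatK (h : BesselProfile κ L g g' ρ) (N : ℕ) :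
    HeatDominated (fun y => ρ y / (1 + y) ^ N) (heatK g) := by
  obtain ⟨C, m, hC, hb⟩ := h.heat_bounds N
  refine ⟨?_, C, m, hC, fun X T y hX hT hy => (hb X T y hX hT hy).1⟩
  exact (continuousOn_heat_factors.1.mul (continuousOn_comp h.solves.continuousOn)).mul continuousOn_heat_factors.2

lemma dominated_heatKX (h : BesselProfile κ L g g' ρ) (N : ℕ) :
    HeatDominated (fun y => ρ y / (1 + y) ^ N) (heatKX g g') := by
  obtain ⟨C, m, hC, hb⟩ := h.heat_bounds N
  refine ⟨?_, C, m, hC, fun X T y hX hT hy => (hb X T y hX hT hy).2.1⟩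
  refine (continuousOn_heat_factors.1.mul (ContinuousOn.sub (ContinuousOn.mul ?_
    (continuousOn_comp h.continuousOn_deriv)) (ContinuousOn.mul ?_
    (continuousOn_comp h.solves.continuousOn)))).mul continuousOn_heat_factors.2
  all_goals
    refine ContinuousOn.div (by fun_prop) (by fun_prop) ?_
    rintro ⟨X, T, y⟩ ⟨_, hT : 0 < T, _⟩
    positivity

lemma dominated_heatKT (h : BesselProfile κ L g g' ρ) (N : ℕ) :
    HeatDominated (fun y => ρ y / (1 + y) ^ N) (heatKT g g') := by
  obtain ⟨C, m, hC, hb⟩ := h.heat_bounds N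
  refine ⟨?_, C, m, hC, fun X T y hX hT hy => (hb X T y hX hT hy).2.2⟩
  refine (continuousOn_heat_factors.1.mul (ContinuousOn.sub (ContinuousOn.mul (ContinuousOn.sub ?_ ?_)
    (continuousOn_comp h.solves.continuousOn)) (ContinuousOn.mul ?_
    (continuousOn_comp h.continuousOn_deriv)))).mul continuousOn_heat_factors.2
  all_goals
    refine ContinuousOn.div (by fun_prop) (by fun_prop) ?_
    rintro ⟨X, T, y⟩ ⟨_, hT : 0 < T, _⟩
    positivity

/-- Differentiating under the integral along a curve builds in the chain rule, so joint
differentiability in (X, T) need not be established. -/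
lemma hasDerivAt_heatInt (h : BesselProfile κ L g g' ρ) {N : ℕ} (hα : ContinuousOn α (Ioi 0))
    (hw : IntegrableOn (fun y => ρ y / (1 + y) ^ N * α y) (Ioi 0)) {X T X' T' : ℝ → ℝ} {t : ℝ}
    (hX : ∀ s, HasDerivAt X (X' s) s) (hT : ∀ s, HasDerivAt T (T' s) s) (hX' : Continuous X') (hT' : Continuous T')
    (hXt : 0 < X t) (hTt : 0 < T t) :
    HasDerivAt (fun s => heatInt (heatK g) α (X s) (T s))
      (heatInt (heatKX g g') α (X t) (T t) * X' t + heatInt (heatKT g g') α (X t) (T t) * T' t) t := by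
  obtain ⟨K₁, hK₁, h₁⟩ := (h.dominated_heatKX N).eventually_le (α := α) hXt hTt
  obtain ⟨K₂, hK₂, h₂⟩ := (h.dominated_heatKT N).eventually_le (α := α) hXt hTt
  have hc : ContinuousAt (fun s => (X s, T s)) t := (hX t).continuousAt.prodMk (hT t).continuousAt
  have i₁ := (h.dominated_heatKX N).integrableOn hα hw hXt hTt
  have i₂ := (h.dominated_heatKT N).integrableOn hα hw hXt hTt
  have ev := (((hc.eventually h₁).and (hc.eventually h₂)).and
    ((hX'.abs.continuousAt (x := t)).eventually (gt_mem_nhds (lt_add_one _)))).and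
    ((hT'.abs.continuousAt (x := t)).eventually (gt_mem_nhds (lt_add_one _)))
  have key := hasDerivAt_integral_of_dominated_loc_of_deriv_le (μ := volume.restrict (Ioi (0 : ℝ)))
    (F := fun s y => heatK g (X s) (T s) y * α y)
    (F' := fun s y => (heatKX g g' (X s) (T s) y * X' s + heatKT g g' (X s) (T s) y * T' s) * α y)
    (bound := fun y => (K₁ * (|X' t| + 1) + K₂ * (|T' t| + 1)) * |ρ y / (1 + y) ^ N * α y|) ev ?_
    ((h.dominated_heatK N).integrableOn hα hw hXt hTt) ?_ ?_ (hw.abs.const_mul _) ?_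
  · refine key.2.congr_deriv ?_
    rw [heatInt, heatInt, ← integral_mul_const, ← integral_mul_const, ← integral_add (i₁.mul_const _) (i₂.mul_const _)]
    congr 1; ext y; ring
  · filter_upwards [ev] with s hs using (h.dominated_heatK N).aestronglyMeasurable hα hs.1.1.1.1 hs.1.1.1.2.1
  · have := ((i₁.mul_const (X' t)).add (i₂.mul_const (T' t))).aestronglyMeasurable
    refine this.congr (Eventually.of_forall fun y => ?_)
    simp only [Pi.add_apply]; ring
  · filter_upwards [ae_restrict_mem measurableSet_Ioi] with y hy s hs
    obtain ⟨⟨⟨a1, a2⟩, a3⟩, a4⟩ := hs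
    have e : (heatKX g g' (X s) (T s) y * X' s + heatKT g g' (X s) (T s) y * T' s) * α y
      = heatKX g g' (X s) (T s) y * α y * X' s + heatKT g g' (X s) (T s) y * α y * T' s := by ring
    rw [e, Real.norm_eq_abs]
    refine (abs_add_le _ _).trans ?_
    rw [abs_mul _ (X' s), abs_mul _ (T' s)]
    calc _ ≤ K₁ * |ρ y / (1 + y) ^ N * α y| * (|X' t| + 1) + K₂ * |ρ y / (1 + y) ^ N * α y| * (|T' t| + 1) := by
          refine add_le_add (mul_le_mul (a1.2.2 y hy) a3.le (abs_nonneg _) (by positivity))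
            (mul_le_mul (a2.2.2 y hy) a4.le (abs_nonneg _) (by positivity))
      _ = _ := by ring
  · filter_upwards [ae_restrict_mem measurableSet_Ioi] with y hy s hs
    exact (hasDerivAt_heatK_comp h.solves (hX s) (hT s) hs.1.1.1.1 hs.1.1.1.2.1 hy).mul_const _

/-- The Bessel heat equation passes to the integral; the majorant also controls κ/s² for s near X.
-/
lemma hasDerivAt_heatInt_heatKX (h : BesselProfile κ L g g' ρ) {N : ℕ} (hα : ContinuousOn α (Ioi 0))
    (hw : IntegrableOn (fun y => ρ y / (1 + y) ^ N * α y) (Ioi 0)) {X T : ℝ} (hX : 0 < X) (hT : 0 < T) :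
    HasDerivAt (fun ξ => heatInt (heatKX g g') α ξ T)
      (heatInt (heatKT g g') α X T + κ / X ^ 2 * heatInt (heatK g) α X T) X := by
  obtain ⟨K₁, hK₁, h₁⟩ := (h.dominated_heatKT N).eventually_le (α := α) hX hT
  obtain ⟨K₂, hK₂, h₂⟩ := (h.dominated_heatK N).eventually_le (α := α) hX hT
  have hc : ContinuousAt (fun s : ℝ => (s, T)) X := by fun_prop
  have hc2 : ContinuousAt (fun s : ℝ => |κ / s ^ 2|) X := by
    fun_prop (disch := exact pow_ne_zero 2 hX.ne')
  have i₁ := (h.dominated_heatKT N).integrableOn hα hw hX hT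
  have i₂ := (h.dominated_heatK N).integrableOn hα hw hX hT
  have ev := ((hc.eventually h₁).and (hc.eventually h₂)).and (hc2.eventually (gt_mem_nhds (lt_add_one _)))
  have key := hasDerivAt_integral_of_dominated_loc_of_deriv_le (μ := volume.restrict (Ioi (0 : ℝ)))
    (F := fun s y => heatKX g g' s T y * α y)
    (F' := fun s y => (heatKT g g' s T y + κ / s ^ 2 * heatK g s T y) * α y)
    (bound := fun y => (K₁ + (|κ / X ^ 2| + 1) * K₂) * |ρ y / (1 + y) ^ N * α y|) ev ?_
    ((h.dominated_heatKX N).integrableOn hα hw hX hT) ?_ ?_ (hw.abs.const_mul _) ?_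
  · refine key.2.congr_deriv ?_
    rw [heatInt, heatInt, ← integral_const_mul, ← integral_add i₁ (i₂.const_mul _)]
    congr 1; ext y; ring
  · filter_upwards [ev] with s hs using (h.dominated_heatKX N).aestronglyMeasurable hα hs.1.1.1 hT
  · have := (i₁.add (i₂.const_mul (κ / X ^ 2))).aestronglyMeasurable
    refine this.congr (Eventually.of_forall fun y => ?_)
    simp only [Pi.add_apply]; ring
  · filter_upwards [ae_restrict_mem measurableSet_Ioi] with y hy s hs
    obtain ⟨⟨a1, a2⟩, a3⟩ := hs
    have e : (heatKT g g' s T y + κ / s ^ 2 * heatK g s T y) * α y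
      = heatKT g g' s T y * α y + κ / s ^ 2 * (heatK g s T y * α y) := by ring
    rw [e, Real.norm_eq_abs]
    refine (abs_add_le _ _).trans ?_
    rw [abs_mul (κ / s ^ 2)]
    calc _ ≤ K₁ * |ρ y / (1 + y) ^ N * α y| + (|κ / X ^ 2| + 1) * (K₂ * |ρ y / (1 + y) ^ N * α y|) := by
          refine add_le_add (a1.2.2 y hy) (mul_le_mul a3.le (a2.2.2 y hy) (abs_nonneg _) (by positivity))
      _ = _ := by ring
  · filter_upwards [ae_restrict_mem measurableSet_Ioi] with y hy s hs
    exact (hasDerivAt_heatKX h.solves hs.1.1.1 hT hy).mul_const _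

end BesselProfile

end Kernels

/-! ### Heat integrals for small times -/

/-- For T ≤ 1 and X comparable to X₀ the size is O(1/T), while the exponential is O(T^{m+1}); one
power of T is left over. -/
lemma quadSize_pow_mul_exp_le {X₀ : ℝ} (h₀ : 0 < X₀) (m : ℕ) : ∃ C, 0 ≤ C ∧ ∀ X T a : ℝ, X₀ / 2 ≤ X → X ≤ 2 * X₀ →
    0 < T → T ≤ 1 → (X₀ / 4) ^ 2 ≤ a → quadSize X T ^ m * Real.exp (-(a / (8 * T))) ≤ C * T := by
  set K := 2 * X₀ + 2 / X₀ + 2 with hK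
  set q := (X₀ / 4) ^ 2 / 8 with hq
  have hq0 : 0 < q := by positivity
  refine ⟨K ^ m * ((m + 1).factorial / q ^ (m + 1)), by positivity, fun X T a h1 h2 hT hT1 ha => ?_⟩
  have hX : 0 < X := by linarith
  have hS : quadSize X T ≤ K / T := by
    rw [le_div_iff₀ hT, quadSize]
    have e1 : 1 / X ≤ 2 / X₀ := by
      rw [div_le_div_iff₀ hX h₀]; linarith
    have e2 : (T + 1 / T) * T ≤ 2 := by
      have : (T + 1 / T) * T = T ^ 2 + 1 := by field_simp
      rw [this]; nlinarith
    have e3 : (X + 1 / X) * T ≤ (2 * X₀ + 2 / X₀) * 1 := by gcongr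
    linarith
  have hS0 := quadSize_nonneg hX hT
  have e1 : Real.exp (-(a / (8 * T))) ≤ (m + 1).factorial / q ^ (m + 1) * T ^ (m + 1) := by
    have h3 : q / T ≤ a / (8 * T) := by
      rw [hq, div_div]; gcongr
    have h4 := Real.pow_div_factorial_le_exp (q / T) (by positivity) (m + 1)
    rw [Real.exp_neg]
    calc (Real.exp (a / (8 * T)))⁻¹ ≤ (Real.exp (q / T))⁻¹ := by gcongr
      _ ≤ ((q / T) ^ (m + 1) / (m + 1).factorial)⁻¹ := by gcongr
      _ = _ := by rw [div_pow]; field_simp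
  calc quadSize X T ^ m * Real.exp (-(a / (8 * T)))
      ≤ (K / T) ^ m * ((m + 1).factorial / q ^ (m + 1) * T ^ (m + 1)) := by gcongr
    _ = _ := by rw [div_pow, pow_succ T]; field_simp

lemma sq_le_sub_sq {X₀ X y : ℝ} (h1 : 3 * X₀ / 4 ≤ X) (h2 : X ≤ 3 * X₀ / 2) (h₀ : 0 < X₀)
    (hy : y ≤ X₀ / 2 ∨ 2 * X₀ ≤ y) : (X₀ / 4) ^ 2 ≤ (X - y) ^ 2 := by
  rw [sq_le_sq, abs_of_pos (by linarith)]
  rcases hy with hy | hy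
  · rw [le_abs]; left; linarith
  · rw [le_abs]; right; linarith

/-- Far away from the base point the heat kernel does not contribute as the time tends to zero. -/
lemma HeatDominated.abs_heatInt_sub_le {w α : ℝ → ℝ} {k : ℝ → ℝ → ℝ → ℝ} (hk : HeatDominated w k)
    (hα : ContinuousOn α (Ioi 0)) (hw : IntegrableOn (fun y => w y * α y) (Ioi 0)) {X₀ : ℝ} (h₀ : 0 < X₀) :
    ∃ C, 0 ≤ C ∧ ∀ X T : ℝ, 3 * X₀ / 4 ≤ X → X ≤ 3 * X₀ / 2 → 0 < T → T ≤ 1 →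
      |heatInt k α X T - ∫ y in (X₀ / 2)..(2 * X₀), k X T y * α y| ≤ C * T := by
  obtain ⟨C, m, hC, h⟩ := hk.abs_le (α := α)
  obtain ⟨D, hD, h'⟩ := quadSize_pow_mul_exp_le h₀ m
  refine ⟨C * D * ∫ y in Ioi (0 : ℝ), |w y * α y|, mul_nonneg (mul_nonneg hC hD)
    (integral_nonneg fun y => abs_nonneg _), fun X T h1 h2 hT hT1 => ?_⟩
  have hX : 0 < X := by linarith
  have hi := hk.integrableOn hα hw hX hT
  have hsub : Ioi (0 : ℝ) ∩ Ioc (X₀ / 2) (2 * X₀) = Ioc (X₀ / 2) (2 * X₀) :=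
    inter_eq_right.2 fun y hy => mem_Ioi.2 (by linarith [hy.1])
  rw [heatInt, intervalIntegral.integral_of_le (by linarith),
    ← integral_inter_add_sdiff (t := Ioc (X₀ / 2) (2 * X₀)) measurableSet_Ioc hi, hsub, add_sub_cancel_left]
  have hsd : Ioi (0 : ℝ) \ Ioc (X₀ / 2) (2 * X₀) ⊆ Ioi 0 := sdiff_subset
  have key : ‖∫ y in Ioi (0 : ℝ) \ Ioc (X₀ / 2) (2 * X₀), k X T y * α y‖ ≤
      ∫ y in Ioi (0 : ℝ) \ Ioc (X₀ / 2) (2 * X₀), C * D * T * |w y * α y| := by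
    refine norm_integral_le_of_norm_le ((IntegrableOn.mono_set hw.abs hsd).const_mul _) ?_
    filter_upwards [ae_restrict_mem (measurableSet_Ioi.diff measurableSet_Ioc)] with y hy
    have hy' : y ≤ X₀ / 2 ∨ 2 * X₀ ≤ y := by
      by_contra! hc
      exact hy.2 ⟨hc.1, hc.2.le⟩
    have e := h' X T ((X - y) ^ 2) (by linarith) (by linarith) hT hT1 (sq_le_sub_sq h1 h2 h₀ hy')
    calc ‖k X T y * α y‖ ≤ C * quadSize X T ^ m * |w y * α y| * Real.exp (-((X - y) ^ 2 / (8 * T))) :=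
          h X T y hX hT hy.1
      _ = C * (quadSize X T ^ m * Real.exp (-((X - y) ^ 2 / (8 * T)))) * |w y * α y| := by ring
      _ ≤ C * (D * T) * |w y * α y| := by gcongr
      _ = _ := by ring
  rw [Real.norm_eq_abs, integral_const_mul] at key
  refine key.trans ?_
  have := setIntegral_mono_set hw.abs (Eventually.of_forall fun y => abs_nonneg _) hsd.eventuallyLE
  calc C * D * T * ∫ y in Ioi (0 : ℝ) \ Ioc (X₀ / 2) (2 * X₀), |w y * α y|
      ≤ C * D * T * ∫ y in Ioi (0 : ℝ), |w y * α y| := by gcongr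
    _ = _ := by ring

/-- The mass √(2π) is the factor that L = (2π)^{-1/2} cancels in the initial value for I_a. -/
lemma integral_gaussian_kernel {T : ℝ} (hT : 0 < T) (X : ℝ) :
    Integrable (fun y : ℝ => (2 * T) ^ (-(1 / 2) : ℝ) * Real.exp (-((X - y) ^ 2 / (4 * T)))) ∧
    ∫ y : ℝ, (2 * T) ^ (-(1 / 2) : ℝ) * Real.exp (-((X - y) ^ 2 / (4 * T))) = √(2 * π) := by
  have e : ∀ y : ℝ, Real.exp (-((X - y) ^ 2 / (4 * T))) = Real.exp (-(1 / (4 * T)) * (y - X) ^ 2) := by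
    intro y; congr 1; field_simp; ring
  have hb : 0 < 1 / (4 * T) := by positivity
  simp_rw [e]
  constructor
  · exact ((integrable_exp_neg_mul_sq hb).comp_sub_right X).const_mul _
  · rw [integral_const_mul, integral_sub_right_eq_self (fun y => Real.exp (-(1 / (4 * T)) * y ^ 2)) X, integral_gaussian,
      Real.rpow_neg (by positivity), ← Real.sqrt_eq_rpow, ← div_eq_inv_mul, ← Real.sqrt_div' _ (by positivity)]
    congr 1; field_simp; ring

namespace BesselProfile

variable {κ L : ℝ} {g g' ρ α : ℝ → ℝ} {X₀ : ℝ}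

/-- For X and y bounded below and T small, the argument z = Xy/2T is so large that |g(z)| e^{-z} <
|L| + 1. -/
lemma abs_heatK_le_gaussian (h : BesselProfile κ L g g' ρ) (h₀ : 0 < X₀) : ∃ τ, 0 < τ ∧ τ ≤ 1 ∧ ∀ X T y : ℝ,
    X₀ / 2 ≤ X → 0 < T → T ≤ τ → X₀ / 2 ≤ y →
      |heatK g X T y| ≤ (|L| + 1) * ((2 * T) ^ (-(1 / 2) : ℝ) * Real.exp (-((X - y) ^ 2 / (4 * T)))) := by
  have h1 := h.lim.abs.eventually (gt_mem_nhds (lt_add_one _))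
  obtain ⟨Z, hZ⟩ := eventually_atTop.1 h1
  set Z' := max Z 1 with hZ'
  have hZ0 : 0 < Z' := lt_max_of_lt_right one_pos
  -- From X, y ≥ X₀/2 one gets Xy/(2T) ≥ X₀²/(8T), which is at least Z' for T ≤ X₀²/(8Z').
  refine ⟨min 1 (X₀ ^ 2 / (8 * Z')), by positivity, min_le_left _ _, fun X T y hX hT hTτ hy => ?_⟩
  have hz : Z ≤ X * y / (2 * T) := by
    refine (le_max_left Z 1).trans ?_
    rw [← hZ', le_div_iff₀ (by positivity)]
    have h2 := hTτ.trans (min_le_right _ _)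
    rw [le_div_iff₀ (by positivity)] at h2
    nlinarith [mul_le_mul hX hy (by positivity) (by linarith)]
  have h3 := (hZ _ hz).le
  rw [abs_mul, abs_of_pos (Real.exp_pos _)] at h3
  have hp : 0 < (2 * T) ^ (-(1 / 2) : ℝ) := by positivity
  rw [heatK, exp_heat_split hT, abs_mul, abs_mul, abs_of_pos hp, abs_mul, abs_of_pos (Real.exp_pos _),
    abs_of_pos (Real.exp_pos _)]
  calc _ = |g (X * y / (2 * T))| * Real.exp (-(X * y / (2 * T))) *
        ((2 * T) ^ (-(1 / 2) : ℝ) * Real.exp (-((X - y) ^ 2 / (4 * T)))) := by ring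
    _ ≤ _ := by gcongr

lemma continuousOn_heatK (h : BesselProfile κ L g g' ρ) {X T : ℝ} (hX : 0 < X) (hT : 0 < T) :
    ContinuousOn (heatK g X T) (Ioi 0) := (h.dominated_heatK 0).continuousOn hX hT

lemma continuousOn_heatKX_symm (h : BesselProfile κ L g g' ρ) {X T : ℝ} (hX : 0 < X) (hT : 0 < T) :
    ContinuousOn (fun y => heatKX g g' y T X) (Ioi 0) := by
  have : ContinuousOn (fun y : ℝ => (y, T, X)) (Ioi 0) := by fun_prop
  exact (h.dominated_heatKX 0).cont.comp this fun y hy => ⟨hy, hT, hX⟩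

lemma continuousOn_heatKT (h : BesselProfile κ L g g' ρ) {X T : ℝ} (hX : 0 < X) (hT : 0 < T) :
    ContinuousOn (heatKT g g' X T) (Ioi 0) := (h.dominated_heatKT 0).continuousOn hX hT

lemma uIcc_subset_Ioi (h₀ : 0 < X₀) : uIcc (X₀ / 2) (2 * X₀) ⊆ Ioi 0 := by
  rw [uIcc_of_le (by linarith)]
  exact fun y hy => mem_Ioi.2 (by linarith [hy.1])

/-- The local part of a heat integral is bounded for small times. -/
lemma abs_integral_heatK_le (h : BesselProfile κ L g g' ρ) (h₀ : 0 < X₀) {ψ : ℝ → ℝ} (hψ : ContinuousOn ψ (Ioi 0)) :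
    ∃ C τ, 0 ≤ C ∧ 0 < τ ∧ ∀ X T : ℝ, X₀ / 2 ≤ X → 0 < T → T ≤ τ →
      |∫ y in (X₀ / 2)..(2 * X₀), heatK g X T y * ψ y| ≤ C := by
  obtain ⟨τ, hτ, -, hb⟩ := h.abs_heatK_le_gaussian h₀
  have hle : X₀ / 2 ≤ 2 * X₀ := by linarith
  obtain ⟨M, hM⟩ := isCompact_uIcc.exists_bound_of_continuousOn (hψ.mono (uIcc_subset_Ioi h₀))
  have hM0 : 0 ≤ M := (norm_nonneg _).trans (hM _ left_mem_uIcc)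
  refine ⟨(|L| + 1) * M * √(2 * π), τ, by positivity, hτ, fun X T hX hT hTτ => ?_⟩
  obtain ⟨gi, ge⟩ := integral_gaussian_kernel hT X
  have hp : ∀ y : ℝ, 0 ≤ (2 * T) ^ (-(1 / 2) : ℝ) * Real.exp (-((X - y) ^ 2 / (4 * T))) := fun y => by positivity
  rw [← Real.norm_eq_abs, intervalIntegral.integral_of_le hle]
  calc _ ≤ ∫ y in Ioc (X₀ / 2) (2 * X₀),
        (|L| + 1) * M * ((2 * T) ^ (-(1 / 2) : ℝ) * Real.exp (-((X - y) ^ 2 / (4 * T)))) := by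
        refine norm_integral_le_of_norm_le (gi.const_mul _).integrableOn ?_
        filter_upwards [ae_restrict_mem measurableSet_Ioc] with y hy
        rw [norm_mul]
        have h1 := hb X T y hX hT hTτ hy.1.le
        have h2 := hM y (uIcc_of_le hle ▸ Ioc_subset_Icc_self hy)
        calc _ ≤ (|L| + 1) * ((2 * T) ^ (-(1 / 2) : ℝ) * Real.exp (-((X - y) ^ 2 / (4 * T)))) * M :=
              mul_le_mul h1 h2 (norm_nonneg _) (mul_nonneg (by positivity) (hp y))
          _ = _ := by ring
    _ = (|L| + 1) * M * ∫ y in Ioc (X₀ / 2) (2 * X₀), (2 * T) ^ (-(1 / 2) : ℝ) * Real.exp (-((X - y) ^ 2 / (4 * T))) :=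
        integral_const_mul _ _
    _ ≤ (|L| + 1) * M * √(2 * π) := by
        rw [← ge]
        exact mul_le_mul_of_nonneg_left (setIntegral_le_integral gi (Eventually.of_forall hp)) (by positivity)

/-- The endpoints stay at distance at least X₀/4 from X, so the Gaussian beats all powers of 1/T.
The derivative is in y here, hence by symmetry y plays the space variable and X the source. -/
lemma abs_boundary_le (h : BesselProfile κ L g g' ρ) (h₀ : 0 < X₀) : ∃ C, 0 ≤ C ∧ ∀ X T y : ℝ,
    3 * X₀ / 4 ≤ X → X ≤ 3 * X₀ / 2 → 0 < T → T ≤ 1 → (y = X₀ / 2 ∨ y = 2 * X₀) →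
      |heatK g X T y| ≤ C ∧ |heatKX g g' y T X| ≤ C := by
  obtain ⟨C, m, hC, hb⟩ := h.heat_bounds 0
  obtain ⟨D, hD, h'⟩ := quadSize_pow_mul_exp_le h₀ m
  obtain ⟨R, n, hR, hρ⟩ := h.weight_le
  refine ⟨C * D * (R * (3 * X₀ / 2 + 4 / (3 * X₀)) ^ n), by positivity, fun X T y h1 h2 hT hT1 hy => ?_⟩
  have hX : 0 < X := by linarith
  have hy1 : X₀ / 2 ≤ y ∧ y ≤ 2 * X₀ := by rcases hy with rfl | rfl <;> constructor <;> linarith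
  have hy0 : 0 < y := by linarith
  have e := h' y T ((y - X) ^ 2) hy1.1 hy1.2 hT hT1
    ((sq_le_sub_sq h1 h2 h₀ (hy.imp le_of_eq ge_of_eq)).trans_eq (by ring))
  have hρX : ρ X ≤ R * (3 * X₀ / 2 + 4 / (3 * X₀)) ^ n := by
    refine (hρ X hX).trans ?_
    refine mul_le_mul_of_nonneg_left (pow_le_pow_left₀ (by positivity) (add_le_add h2 ?_) n) hR
    rw [div_le_div_iff₀ hX (by positivity)]; linarith
  have hρ0 := h.weight_pos X hX
  have hS0 := quadSize_nonneg hy0 hT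
  have fin : C * quadSize y T ^ m * (ρ X / (1 + X) ^ 0) * Real.exp (-((y - X) ^ 2 / (8 * T))) ≤
      C * D * (R * (3 * X₀ / 2 + 4 / (3 * X₀)) ^ n) := by
    rw [pow_zero, div_one]
    calc _ = C * (quadSize y T ^ m * Real.exp (-((y - X) ^ 2 / (8 * T)))) * ρ X := by ring
      _ ≤ C * (D * 1) * (R * (3 * X₀ / 2 + 4 / (3 * X₀)) ^ n) := by
        exact mul_le_mul (mul_le_mul_of_nonneg_left (e.trans (by gcongr)) hC) hρX hρ0.le (by positivity)
      _ = _ := by ring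
  rw [heatK_symm]
  exact ⟨(hb y T X hy0 hT hX).1.trans fin, (hb y T X hy0 hT hX).2.1.trans fin⟩

/-- Integration by parts for the time derivative of the heat kernel. -/
lemma integral_heatKT (h : BesselProfile κ L g g' ρ) {α' α'' : ℝ → ℝ} (h₁ : ∀ y, 0 < y → HasDerivAt α (α' y) y)
    (h₂ : ∀ y, 0 < y → HasDerivAt α' (α'' y) y) (h₃ : ContinuousOn α'' (Ioi 0)) (h₀ : 0 < X₀) {X T : ℝ}
    (hX : 0 < X) (hT : 0 < T) :
    ∫ y in (X₀ / 2)..(2 * X₀), heatKT g g' X T y * α y =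
      (heatKX g g' (2 * X₀) T X * α (2 * X₀) - heatKX g g' (X₀ / 2) T X * α (X₀ / 2))
      - (heatK g X T (2 * X₀) * α' (2 * X₀) - heatK g X T (X₀ / 2) * α' (X₀ / 2))
      + ∫ y in (X₀ / 2)..(2 * X₀), heatK g X T y * (α'' y - κ / y ^ 2 * α y) := by
  have hs := uIcc_subset_Ioi h₀
  have cα : ContinuousOn α (Ioi 0) := fun y hy => (h₁ y hy).continuousAt.continuousWithinAt
  have cα' : ContinuousOn α' (Ioi 0) := fun y hy => (h₂ y hy).continuousAt.continuousWithinAt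
  have cκ : ContinuousOn (fun y : ℝ => κ / y ^ 2) (Ioi 0) :=
    continuousOn_const.div (by fun_prop) fun y hy => pow_ne_zero 2 (ne_of_gt hy)
  have cK := h.continuousOn_heatK hX hT
  have cT := h.continuousOn_heatKT hX hT
  have cX := h.continuousOn_heatKX_symm hX hT
  -- By symmetry K_T = K_yy - (κ/y²) K also in the source variable, so two integrations by parts
  -- move the derivatives onto α.
  have d0 : ∀ y ∈ uIcc (X₀ / 2) (2 * X₀), HasDerivAt (heatK g X T) (heatKX g g' y T X) y := by
    intro y hy
    have := hasDerivAt_heatK_comp h.solves (hasDerivAt_id y) (hasDerivAt_const y T) (hs hy) hT hX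
    simp only [id, mul_one, mul_zero, add_zero] at this
    exact this.congr_of_eventuallyEq (Eventually.of_forall fun s => heatK_symm g X T s)
  have d1 : ∀ y ∈ uIcc (X₀ / 2) (2 * X₀),
      HasDerivAt (fun y => heatKX g g' y T X) (heatKT g g' X T y + κ / y ^ 2 * heatK g X T y) y := by
    intro y hy
    rw [heatK_symm, heatKT_symm]
    exact hasDerivAt_heatKX h.solves (hs hy) hT hX
  have i1 := intervalIntegral.integral_mul_deriv_eq_deriv_mul d1 (fun y hy => h₁ y (hs hy))
    ((cT.add (cκ.mul cK)).mono hs).intervalIntegrable (cα'.mono hs).intervalIntegrable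
  have i2 := intervalIntegral.integral_mul_deriv_eq_deriv_mul d0 (fun y hy => h₂ y (hs hy))
    (cX.mono hs).intervalIntegrable (h₃.mono hs).intervalIntegrable
  have j1 : IntervalIntegrable (fun y => heatKT g g' X T y * α y) volume (X₀ / 2) (2 * X₀) :=
    ((cT.mul cα).mono hs).intervalIntegrable
  have j2 : IntervalIntegrable (fun y => heatK g X T y * (κ / y ^ 2 * α y)) volume (X₀ / 2) (2 * X₀) :=
    ((cK.mul (cκ.mul cα)).mono hs).intervalIntegrable
  have j3 : IntervalIntegrable (fun y => heatK g X T y * α'' y) volume (X₀ / 2) (2 * X₀) :=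
    ((cK.mul h₃).mono hs).intervalIntegrable
  have e1 : ∫ y in (X₀ / 2)..(2 * X₀), (heatKT g g' X T y + κ / y ^ 2 * heatK g X T y) * α y =
      (∫ y in (X₀ / 2)..(2 * X₀), heatKT g g' X T y * α y) +
        ∫ y in (X₀ / 2)..(2 * X₀), heatK g X T y * (κ / y ^ 2 * α y) := by
    rw [← intervalIntegral.integral_add j1 j2]
    congr 1; ext y; ring
  have e2 : ∫ y in (X₀ / 2)..(2 * X₀), heatK g X T y * (α'' y - κ / y ^ 2 * α y) =
      (∫ y in (X₀ / 2)..(2 * X₀), heatK g X T y * α'' y) -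
        ∫ y in (X₀ / 2)..(2 * X₀), heatK g X T y * (κ / y ^ 2 * α y) := by
    rw [← intervalIntegral.integral_sub j3 j2]
    congr 1; ext y; ring
  linarith

/-- The heat integral of a `C²` function and its derivatives stay bounded as the time tends to `0`. -/
lemma small_time_bounds (h : BesselProfile κ L g g' ρ) {N : ℕ}
    (hw : IntegrableOn (fun y => ρ y / (1 + y) ^ N * α y) (Ioi 0)) {α' α'' : ℝ → ℝ}
    (h₁ : ∀ y, 0 < y → HasDerivAt α (α' y) y) (h₂ : ∀ y, 0 < y → HasDerivAt α' (α'' y) y)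
    (h₃ : ContinuousOn α'' (Ioi 0)) (h₀ : 0 < X₀) :
    ∃ C τ, 0 ≤ C ∧ 0 < τ ∧ ∀ X T : ℝ, 3 * X₀ / 4 ≤ X → X ≤ 5 * X₀ / 4 → 0 < T → T ≤ τ →
      |heatInt (heatK g) α X T| ≤ C ∧ |heatInt (heatKX g g') α X T| ≤ C ∧ |heatInt (heatKT g g') α X T| ≤ C := by
  have cα : ContinuousOn α (Ioi 0) := fun y hy => (h₁ y hy).continuousAt.continuousWithinAt
  have cκ : ContinuousOn (fun y : ℝ => κ / y ^ 2) (Ioi 0) :=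
    continuousOn_const.div (by fun_prop) fun y hy => pow_ne_zero 2 (ne_of_gt hy)
  obtain ⟨F₁, hF₁, f₁⟩ := (h.dominated_heatK N).abs_heatInt_sub_le cα hw h₀
  obtain ⟨F₂, hF₂, f₂⟩ := (h.dominated_heatKT N).abs_heatInt_sub_le cα hw h₀
  obtain ⟨G₁, τ₁, hG₁, hτ₁, g₁⟩ := h.abs_integral_heatK_le h₀ cα
  obtain ⟨G₂, τ₂, hG₂, hτ₂, g₂⟩ := h.abs_integral_heatK_le h₀
    (ψ := fun y => α'' y - κ / y ^ 2 * α y) (h₃.sub (cκ.mul cα))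
  obtain ⟨B, hB, b⟩ := h.abs_boundary_le h₀
  set A := F₁ + G₁ with hA
  set P := F₂ + (B * |α (2 * X₀)| + B * |α (X₀ / 2)| + (B * |α' (2 * X₀)| + B * |α' (X₀ / 2)|) + G₂) with hP
  set τ := min 1 (min τ₁ τ₂) with hτ
  have hA0 : 0 ≤ A := by positivity
  have hP0 : 0 ≤ P := by positivity
  have q0 : ∀ X T : ℝ, 3 * X₀ / 4 ≤ X → X ≤ 3 * X₀ / 2 → 0 < T → T ≤ τ → |heatInt (heatK g) α X T| ≤ A := by
    intro X T h1 h2 hT hTτ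
    have hT1 : T ≤ 1 := hTτ.trans (min_le_left _ _)
    have a1 := f₁ X T h1 h2 hT hT1
    have a2 := g₁ X T (by linarith) hT (hTτ.trans ((min_le_right _ _).trans (min_le_left _ _)))
    rw [abs_le] at a1 a2 ⊢
    constructor <;> nlinarith
  have qT : ∀ X T : ℝ, 3 * X₀ / 4 ≤ X → X ≤ 3 * X₀ / 2 → 0 < T → T ≤ τ → |heatInt (heatKT g g') α X T| ≤ P := by
    intro X T h1 h2 hT hTτ
    have hT1 : T ≤ 1 := hTτ.trans (min_le_left _ _)
    have a1 := f₂ X T h1 h2 hT hT1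
    have a2 := g₂ X T (by linarith) hT (hTτ.trans ((min_le_right _ _).trans (min_le_right _ _)))
    have hbd := h.integral_heatKT h₁ h₂ h₃ h₀ (by linarith : 0 < X) hT
    have b1 := b X T (X₀ / 2) h1 h2 hT hT1 (Or.inl rfl)
    have b2 := b X T (2 * X₀) h1 h2 hT hT1 (Or.inr rfl)
    have c1 : |heatKX g g' (2 * X₀) T X * α (2 * X₀)| ≤ B * |α (2 * X₀)| := by
      rw [abs_mul]; gcongr; exact b2.2
    have c2 : |heatKX g g' (X₀ / 2) T X * α (X₀ / 2)| ≤ B * |α (X₀ / 2)| := by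
      rw [abs_mul]; gcongr; exact b1.2
    have c3 : |heatK g X T (2 * X₀) * α' (2 * X₀)| ≤ B * |α' (2 * X₀)| := by
      rw [abs_mul]; gcongr; exact b2.1
    have c4 : |heatK g X T (X₀ / 2) * α' (X₀ / 2)| ≤ B * |α' (X₀ / 2)| := by
      rw [abs_mul]; gcongr; exact b1.1
    have hFT : F₂ * T ≤ F₂ := mul_le_of_le_one_right hF₂ hT1
    rw [hbd] at a1
    rw [abs_le] at a1 a2 c1 c2 c3 c4 ⊢
    constructor <;> linarith [a1.1, a1.2, a2.1, a2.2, c1.1, c1.2, c2.1, c2.2, c3.1, c3.2, c4.1, c4.2]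
  -- The X-derivative is interpolated: the heat equation bounds the second X-derivative by E, and
  -- for X ≤ 5X₀/4 a step X₀/4 stays below 3X₀/2, where the other two bounds hold.
  set E := P + |κ| / (3 * X₀ / 4) ^ 2 * A with hE
  have hE0 : 0 ≤ E := by positivity
  set Q := 2 * A / (X₀ / 4) + E * (X₀ / 4) with hQ
  have hQ0 : 0 ≤ Q := by positivity
  refine ⟨A + P + Q, τ, by positivity, by positivity, fun X T h1 h2 hT hTτ => ⟨?_, ?_, ?_⟩⟩
  · linarith [q0 X T h1 (by linarith) hT hTτ]
  · have hX : 0 < X := by linarith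
    have key := abs_deriv_le_of_abs_le (f := fun ξ => heatInt (heatK g) α ξ T) (f' := fun ξ => heatInt (heatKX g g') α ξ T)
      (f'' := fun ξ => heatInt (heatKT g g') α ξ T + κ / ξ ^ 2 * heatInt (heatK g) α ξ T) (x := X) (h := X₀ / 4)
      (A := A) (B := E) (by linarith) ?_ ?_ ?_ ?_
    · linarith
    · intro ξ hξ
      have := h.hasDerivAt_heatInt cα hw (X := id) (T := fun _ => T) (X' := fun _ => 1) (T' := fun _ => 0) (t := ξ)
        (fun s => hasDerivAt_id s) (fun s => hasDerivAt_const s T) continuous_const continuous_const (hX.trans_le hξ.1) hT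
      simpa using this
    · intro ξ hξ
      exact h.hasDerivAt_heatInt_heatKX cα hw (hX.trans_le hξ.1) hT
    · intro ξ hξ
      exact q0 ξ T (h1.trans hξ.1) (by linarith [hξ.2]) hT hTτ
    · intro ξ hξ
      have hξ0 : 0 < ξ := hX.trans_le hξ.1
      refine (abs_add_le _ _).trans (add_le_add (qT ξ T (h1.trans hξ.1) (by linarith [hξ.2]) hT hTτ) ?_)
      rw [abs_mul, abs_div, abs_of_pos (by positivity : 0 < ξ ^ 2)]
      have := q0 ξ T (h1.trans hξ.1) (by linarith [hξ.2]) hT hTτ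
      have h3 := h1.trans hξ.1
      gcongr
  · linarith [qT X T h1 (by linarith) hT hTτ]

end BesselProfile

/-! ### The initial value of a heat integral -/

lemma sqrt_mul_rpow_neg_half {T : ℝ} (hT : 0 < T) : √T * (2 * T) ^ (-(1 / 2) : ℝ) = (2 : ℝ) ^ (-(1 / 2) : ℝ) := by
  rw [Real.mul_rpow (by norm_num) hT.le, Real.sqrt_eq_rpow, mul_left_comm, ← Real.rpow_add hT]
  norm_num

/-- Laplace's method with y = X + √T η. The far part is O(T); near X₀, √T times the kernel tends to
2^{-1/2} L e^{-η²/4} under a Gaussian majorant in η. The point X is allowed to move because r e^{bt}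
does. -/
lemma BesselProfile.tendsto_heatInt {κ L : ℝ} {g g' ρ α : ℝ → ℝ} {X₀ : ℝ} (h : BesselProfile κ L g g' ρ) {N : ℕ}
    (hα : ContinuousOn α (Ioi 0)) (hw : IntegrableOn (fun y => ρ y / (1 + y) ^ N * α y) (Ioi 0)) (h₀ : 0 < X₀)
    {ι : Type*} {l : Filter ι} [l.IsCountablyGenerated] {X T : ι → ℝ} (hX : Tendsto X l (𝓝 X₀))
    (hT : Tendsto T l (𝓝[>] 0)) :
    Tendsto (fun i => heatInt (heatK g) α (X i) (T i)) l (𝓝 (√(2 * π) * L * α X₀)) := by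
  obtain ⟨F, hF, f⟩ := (h.dominated_heatK N).abs_heatInt_sub_le hα hw h₀
  obtain ⟨τ, hτ, hτ1, hb⟩ := h.abs_heatK_le_gaussian h₀
  have hT0 : Tendsto T l (𝓝 0) := hT.mono_right nhdsWithin_le_nhds
  have hTpos : ∀ᶠ i in l, 0 < T i := hT.eventually self_mem_nhdsWithin
  have hTτ : ∀ᶠ i in l, T i ≤ τ := hT0.eventually (ge_mem_nhds hτ)
  have hX1 : ∀ᶠ i in l, 3 * X₀ / 4 ≤ X i := hX.eventually (le_mem_nhds (by linarith))
  have hX2 : ∀ᶠ i in l, X i ≤ 3 * X₀ / 2 := hX.eventually (ge_mem_nhds (by linarith))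
  have far : Tendsto (fun i => heatInt (heatK g) α (X i) (T i) -
      ∫ y in (X₀ / 2)..(2 * X₀), heatK g (X i) (T i) y * α y) l (𝓝 0) := by
    refine squeeze_zero_norm' (a := fun i => F * T i) ?_ (by simpa using hT0.const_mul F)
    filter_upwards [hTpos, hTτ, hX1, hX2] with i h1 h2 h3 h4 using f _ _ h3 h4 h1 (h2.trans hτ1)
  have hle : X₀ / 2 ≤ 2 * X₀ := by linarith
  obtain ⟨M, hM⟩ := isCompact_uIcc.exists_bound_of_continuousOn (hα.mono (uIcc_subset_Ioi h₀))
  have hM0 : 0 ≤ M := (norm_nonneg _).trans (hM _ left_mem_uIcc)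
  set H : ι → ℝ → ℝ := fun i => (Ioc (X₀ / 2) (2 * X₀)).indicator fun y => heatK g (X i) (T i) y * α y
  have hH : ∀ i y, y ∈ Ioc (X₀ / 2) (2 * X₀) → H i y = heatK g (X i) (T i) y * α y := fun i y hy =>
    indicator_of_mem hy _
  have hH' : ∀ i y, y ∉ Ioc (X₀ / 2) (2 * X₀) → H i y = 0 := fun i y hy => indicator_of_notMem hy _
  have cov : ∀ᶠ i in l, ∫ y in (X₀ / 2)..(2 * X₀), heatK g (X i) (T i) y * α y =
      ∫ η : ℝ, √(T i) * H i (X i + √(T i) * η) := by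
    filter_upwards [hTpos] with i h1
    have hs : 0 < √(T i) := Real.sqrt_pos.2 h1
    rw [intervalIntegral.integral_of_le hle, ← integral_indicator measurableSet_Ioc, integral_const_mul,
      Measure.integral_comp_mul_left (fun η => H i (X i + η)) (√(T i)), integral_add_left_eq_self (H i) (X i),
      abs_of_pos (inv_pos.2 hs), smul_eq_mul, mul_inv_cancel_left₀ hs.ne']
  have lim : Tendsto (fun i => ∫ η : ℝ, √(T i) * H i (X i + √(T i) * η)) l
      (𝓝 (∫ η : ℝ, (2 : ℝ) ^ (-(1 / 2) : ℝ) * L * α X₀ * Real.exp (-(1 / 4) * η ^ 2))) := by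
    refine tendsto_integral_filter_of_dominated_convergence
      (fun η => (2 : ℝ) ^ (-(1 / 2) : ℝ) * (|L| + 1) * M * Real.exp (-(1 / 4) * η ^ 2)) ?_ ?_
      ((integrable_exp_neg_mul_sq (by norm_num)).const_mul _) ?_
    · filter_upwards [hTpos, hX1] with i h1 h2
      have hs : 0 < √(T i) := Real.sqrt_pos.2 h1
      have hc : ContinuousOn (fun y => heatK g (X i) (T i) y * α y) (Ioc (X₀ / 2) (2 * X₀)) :=
        ((h.continuousOn_heatK (by linarith) h1).mul hα).mono fun y hy => mem_Ioi.2 (by linarith [hy.1])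
      have hm : Measurable (H i) := by
        classical
        have := hc.measurable_piecewise (g := 0) continuous_zero.continuousOn measurableSet_Ioc
        rwa [piecewise_eq_indicator] at this
      exact ((hm.comp (by fun_prop)).const_mul _).aestronglyMeasurable
    · filter_upwards [hTpos, hTτ, hX1] with i h1 h2 h3
      refine Eventually.of_forall fun η => ?_
      have hs : 0 < √(T i) := Real.sqrt_pos.2 h1
      by_cases hy : X i + √(T i) * η ∈ Ioc (X₀ / 2) (2 * X₀)
      · rw [hH i _ hy, norm_mul, norm_mul, Real.norm_eq_abs, abs_of_pos hs]
        have e1 := hb (X i) (T i) _ (by linarith) h1 h2 hy.1.le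
        have e2 := hM _ (uIcc_of_le hle ▸ Ioc_subset_Icc_self hy)
        have e3 : (X i - (X i + √(T i) * η)) ^ 2 / (4 * T i) = 1 / 4 * η ^ 2 := by
          rw [sub_add_cancel_left, neg_sq, mul_pow, Real.sq_sqrt h1.le]; field_simp
        rw [e3] at e1
        rw [← sqrt_mul_rpow_neg_half h1]
        calc _ ≤ √(T i) * ((|L| + 1) * ((2 * T i) ^ (-(1 / 2) : ℝ) * Real.exp (-(1 / 4 * η ^ 2))) * M) := by
              refine mul_le_mul_of_nonneg_left (mul_le_mul e1 e2 (norm_nonneg _) (by positivity)) hs.le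
          _ = _ := by rw [neg_mul]; ring
      · rw [hH' i _ hy, mul_zero, norm_zero]
        positivity
    · refine Eventually.of_forall fun η => ?_
      have hy : Tendsto (fun i => X i + √(T i) * η) l (𝓝 X₀) := by
        have := hX.add ((hT0.sqrt).mul_const η)
        simpa using this
      have hmem : ∀ᶠ i in l, X i + √(T i) * η ∈ Ioc (X₀ / 2) (2 * X₀) :=
        hy.eventually (Ioc_mem_nhds (by linarith) (by linarith))
      have hz : Tendsto (fun i => X i * (X i + √(T i) * η) / (2 * T i)) l atTop := by
        have h2T : Tendsto (fun i => (T i)⁻¹) l atTop := tendsto_inv_nhdsGT_zero.comp hT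
        have := h2T.atTop_mul_pos (by positivity : 0 < X₀ * X₀ / 2) ((hX.mul hy).div_const 2)
        refine this.congr fun i => ?_
        rw [div_mul_eq_div_div, ← div_eq_inv_mul]
      have l1 := (h.lim.comp hz).mul ((hα.continuousAt (Ioi_mem_nhds h₀)).tendsto.comp hy)
      have l2 := (l1.const_mul ((2 : ℝ) ^ (-(1 / 2) : ℝ))).mul_const (Real.exp (-(1 / 4) * η ^ 2))
      rw [← mul_assoc] at l2
      refine l2.congr' ?_
      filter_upwards [hTpos, hmem] with i h1 h2
      have e3 : (X i - (X i + √(T i) * η)) ^ 2 / (4 * T i) = 1 / 4 * η ^ 2 := by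
        rw [sub_add_cancel_left, neg_sq, mul_pow, Real.sq_sqrt h1.le]; field_simp
      rw [hH i _ h2, heatK, exp_heat_split h1, e3, ← sqrt_mul_rpow_neg_half h1, neg_mul]
      simp only [Function.comp]
      ring
  have e : ∫ η : ℝ, (2 : ℝ) ^ (-(1 / 2) : ℝ) * L * α X₀ * Real.exp (-(1 / 4) * η ^ 2) = √(2 * π) * L * α X₀ := by
    rw [integral_const_mul, integral_gaussian, Real.rpow_neg (by norm_num), ← Real.sqrt_eq_rpow]
    have : √(π / (1 / 4)) = √(2 * π) * √2 := by
      rw [← Real.sqrt_mul (by positivity)]; congr 1; ring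
    rw [this]
    have h2 : √(2 : ℝ) ≠ 0 := by positivity
    field_simp
  rw [e] at lim
  have := far.add (lim.congr' (cov.mono fun i hi => hi.symm))
  simpa using this

/-! ### Functions of exponential growth in time, locally uniformly in space -/

/-- `F(r, t)` grows at most exponentially in `t > 0`, uniformly for `r` near `r₀`. -/
def LocExpBdd (r₀ : ℝ) (F : ℝ → ℝ → ℝ) : Prop :=
  ∃ C l : ℝ, 0 ≤ C ∧ 0 ≤ l ∧ ∀ᶠ r in 𝓝 r₀, ∀ t, 0 < t → |F r t| ≤ C * Real.exp (l * t)

namespace LocExpBdd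

variable {r₀ : ℝ} {F G : ℝ → ℝ → ℝ}

lemma add (hF : LocExpBdd r₀ F) (hG : LocExpBdd r₀ G) : LocExpBdd r₀ (fun r t => F r t + G r t) := by
  obtain ⟨C, l, hC, hl, hF⟩ := hF
  obtain ⟨D, m, hD, hm, hG⟩ := hG
  refine ⟨C + D, l + m, by positivity, by positivity, ?_⟩
  filter_upwards [hF, hG] with r h1 h2 t ht
  calc _ ≤ |F r t| + |G r t| := abs_add_le _ _
    _ ≤ C * Real.exp (l * t) + D * Real.exp (m * t) := add_le_add (h1 t ht) (h2 t ht)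
    _ ≤ C * Real.exp ((l + m) * t) + D * Real.exp ((l + m) * t) := by gcongr <;> linarith
    _ = _ := by ring

lemma mul (hF : LocExpBdd r₀ F) (hG : LocExpBdd r₀ G) : LocExpBdd r₀ (fun r t => F r t * G r t) := by
  obtain ⟨C, l, hC, hl, hF⟩ := hF
  obtain ⟨D, m, hD, hm, hG⟩ := hG
  refine ⟨C * D, l + m, by positivity, by positivity, ?_⟩
  filter_upwards [hF, hG] with r h1 h2 t ht
  rw [abs_mul]
  calc _ ≤ C * Real.exp (l * t) * (D * Real.exp (m * t)) :=
        mul_le_mul (h1 t ht) (h2 t ht) (abs_nonneg _) (by positivity)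
    _ = _ := by rw [add_mul, Real.exp_add]; ring

lemma of_continuousAt {φ : ℝ → ℝ} (h : ContinuousAt φ r₀) : LocExpBdd r₀ (fun r _ => φ r) := by
  refine ⟨|φ r₀| + 1, 0, by positivity, le_rfl, ?_⟩
  filter_upwards [h.abs.eventually (gt_mem_nhds (lt_add_one _))] with r hr t ht
  simpa using hr.le

lemma exp_mul (c : ℝ) : LocExpBdd r₀ (fun _ t => Real.exp (c * t)) := by
  refine ⟨1, |c|, one_pos.le, abs_nonneg _, Eventually.of_forall fun r t ht => ?_⟩
  rw [abs_of_pos (Real.exp_pos _), one_mul, Real.exp_le_exp]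
  exact mul_le_mul_of_nonneg_right (le_abs_self _) ht.le

lemma congr (hF : LocExpBdd r₀ F) (h : ∀ᶠ r in 𝓝 r₀, ∀ t, 0 < t → G r t = F r t) : LocExpBdd r₀ G := by
  obtain ⟨C, l, hC, hl, hF⟩ := hF
  refine ⟨C, l, hC, hl, ?_⟩
  filter_upwards [hF, h] with r h1 h2 t ht
  rw [h2 t ht]; exact h1 t ht

end LocExpBdd

/-- A classical solution on `s` of `w_t = w_xx + V w` for `t > 0`, with its space derivatives, which
grows at most exponentially in time and is bounded down to `t = 0`. -/
structure ParabolicSolution (s : Set ℝ) (V : ℝ → ℝ) (w wx wxx : ℝ → ℝ → ℝ) : Prop where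
  deriv_fst : ∀ x ∈ s, ∀ t, 0 < t → HasDerivAt (fun ξ => w ξ t) (wx x t) x
  deriv_snd : ∀ x ∈ s, ∀ t, 0 < t → HasDerivAt (fun ξ => wx ξ t) (wxx x t) x
  deriv_time : ∀ x ∈ s, ∀ t, 0 < t → HasDerivAt (fun τ => w x τ) (wxx x t + V x * w x t) t
  cont_space : ∀ x ∈ s, ∀ t, 0 < t → ContinuousAt (fun ξ => wxx ξ t) x
  cont_time_fst : ∀ x ∈ s, ContinuousOn (fun τ => wx x τ) (Ioi 0)
  cont_time_snd : ∀ x ∈ s, ContinuousOn (fun τ => wxx x τ) (Ioi 0)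
  bound : ∀ x ∈ s, LocExpBdd x w
  bound_fst : ∀ x ∈ s, LocExpBdd x wx
  bound_snd : ∀ x ∈ s, LocExpBdd x wxx

namespace ParabolicSolution

variable {s : Set ℝ} {V : ℝ → ℝ} {w wx wxx z zx zxx : ℝ → ℝ → ℝ}

lemma add (h : ParabolicSolution s V w wx wxx) (h' : ParabolicSolution s V z zx zxx) :
    ParabolicSolution s V (fun x t => w x t + z x t) (fun x t => wx x t + zx x t) (fun x t => wxx x t + zxx x t) where
  deriv_fst x hx t ht := (h.deriv_fst x hx t ht).add (h'.deriv_fst x hx t ht)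
  deriv_snd x hx t ht := (h.deriv_snd x hx t ht).add (h'.deriv_snd x hx t ht)
  deriv_time x hx t ht := ((h.deriv_time x hx t ht).add (h'.deriv_time x hx t ht)).congr_deriv (by ring)
  cont_space x hx t ht := (h.cont_space x hx t ht).add (h'.cont_space x hx t ht)
  cont_time_fst x hx := (h.cont_time_fst x hx).add (h'.cont_time_fst x hx)
  cont_time_snd x hx := (h.cont_time_snd x hx).add (h'.cont_time_snd x hx)
  bound x hx := (h.bound x hx).add (h'.bound x hx)
  bound_fst x hx := (h.bound_fst x hx).add (h'.bound_fst x hx)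
  bound_snd x hx := (h.bound_snd x hx).add (h'.bound_snd x hx)

lemma congr (h : ParabolicSolution s V w wx wxx) (hs : IsOpen s) (e : ∀ x ∈ s, ∀ t, 0 < t → z x t = w x t) :
    ParabolicSolution s V z wx wxx where
  deriv_fst x hx t ht := (h.deriv_fst x hx t ht).congr_of_eventuallyEq <| by
    filter_upwards [hs.mem_nhds hx] with ξ hξ using e ξ hξ t ht
  deriv_snd := h.deriv_snd
  deriv_time x hx t ht := by
    rw [e x hx t ht]
    refine (h.deriv_time x hx t ht).congr_of_eventuallyEq ?_
    filter_upwards [Ioi_mem_nhds ht] with τ hτ using e x hx τ hτ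
  cont_space := h.cont_space
  cont_time_fst := h.cont_time_fst
  cont_time_snd := h.cont_time_snd
  bound x hx := (h.bound x hx).congr (by filter_upwards [hs.mem_nhds hx] with ξ hξ using e ξ hξ)
  bound_fst := h.bound_fst
  bound_snd := h.bound_snd

end ParabolicSolution

lemma LocExpBdd.comp_neg {F : ℝ → ℝ → ℝ} {x : ℝ} (h : LocExpBdd (-x) F) : LocExpBdd x (fun r t => F (-r) t) := by
  obtain ⟨C, l, hC, hl, hF⟩ := h
  exact ⟨C, l, hC, hl, (continuous_neg.tendsto x).eventually hF⟩

/-- Evenness of V transports solutions from the positive to the negative half-line. -/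
lemma ParabolicSolution.comp_neg {V : ℝ → ℝ} {w wx wxx : ℝ → ℝ → ℝ} (h : ParabolicSolution (Ioi 0) V w wx wxx)
    (hV : ∀ x, V (-x) = V x) :
    ParabolicSolution (Iio 0) V (fun x t => w (-x) t) (fun x t => -wx (-x) t) (fun x t => wxx (-x) t) := by
  have hs : ∀ x : ℝ, x ∈ Iio 0 → -x ∈ Ioi 0 := fun x hx => neg_pos.2 (mem_Iio.1 hx)
  have dneg : ∀ x : ℝ, HasDerivAt (fun ξ : ℝ => -ξ) (-1) x := fun x => hasDerivAt_neg x
  refine ⟨fun x hx t ht => ?_, fun x hx t ht => ?_, fun x hx t ht => ?_, fun x hx t ht => ?_, fun x hx => ?_,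
    fun x hx => ?_, fun x hx => ?_, fun x hx => ?_, fun x hx => ?_⟩
  · have : HasDerivAt (fun ξ => w (-ξ) t) _ x := HasDerivAt.comp x (h.deriv_fst _ (hs x hx) t ht) (dneg x)
    simpa using this
  · have : HasDerivAt (fun ξ => wx (-ξ) t) _ x := HasDerivAt.comp x (h.deriv_snd _ (hs x hx) t ht) (dneg x)
    simpa using this.fun_neg
  · have := h.deriv_time _ (hs x hx) t ht
    rwa [hV] at this
  · exact ContinuousAt.comp (f := fun ξ : ℝ => -ξ) (h.cont_space _ (hs x hx) t ht) continuous_neg.continuousAt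
  · exact (h.cont_time_fst _ (hs x hx)).neg
  · exact h.cont_time_snd _ (hs x hx)
  · exact (h.bound _ (hs x hx)).comp_neg
  · refine ((LocExpBdd.of_continuousAt (φ := fun _ => (-1 : ℝ)) continuousAt_const).mul
      (h.bound_fst _ (hs x hx)).comp_neg).congr (Eventually.of_forall fun r t _ => by ring)
  · exact (h.bound_snd _ (hs x hx)).comp_neg

/-! ### The time change -/

/-- The time change `(e^{2bt} - 1) / (2b)`. -/
def timeChange (b t : ℝ) : ℝ := (Real.exp (2 * b * t) - 1) / (2 * b)

section TimeChange

variable {b t : ℝ}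

lemma hasDerivAt_timeChange (hb : b ≠ 0) (t : ℝ) : HasDerivAt (timeChange b) (Real.exp (2 * b * t)) t := by
  have := (((hasDerivAt_id' t).const_mul (2 * b)).exp.sub_const 1).div_const (2 * b)
  refine this.congr_deriv ?_
  field_simp

lemma strictMono_timeChange (hb : b ≠ 0) : StrictMono (timeChange b) :=
  strictMono_of_deriv_pos fun t => by rw [(hasDerivAt_timeChange hb t).deriv]; exact Real.exp_pos _

lemma timeChange_zero : timeChange b 0 = 0 := by simp [timeChange]

lemma timeChange_pos (hb : b ≠ 0) (ht : 0 < t) : 0 < timeChange b t := by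
  rw [← timeChange_zero (b := b)]; exact strictMono_timeChange hb ht

lemma tendsto_timeChange (hb : b ≠ 0) : Tendsto (timeChange b) (𝓝[>] 0) (𝓝[>] 0) := by
  refine tendsto_nhdsWithin_iff.2 ⟨?_, eventually_mem_nhdsWithin.mono fun t ht => timeChange_pos hb ht⟩
  have := (hasDerivAt_timeChange hb 0).continuousAt.tendsto
  rw [timeChange_zero] at this
  exact this.mono_left nhdsWithin_le_nhds

lemma timeChange_le (hb : b ≠ 0) (ht : 0 < t) : timeChange b t ≤ Real.exp (2 * |b| * t) / (2 * |b|) := by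
  rcases hb.lt_or_gt with h | h
  · rw [abs_of_neg h, timeChange, ← neg_div_neg_eq, ← mul_neg]
    have h1 : 0 < -b := neg_pos.2 h
    have h2 : 1 ≤ Real.exp (2 * -b * t) := Real.one_le_exp (by positivity)
    gcongr
    linarith [Real.exp_pos (2 * b * t)]
  · rw [abs_of_pos h, timeChange]
    gcongr
    linarith

/-- Functions with polynomial growth on the quadrant which are bounded for small times grow at most
exponentially along the curves of the time change. -/
lemma locExpBdd_curve (hb : b ≠ 0) {Q : ℝ → ℝ → ℝ} {r₀ : ℝ} (h₀ : 0 < r₀)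
    (h₁ : ∃ C τ, 0 ≤ C ∧ 0 < τ ∧ ∀ X T : ℝ, 3 * r₀ / 4 ≤ X → X ≤ 5 * r₀ / 4 → 0 < T → T ≤ τ → |Q X T| ≤ C)
    (h₂ : ∃ (C : ℝ) (m : ℕ), 0 ≤ C ∧ ∀ X T : ℝ, 0 < X → 0 < T → |Q X T| ≤ C * quadSize X T ^ m) :
    LocExpBdd r₀ (fun r t => Q (r * Real.exp (b * t)) (timeChange b t)) := by
  obtain ⟨C, τ, hC, hτ, h₁⟩ := h₁
  obtain ⟨D, m, hD, h₂⟩ := h₂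
  have c1 : Tendsto (fun t => Real.exp (b * t)) (𝓝 0) (𝓝 1) := by
    have : Continuous fun t => Real.exp (b * t) := by fun_prop
    simpa using this.tendsto 0
  have c2 : Tendsto (timeChange b) (𝓝 0) (𝓝 0) := by
    have := (hasDerivAt_timeChange hb 0).continuousAt.tendsto
    rwa [timeChange_zero] at this
  -- For r between 7r₀/8 and 9r₀/8 the factors 6/7 and 10/9 keep r e^{bt} between 3r₀/4 and 5r₀/4.
  have ev := ((c1.eventually (le_mem_nhds (by norm_num : (6 / 7 : ℝ) < 1))).and
    (c1.eventually (ge_mem_nhds (by norm_num : (1 : ℝ) < 10 / 9)))).and (c2.eventually (ge_mem_nhds hτ))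
  obtain ⟨ε, hε, hev⟩ := Metric.eventually_nhds_iff.1 ev
  have hTε := timeChange_pos hb (half_pos hε)
  have hb0 : 0 < |b| := abs_pos.2 hb
  -- Once t ≥ ε, each of the four summands of `quadSize` is at most a constant times e^{2|b|t}, and
  -- K is the sum of these constants.
  set K := 9 * r₀ / 8 + 8 / (7 * r₀) + (1 / (2 * |b|) + 1 / timeChange b (ε / 2)) with hK
  have hK0 : 0 < K := by positivity
  refine ⟨C + D * K ^ m, m * (2 * |b|), by positivity, by positivity, ?_⟩
  filter_upwards [le_mem_nhds (by linarith : 7 * r₀ / 8 < r₀), ge_mem_nhds (by linarith : r₀ < 9 * r₀ / 8)]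
    with r hr1 hr2 t ht
  have hr : 0 < r := by linarith
  have hT := timeChange_pos hb ht
  have hX : 0 < r * Real.exp (b * t) := by positivity
  have he1 : 1 ≤ Real.exp (m * (2 * |b|) * t) := Real.one_le_exp (by positivity)
  rcases lt_or_ge t ε with hlt | hge
  · obtain ⟨⟨e1, e2⟩, e3⟩ := hev (y := t) (by rwa [Real.dist_eq, sub_zero, abs_of_pos ht])
    have f1 : 3 * r₀ / 4 ≤ r * Real.exp (b * t) := by nlinarith
    have f2 : r * Real.exp (b * t) ≤ 5 * r₀ / 4 := by nlinarith
    calc _ ≤ C := h₁ _ _ f1 f2 hT e3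
      _ ≤ (C + D * K ^ m) * 1 := by rw [mul_one]; exact le_add_of_nonneg_right (by positivity)
      _ ≤ _ := by gcongr
  · have habs : b * t ≤ 2 * |b| * t := by
      have := le_abs_self b
      nlinarith
    have habs' : -(b * t) ≤ 2 * |b| * t := by
      have := neg_abs_le b
      nlinarith
    have hS : quadSize (r * Real.exp (b * t)) (timeChange b t) ≤ K * Real.exp (2 * |b| * t) := by
      have g1 : r * Real.exp (b * t) ≤ 9 * r₀ / 8 * Real.exp (2 * |b| * t) := by gcongr
      have g2 : 1 / (r * Real.exp (b * t)) ≤ 8 / (7 * r₀) * Real.exp (2 * |b| * t) := by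
        rw [one_div, mul_inv, ← Real.exp_neg]
        have : r⁻¹ ≤ 8 / (7 * r₀) := by
          rw [inv_le_comm₀ hr (by positivity), inv_div]; linarith
        gcongr
      have g3 : timeChange b t ≤ 1 / (2 * |b|) * Real.exp (2 * |b| * t) :=
        (timeChange_le hb ht).trans_eq (by ring)
      have g4 : 1 / timeChange b t ≤ 1 / timeChange b (ε / 2) * Real.exp (2 * |b| * t) := by
        have g5 : 1 / timeChange b t ≤ 1 / timeChange b (ε / 2) := by
          gcongr
          exact (strictMono_timeChange hb).monotone (by linarith)
        exact g5.trans (le_mul_of_one_le_right (by positivity) (Real.one_le_exp (by positivity)))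
      rw [quadSize, hK]
      linarith
    have hS0 := quadSize_nonneg hX hT
    calc _ ≤ D * quadSize (r * Real.exp (b * t)) (timeChange b t) ^ m := h₂ _ _ hX hT
      _ ≤ D * (K * Real.exp (2 * |b| * t)) ^ m := by gcongr
      _ = D * K ^ m * Real.exp (m * (2 * |b|) * t) := by
        rw [mul_pow, ← Real.exp_nat_mul]; ring_nf
      _ ≤ _ := by gcongr; linarith

end TimeChange

/-! ### The Bessel heat kernel in self-similar variables -/

/-- The solution of `w_t = w_rr + (γ/4 - b²r²/4 - κ/r²) w` obtained from a heat integral. -/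
def selfSimilar (b γ : ℝ) (Q : ℝ → ℝ → ℝ) (r t : ℝ) : ℝ :=
  Real.exp (b * r ^ 2 / 4 + (γ + 2 * b) * t / 4) * Q (r * Real.exp (b * t)) (timeChange b t)

section SelfSimilar

variable {κ L b γ : ℝ} {g g' ρ α α' α'' : ℝ → ℝ}

lemma locExpBdd_factor (r₀ : ℝ) : LocExpBdd r₀ (fun r t => Real.exp (b * r ^ 2 / 4 + (γ + 2 * b) * t / 4)) := by
  have h1 : ContinuousAt (fun r : ℝ => Real.exp (b * r ^ 2 / 4)) r₀ := by fun_prop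
  refine ((LocExpBdd.of_continuousAt h1).mul (LocExpBdd.exp_mul ((γ + 2 * b) / 4))).congr
    (Eventually.of_forall fun r t _ => ?_)
  rw [← Real.exp_add]; ring_nf

/-- The time derivative along X = r e^{bt}, T' = e^{2bt} produces b X Q_X + e^{2bt} Q_T. The gauge
e^{br²/4} reproduces the term b X Q_X in w_rr and adds b/2 + b²r²/4; the factor e^{(γ+2b)t/4}
cancels the b/2 and supplies γ/4. -/
lemma BesselProfile.parabolicSolution (h : BesselProfile κ L g g' ρ) (hb : b ≠ 0) {N : ℕ}
    (hw : IntegrableOn (fun y => ρ y / (1 + y) ^ N * α y) (Ioi 0))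
    (h₁ : ∀ y, 0 < y → HasDerivAt α (α' y) y) (h₂ : ∀ y, 0 < y → HasDerivAt α' (α'' y) y)
    (h₃ : ContinuousOn α'' (Ioi 0)) :
    ∃ wx wxx, ParabolicSolution (Ioi 0) (fun r => γ / 4 - b ^ 2 * r ^ 2 / 4 - κ / r ^ 2)
      (selfSimilar b γ (heatInt (heatK g) α)) wx wxx := by
  have cα : ContinuousOn α (Ioi 0) := fun y hy => (h₁ y hy).continuousAt.continuousWithinAt
  set Q := heatInt (heatK g) α with hQ
  set QX := heatInt (heatKX g g') α with hQX
  set QT := heatInt (heatKT g g') α with hQT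
  set E : ℝ → ℝ → ℝ := fun r t => Real.exp (b * r ^ 2 / 4 + (γ + 2 * b) * t / 4) with hE
  set X : ℝ → ℝ → ℝ := fun r t => r * Real.exp (b * t) with hX
  have X0 : ∀ r : ℝ, 0 < r → ∀ t, 0 < X r t := fun r hr t => by positivity
  have T0 : ∀ t, 0 < t → 0 < timeChange b t := fun t ht => timeChange_pos hb ht
  have dE : ∀ r t, HasDerivAt (fun r => E r t) (b * r / 2 * E r t) r := by
    intro r t
    have := ((((hasDerivAt_pow 2 r).const_mul b).div_const 4).add_const ((γ + 2 * b) * t / 4)).exp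
    refine this.congr_deriv ?_
    simp only [hE]; push_cast; ring
  have dEt : ∀ r t, HasDerivAt (fun t => E r t) ((γ + 2 * b) / 4 * E r t) t := by
    intro r t
    have := ((((hasDerivAt_id' t).const_mul (γ + 2 * b)).div_const 4).const_add (b * r ^ 2 / 4)).exp
    refine this.congr_deriv ?_
    simp only [hE]; ring
  have dXr : ∀ r t, HasDerivAt (fun r => X r t) (Real.exp (b * t)) r := fun r t => by
    simpa using (hasDerivAt_id' r).mul_const (Real.exp (b * t))
  have dXt : ∀ r t, HasDerivAt (fun t => X r t) (b * X r t) t := by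
    intro r t
    refine ((((hasDerivAt_id' t).const_mul b).exp).const_mul r).congr_deriv ?_
    simp only [hX]; ring
  have dQr : ∀ r t, 0 < r → 0 < t → HasDerivAt (fun r => Q (X r t) (timeChange b t))
      (QX (X r t) (timeChange b t) * Real.exp (b * t)) r := by
    intro r t hr ht
    have := h.hasDerivAt_heatInt cα hw (X := fun r => X r t) (T := fun _ => timeChange b t)
      (X' := fun _ => Real.exp (b * t)) (T' := fun _ => 0) (t := r) (fun s => dXr s t) (fun s => hasDerivAt_const s _)
      continuous_const continuous_const (X0 r hr t) (T0 t ht)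
    simpa using this
  have dQt : ∀ r t, 0 < r → 0 < t → HasDerivAt (fun t => Q (X r t) (timeChange b t))
      (QX (X r t) (timeChange b t) * (b * X r t) + QT (X r t) (timeChange b t) * Real.exp (2 * b * t)) t := by
    intro r t hr ht
    exact h.hasDerivAt_heatInt cα hw (X := fun t => X r t) (T := timeChange b)
      (X' := fun t => b * X r t) (T' := fun t => Real.exp (2 * b * t)) (t := t) (fun s => dXt r s)
      (fun s => hasDerivAt_timeChange hb s) (by fun_prop) (by fun_prop) (X0 r hr t) (T0 t ht)
  have dQXr : ∀ r t, 0 < r → 0 < t → HasDerivAt (fun r => QX (X r t) (timeChange b t))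
      ((QT (X r t) (timeChange b t) + κ / X r t ^ 2 * Q (X r t) (timeChange b t)) * Real.exp (b * t)) r := by
    intro r t hr ht
    exact HasDerivAt.comp r (h.hasDerivAt_heatInt_heatKX cα hw (X0 r hr t) (T0 t ht)) (dXr r t)
  have cX : ∀ r, Continuous fun t => X r t := fun r => by fun_prop
  have cT : Continuous (timeChange b) :=
    continuous_iff_continuousAt.2 fun t => (hasDerivAt_timeChange hb t).continuousAt
  have ct : ∀ {k : ℝ → ℝ → ℝ → ℝ}, HeatDominated (fun y => ρ y / (1 + y) ^ N) k → ∀ r t, 0 < r → 0 < t →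
      ContinuousAt (fun t => heatInt k α (X r t) (timeChange b t)) t := by
    intro k hk r t hr ht
    exact ContinuousAt.comp (f := fun t => (X r t, timeChange b t)) (hk.continuousAt_heatInt cα hw (X0 r hr t) (T0 t ht))
      ((cX r).prodMk cT).continuousAt
  have cr : ∀ {k : ℝ → ℝ → ℝ → ℝ}, HeatDominated (fun y => ρ y / (1 + y) ^ N) k → ∀ r t, 0 < r → 0 < t →
      ContinuousAt (fun r => heatInt k α (X r t) (timeChange b t)) r := by
    intro k hk r t hr ht
    exact ContinuousAt.comp (f := fun r => (X r t, timeChange b t)) (hk.continuousAt_heatInt cα hw (X0 r hr t) (T0 t ht))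
      ((dXr r t).continuousAt.prodMk continuousAt_const)
  have bd : ∀ r, 0 < r → LocExpBdd r (fun r t => Q (X r t) (timeChange b t)) ∧
      LocExpBdd r (fun r t => QX (X r t) (timeChange b t)) ∧ LocExpBdd r (fun r t => QT (X r t) (timeChange b t)) := by
    intro r hr
    obtain ⟨C, τ, hC, hτ, hs⟩ := h.small_time_bounds hw h₁ h₂ h₃ hr
    exact ⟨locExpBdd_curve hb hr ⟨C, τ, hC, hτ, fun X T a1 a2 a3 a4 => (hs X T a1 a2 a3 a4).1⟩
        ((h.dominated_heatK N).abs_heatInt_le hw),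
      locExpBdd_curve hb hr ⟨C, τ, hC, hτ, fun X T a1 a2 a3 a4 => (hs X T a1 a2 a3 a4).2.1⟩
        ((h.dominated_heatKX N).abs_heatInt_le hw),
      locExpBdd_curve hb hr ⟨C, τ, hC, hτ, fun X T a1 a2 a3 a4 => (hs X T a1 a2 a3 a4).2.2⟩
        ((h.dominated_heatKT N).abs_heatInt_le hw)⟩
  have ce : ∀ c r : ℝ, LocExpBdd r (fun _ t => Real.exp (c * t)) := fun c r => LocExpBdd.exp_mul c
  refine ⟨fun r t => E r t * (b * r / 2 * Q (X r t) (timeChange b t) + Real.exp (b * t) * QX (X r t) (timeChange b t)),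
    fun r t => E r t * ((b / 2 + b ^ 2 * r ^ 2 / 4 + κ / r ^ 2) * Q (X r t) (timeChange b t)
      + b * r * Real.exp (b * t) * QX (X r t) (timeChange b t)
      + Real.exp (2 * b * t) * QT (X r t) (timeChange b t)), ?_⟩
  have dbr : ∀ r : ℝ, HasDerivAt (fun r : ℝ => b * r / 2) (b / 2) r := fun r => by
    simpa using ((hasDerivAt_id' r).const_mul b).div_const 2
  have e2 : ∀ t, Real.exp (2 * b * t) = Real.exp (b * t) ^ 2 := fun t => by
    rw [← Real.exp_nat_mul]; congr 1; push_cast; ring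
  refine ⟨fun r hr t ht => ?_, fun r hr t ht => ?_, fun r hr t ht => ?_, fun r hr t ht => ?_, fun r hr t ht => ?_,
    fun r hr t ht => ?_, fun r hr => ?_, fun r hr => ?_, fun r hr => ?_⟩ <;> have hr' : (0 : ℝ) < r := hr
  · exact ((dE r t).fun_mul (dQr r t hr ht)).congr_deriv (by ring)
  · refine ((dE r t).fun_mul (((dbr r).fun_mul (dQr r t hr ht)).fun_add
      ((dQXr r t hr ht).const_mul (Real.exp (b * t))))).congr_deriv ?_
    rw [e2]
    simp only [hX]
    have h1 := hr'.ne'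
    have h2 := (Real.exp_pos (b * t)).ne'
    field_simp
    ring
  · refine ((dEt r t).fun_mul (dQt r t hr ht)).congr_deriv ?_
    simp only [selfSimilar, hX]
    ring
  · have c1 := cr (h.dominated_heatK N) r t hr ht
    have c2 := cr (h.dominated_heatKX N) r t hr ht
    have c3 := cr (h.dominated_heatKT N) r t hr ht
    have c4 := (dE r t).continuousAt
    have c5 : ContinuousAt (fun r => b / 2 + b ^ 2 * r ^ 2 / 4 + κ / r ^ 2) r := by
      fun_prop (disch := exact pow_ne_zero 2 hr'.ne')
    have c6 : ContinuousAt (fun r => b * r * Real.exp (b * t)) r := by fun_prop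
    exact c4.mul (((c5.mul c1).add (c6.mul c2)).add (c3.const_mul _))
  · have c1 := ct (h.dominated_heatK N) r t hr ht
    have c2 := ct (h.dominated_heatKX N) r t hr ht
    have c4 := (dEt r t).continuousAt
    have c6 : ContinuousAt (fun t => Real.exp (b * t)) t := by fun_prop
    exact (c4.mul ((c1.const_mul _).add (c6.mul c2))).continuousWithinAt
  · have c1 := ct (h.dominated_heatK N) r t hr ht
    have c2 := ct (h.dominated_heatKX N) r t hr ht
    have c3 := ct (h.dominated_heatKT N) r t hr ht
    have c4 := (dEt r t).continuousAt
    have c6 : ContinuousAt (fun t => b * r * Real.exp (b * t)) t := by fun_prop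
    have c7 : ContinuousAt (fun t => Real.exp (2 * b * t)) t := by fun_prop
    exact (c4.mul (((c1.const_mul _).add (c6.mul c2)).add (c7.mul c3))).continuousWithinAt
  · exact (locExpBdd_factor r).mul (bd r hr).1
  · have c1 : ContinuousAt (fun r => b * r / 2) r := by fun_prop
    exact (locExpBdd_factor r).mul (((LocExpBdd.of_continuousAt c1).mul (bd r hr).1).add ((ce b r).mul (bd r hr).2.1))
  · have c1 : ContinuousAt (fun r => b / 2 + b ^ 2 * r ^ 2 / 4 + κ / r ^ 2) r := by
      fun_prop (disch := exact pow_ne_zero 2 hr'.ne')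
    have c2 : ContinuousAt (fun r => b * r) r := by fun_prop
    exact (locExpBdd_factor r).mul ((((LocExpBdd.of_continuousAt c1).mul (bd r hr).1).add
      (((LocExpBdd.of_continuousAt c2).mul (ce b r)).mul (bd r hr).2.1)).add ((ce (2 * b) r).mul (bd r hr).2.2))

lemma BesselProfile.tendsto_selfSimilar (h : BesselProfile κ L g g' ρ) (hb : b ≠ 0) {N : ℕ}
    (hα : ContinuousOn α (Ioi 0)) (hw : IntegrableOn (fun y => ρ y / (1 + y) ^ N * α y) (Ioi 0)) {r : ℝ} (hr : 0 < r) :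
    Tendsto (fun t => selfSimilar b γ (heatInt (heatK g) α) r t) (𝓝[>] 0)
      (𝓝 (Real.exp (b * r ^ 2 / 4) * (√(2 * π) * L * α r))) := by
  have c1 : Continuous fun t => r * Real.exp (b * t) := by fun_prop
  have l1 : Tendsto (fun t => r * Real.exp (b * t)) (𝓝[>] 0) (𝓝 r) := by
    have := (c1.tendsto 0).mono_left (nhdsWithin_le_nhds (s := Ioi 0))
    simpa using this
  have c2 : Continuous fun t => Real.exp (b * r ^ 2 / 4 + (γ + 2 * b) * t / 4) := by fun_prop
  have l2 : Tendsto (fun t => Real.exp (b * r ^ 2 / 4 + (γ + 2 * b) * t / 4)) (𝓝[>] 0) (𝓝 (Real.exp (b * r ^ 2 / 4))) := by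
    have := (c2.tendsto 0).mono_left (nhdsWithin_le_nhds (s := Ioi 0))
    simpa using this
  exact l2.mul (h.tendsto_heatInt hα hw hr l1 (tendsto_timeChange hb))

end SelfSimilar

/-! ### Subordination of parabolic solutions -/

section Subordination

variable {β : ℝ}

lemma wrightTransform_one (h : ℝ → ℝ) : wrightTransform 1 h = h := by
  ext t; rw [wrightTransform, if_pos rfl]

lemma wrightTransform_of_lt (h1 : β < 1) (h : ℝ → ℝ) (t : ℝ) :
    wrightTransform β h t = ∫ s in Ioi (0 : ℝ), h s * wrightDensity β s t := by
  rw [wrightTransform, if_neg h1.ne]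

lemma wrightTransform_const_mul (c : ℝ) (h : ℝ → ℝ) (t : ℝ) :
    wrightTransform β (fun s => c * h s) t = c * wrightTransform β h t := by
  by_cases h1 : β = 1
  · subst h1; rw [wrightTransform_one, wrightTransform_one]
  · rw [wrightTransform, wrightTransform, if_neg h1, if_neg h1, ← integral_const_mul]
    congr 1; ext s; ring

lemma HasCaputoDerivAt.const_mul {h : ℝ → ℝ} {d t : ℝ} (hd : HasCaputoDerivAt β h d t) (c : ℝ) :
    HasCaputoDerivAt β (fun τ => c * h τ) (c * d) t := by
  have e : deriv (fun τ => c * h τ) = fun τ => c * deriv h τ := by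
    ext τ; exact deriv_const_mul_field c
  refine ⟨fun τ hτ => (hd.1 τ hτ).const_mul c, hd.2.imp (fun h => ⟨h.1, ?_⟩) fun h => ⟨h.1, ?_, ?_⟩⟩
  · rw [e, h.2]
  · rw [e]
    refine (h.2.1.const_mul c).congr fun τ _ => ?_
    ring
  · rw [e, h.2.2, mul_left_comm, ← intervalIntegral.integral_const_mul]
    congr 2; ext τ; ring

lemma integrable_exp_mul_wrightDensity (h0 : 0 < β) (h1 : β < 1) {t : ℝ} (ht : 0 < t) (C l : ℝ) :
    IntegrableOn (fun s => C * Real.exp (l * s) * |wrightDensity β s t|) (Ioi 0) := by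
  have c : Continuous fun s => C * Real.exp (l * s) := by fun_prop
  have := (integrableOn_comp_mul_mWright (C := |C|) (l := l) h0 h1 ht c.aestronglyMeasurable fun s _ => by
    rw [abs_mul, abs_of_pos (Real.exp_pos _)]).abs
  by_cases hC : 0 ≤ C
  · refine this.congr (Eventually.of_forall fun s => ?_)
    simp only [abs_mul, abs_of_pos (Real.exp_pos _), abs_of_nonneg hC]
  · refine this.neg.congr (Eventually.of_forall fun s => ?_)
    simp only [Pi.neg_apply, abs_mul, abs_of_pos (Real.exp_pos _), abs_of_neg (not_le.1 hC)]
    ring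

lemma LocExpBdd.abs_mul_density_le {F : ℝ → ℝ → ℝ} {x : ℝ} (h : LocExpBdd x F) :
    ∃ C l : ℝ, 0 ≤ C ∧ ∀ᶠ ξ in 𝓝 x, ∀ t s, 0 < s →
      ‖F ξ s * wrightDensity β s t‖ ≤ C * Real.exp (l * s) * |wrightDensity β s t| := by
  obtain ⟨C, l, hC, hl, hF⟩ := h
  refine ⟨C, l, hC, ?_⟩
  filter_upwards [hF] with ξ hξ t s hs
  rw [norm_mul]
  exact mul_le_mul_of_nonneg_right (hξ s hs) (abs_nonneg _)

lemma LocExpBdd.integrableOn {F : ℝ → ℝ → ℝ} {x : ℝ} (hF : LocExpBdd x F) (hc : ContinuousOn (F x) (Ioi 0))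
    (h0 : 0 < β) (h1 : β < 1) {t : ℝ} (ht : 0 < t) :
    IntegrableOn (fun s => F x s * wrightDensity β s t) (Ioi 0) := by
  obtain ⟨C, l, hC, hl, hF⟩ := hF
  exact integrableOn_comp_mul_mWright h0 h1 ht (hc.aestronglyMeasurable measurableSet_Ioi) hF.self_of_nhds

/-- Exponential growth in time, uniform near x, is integrable against the density, so space
derivatives commute with subordination. -/
lemma hasDerivAt_wrightTransform {F F' : ℝ → ℝ → ℝ} {x : ℝ} (h0 : 0 < β) (h1 : β ≤ 1)
    (hd : ∀ᶠ ξ in 𝓝 x, ∀ t, 0 < t → HasDerivAt (fun ξ => F ξ t) (F' ξ t) ξ)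
    (hc : ∀ᶠ ξ in 𝓝 x, ContinuousOn (F ξ) (Ioi 0)) (hc' : ContinuousOn (F' x) (Ioi 0))
    (hF : LocExpBdd x F) (hF' : LocExpBdd x F') {t : ℝ} (ht : 0 < t) :
    HasDerivAt (fun ξ => wrightTransform β (F ξ) t) (wrightTransform β (F' x) t) x := by
  rcases h1.eq_or_lt with rfl | h1
  · simp_rw [wrightTransform_one]
    exact hd.self_of_nhds t ht
  simp_rw [wrightTransform_of_lt h1]
  obtain ⟨C, l, hC, hb⟩ := hF'.abs_mul_density_le (β := β)
  have hi := hF.integrableOn hc.self_of_nhds h0 h1 ht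
  have hi' := hF'.integrableOn hc' h0 h1 ht
  obtain ⟨C₁, l₁, hC₁, hl₁, hb₁⟩ := hF
  refine (hasDerivAt_integral_of_dominated_loc_of_deriv_le (μ := volume.restrict (Ioi (0 : ℝ)))
    (F := fun ξ s => F ξ s * wrightDensity β s t) (F' := fun ξ s => F' ξ s * wrightDensity β s t)
    (bound := fun s => C * Real.exp (l * s) * |wrightDensity β s t|) (hb.and hd) ?_ hi
    hi'.aestronglyMeasurable ?_ (integrable_exp_mul_wrightDensity h0 h1 ht C l) ?_).2
  · filter_upwards [hc, hb₁] with ξ h2 h3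
    exact (integrableOn_comp_mul_mWright h0 h1 ht (h2.aestronglyMeasurable measurableSet_Ioi) h3).aestronglyMeasurable
  · filter_upwards [ae_restrict_mem measurableSet_Ioi] with s hs ξ hξ using hξ.1 t s hs
  · filter_upwards [ae_restrict_mem measurableSet_Ioi] with s hs ξ hξ using (hξ.2 s hs).mul_const _

lemma continuousAt_wrightTransform {F : ℝ → ℝ → ℝ} {x : ℝ} (h0 : 0 < β) (h1 : β ≤ 1)
    (hd : ∀ t, 0 < t → ContinuousAt (fun ξ => F ξ t) x) (hc : ∀ᶠ ξ in 𝓝 x, ContinuousOn (F ξ) (Ioi 0))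
    (hF : LocExpBdd x F) {t : ℝ} (ht : 0 < t) : ContinuousAt (fun ξ => wrightTransform β (F ξ) t) x := by
  rcases h1.eq_or_lt with rfl | h1
  · simp_rw [wrightTransform_one]
    exact hd t ht
  simp_rw [wrightTransform_of_lt h1]
  obtain ⟨C, l, hC, hb⟩ := hF.abs_mul_density_le (β := β)
  obtain ⟨C₁, l₁, hC₁, hl₁, hb₁⟩ := hF
  refine continuousAt_of_dominated (bound := fun s => C * Real.exp (l * s) * |wrightDensity β s t|) ?_ ?_
    (integrable_exp_mul_wrightDensity h0 h1 ht C l) ?_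
  · filter_upwards [hc, hb₁] with ξ h2 h3
    exact (integrableOn_comp_mul_mWright h0 h1 ht (h2.aestronglyMeasurable measurableSet_Ioi) h3).aestronglyMeasurable
  · filter_upwards [hb] with ξ hξ
    filter_upwards [ae_restrict_mem measurableSet_Ioi] with s hs using hξ t s hs
  · filter_upwards [ae_restrict_mem measurableSet_Ioi] with s hs using (hd s hs).mul_const _

namespace ParabolicSolution

variable {s : Set ℝ} {V : ℝ → ℝ} {w wx wxx : ℝ → ℝ → ℝ}

lemma cont_time (h : ParabolicSolution s V w wx wxx) {x : ℝ} (hx : x ∈ s) : ContinuousOn (w x) (Ioi 0) :=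
  fun t ht => (h.deriv_time x hx t ht).continuousAt.continuousWithinAt

/-- The Caputo derivative is the transform of w_t = w_xx + V w, and V(x), being independent of time,
leaves the integral. -/
lemma hasCaputoDerivAt (h : ParabolicSolution s V w wx wxx) (h0 : 0 < β) (h1 : β ≤ 1) {x t : ℝ} (hx : x ∈ s)
    (ht : 0 < t) : HasCaputoDerivAt β (wrightTransform β (w x))
      (wrightTransform β (wxx x) t + V x * wrightTransform β (w x) t) t := by
  rcases h1.eq_or_lt with rfl | h1
  · simp_rw [wrightTransform_one]
    exact ⟨fun τ hτ => (h.deriv_time x hx τ hτ.1).differentiableAt, Or.inl ⟨rfl, (h.deriv_time x hx t ht).deriv.symm⟩⟩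
  have hd : ∀ τ, 0 < τ → deriv (w x) τ = wxx x τ + V x * w x τ := fun τ hτ => (h.deriv_time x hx τ hτ).deriv
  obtain ⟨C, l, hC, hl, hb⟩ := h.bound x hx
  obtain ⟨D, m, hD, hm, hb'⟩ := (h.bound_snd x hx).add
    ((LocExpBdd.of_continuousAt (φ := fun _ => V x) continuousAt_const).mul (h.bound x hx))
  have key := hasCaputoDerivAt_wrightTransform (C := C + D) (l := l + m) h0 h1 (by positivity)
    (fun τ hτ => (h.deriv_time x hx τ hτ).differentiableAt) (fun τ hτ => ?_) (fun τ hτ => ?_) ht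
  · convert key using 1
    rw [wrightTransform_of_lt h1, wrightTransform_of_lt h1, wrightTransform_of_lt h1, ← integral_const_mul,
      ← integral_add ((h.bound_snd x hx).integrableOn (h.cont_time_snd x hx) h0 h1 ht)
      (((h.bound x hx).integrableOn (h.cont_time hx) h0 h1 ht).const_mul _)]
    refine setIntegral_congr_fun measurableSet_Ioi fun τ hτ => ?_
    simp only [hd τ hτ]; ring
  · refine (hb.self_of_nhds τ hτ).trans ?_
    gcongr <;> linarith
  · rw [hd τ hτ]
    refine (hb'.self_of_nhds τ hτ).trans ?_
    gcongr <;> linarith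

end ParabolicSolution

end Subordination

/-! ### From the parabolic equation to the Fokker–Planck equation -/

section FokkerPlanck

variable {β : ℝ} {s : Set ℝ} {f f' Φ V : ℝ → ℝ} {u w wx wxx : ℝ → ℝ → ℝ}

lemma contDiffOn_two_of_hasDerivAt {F F' F'' : ℝ → ℝ} (hs : IsOpen s) (h1 : ∀ x ∈ s, HasDerivAt F (F' x) x)
    (h2 : ∀ x ∈ s, HasDerivAt F' (F'' x) x) (h3 : ContinuousOn F'' s) : ContDiffOn ℝ 2 F s := by
  have e : (2 : WithTop ℕ∞) = 1 + 1 := by norm_num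
  have e' : (1 : WithTop ℕ∞) = 0 + 1 := by norm_num
  have c1 : ContDiffOn ℝ 1 F' s := by
    rw [e', contDiffOn_succ_iff_deriv_of_isOpen hs]
    refine ⟨fun x hx => (h2 x hx).differentiableAt.differentiableWithinAt, by simp, ?_⟩
    rw [contDiffOn_zero]
    exact h3.congr fun x hx => (h2 x hx).deriv
  rw [e, contDiffOn_succ_iff_deriv_of_isOpen hs]
  exact ⟨fun x hx => (h1 x hx).differentiableAt.differentiableWithinAt, by simp,
    c1.congr fun x hx => (h1 x hx).deriv⟩

/-- The ground state transform of a subordinated parabolic solution solves the Fokker–Planck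
equation with the drift `f`. -/
lemma ParabolicSolution.solves_fokkerPlanck (h : ParabolicSolution s V w wx wxx) (hs : IsOpen s) (h0 : 0 < β) (h1 : β ≤ 1)
    (hΦ : ∀ x ∈ s, HasDerivAt Φ (f x) x) (hf : ∀ x ∈ s, HasDerivAt f (f' x) x) (hf' : ContinuousOn f' s)
    (hV : ∀ x ∈ s, V x = f' x / 2 - f x ^ 2 / 4) (hu : ∀ x ∈ s, ∀ t, u x t = Real.exp (-(Φ x / 2)) * w x t)
    {x t : ℝ} (hx : x ∈ s) (ht : 0 < t) :
    ContDiffAt ℝ 2 (fun ξ => wrightTransform β (u ξ) t) x ∧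
    DifferentiableAt ℝ (fun ξ => f ξ * wrightTransform β (u ξ) t) x ∧
    HasCaputoDerivAt β (fun τ => wrightTransform β (u x) τ)
      (iteratedDeriv 2 (fun ξ => wrightTransform β (u ξ) t) x + deriv (fun ξ => f ξ * wrightTransform β (u ξ) t) x) t := by
  have hu' : ∀ ξ ∈ s, ∀ τ, wrightTransform β (u ξ) τ = Real.exp (-(Φ ξ / 2)) * wrightTransform β (w ξ) τ := by
    intro ξ hξ τ
    rw [← wrightTransform_const_mul]
    congr 1; ext σ; exact hu ξ hξ σ
  have hev : ∀ ξ ∈ s, ∀ᶠ η in 𝓝 ξ, η ∈ s := fun ξ hξ => hs.mem_nhds hξ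
  set W := fun ξ => wrightTransform β (w ξ) t with hW
  set WX := fun ξ => wrightTransform β (wx ξ) t with hWX
  set WXX := fun ξ => wrightTransform β (wxx ξ) t with hWXX
  set e := fun ξ => Real.exp (-(Φ ξ / 2)) with he
  have dW : ∀ ξ ∈ s, HasDerivAt W (WX ξ) ξ := fun ξ hξ => hasDerivAt_wrightTransform h0 h1
    ((hev ξ hξ).mono fun η hη τ hτ => h.deriv_fst η hη τ hτ) ((hev ξ hξ).mono fun η hη => h.cont_time hη)
    (h.cont_time_fst ξ hξ) (h.bound ξ hξ) (h.bound_fst ξ hξ) ht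
  have dWX : ∀ ξ ∈ s, HasDerivAt WX (WXX ξ) ξ := fun ξ hξ => hasDerivAt_wrightTransform h0 h1
    ((hev ξ hξ).mono fun η hη τ hτ => h.deriv_snd η hη τ hτ) ((hev ξ hξ).mono fun η hη => h.cont_time_fst η hη)
    (h.cont_time_snd ξ hξ) (h.bound_fst ξ hξ) (h.bound_snd ξ hξ) ht
  have cWXX : ∀ ξ ∈ s, ContinuousAt WXX ξ := fun ξ hξ => continuousAt_wrightTransform h0 h1
    (fun τ hτ => h.cont_space ξ hξ τ hτ) ((hev ξ hξ).mono fun η hη => h.cont_time_snd η hη) (h.bound_snd ξ hξ) ht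
  have de : ∀ ξ ∈ s, HasDerivAt e (-(f ξ / 2) * e ξ) ξ := fun ξ hξ =>
    (((hΦ ξ hξ).div_const 2).fun_neg.exp).congr_deriv (by simp only [he]; ring)
  set U := fun ξ => wrightTransform β (u ξ) t with hU
  -- These are u_x and u_xx of the transform. In u_xx + (f u)_x the terms with w_x cancel, and f'/2
  -- - f²/4 = V remains in front of w.
  set U1 := fun ξ => e ξ * (WX ξ - f ξ / 2 * W ξ) with hU1
  set U2 := fun ξ => e ξ * (WXX ξ - f ξ * WX ξ + (f ξ ^ 2 / 4 - f' ξ / 2) * W ξ) with hU2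
  have dU : ∀ ξ ∈ s, HasDerivAt U (U1 ξ) ξ := by
    intro ξ hξ
    refine (((de ξ hξ).fun_mul (dW ξ hξ)).congr_deriv ?_).congr_of_eventuallyEq
      ((hev ξ hξ).mono fun η hη => hu' η hη t)
    simp only [hU1]; ring
  have dU1 : ∀ ξ ∈ s, HasDerivAt U1 (U2 ξ) ξ := by
    intro ξ hξ
    refine ((de ξ hξ).fun_mul ((dWX ξ hξ).fun_sub (((hf ξ hξ).div_const 2).fun_mul (dW ξ hξ)))).congr_deriv ?_
    simp only [hU2]; ring
  have cU2 : ContinuousOn U2 s := by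
    have c1 : ContinuousOn e s := fun ξ hξ => (de ξ hξ).continuousAt.continuousWithinAt
    have c2 : ContinuousOn W s := fun ξ hξ => (dW ξ hξ).continuousAt.continuousWithinAt
    have c3 : ContinuousOn WX s := fun ξ hξ => (dWX ξ hξ).continuousAt.continuousWithinAt
    have c4 : ContinuousOn WXX s := fun ξ hξ => (cWXX ξ hξ).continuousWithinAt
    have c5 : ContinuousOn f s := fun ξ hξ => (hf ξ hξ).continuousAt.continuousWithinAt
    exact c1.mul ((c4.sub (c5.mul c3)).add ((((c5.pow 2).div_const 4).sub (hf'.div_const 2)).mul c2))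
  have dfU := (hf x hx).fun_mul (dU x hx)
  refine ⟨(contDiffOn_two_of_hasDerivAt hs dU dU1 cU2).contDiffAt (hs.mem_nhds hx), dfU.differentiableAt, ?_⟩
  have i2 : iteratedDeriv 2 U x = U2 x := by
    rw [iteratedDeriv_succ, iteratedDeriv_one]
    have : deriv U =ᶠ[𝓝 x] U1 := (hev x hx).mono fun η hη => (dU η hη).deriv
    rw [this.deriv_eq]
    exact (dU1 x hx).deriv
  rw [i2, dfU.deriv, show (fun τ => wrightTransform β (u x) τ) = fun τ => e x * wrightTransform β (w x) τ from
    funext fun τ => hu' x hx τ]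
  convert (h.hasCaputoDerivAt h0 h1 hx ht).const_mul (e x) using 1
  rw [hV x hx, show U x = e x * W x from hu' x hx t]
  simp only [hU1, hU2, hW, hWXX]
  ring

lemma ParabolicSolution.tendsto_wrightTransform (h : ParabolicSolution s V w wx wxx) (h0 : 0 < β) (h1 : β ≤ 1)
    (hu : ∀ x ∈ s, ∀ t, u x t = Real.exp (-(Φ x / 2)) * w x t) {x a : ℝ} (hx : x ∈ s)
    (ha : Tendsto (u x) (𝓝[>] 0) (𝓝 a)) : Tendsto (fun t => wrightTransform β (u x) t) (𝓝[>] 0) (𝓝 a) := by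
  rcases h1.eq_or_lt with rfl | h1
  · rwa [wrightTransform_one]
  obtain ⟨C, l, hC, hl, hb⟩ := h.bound x hx
  have e : u x = fun t => Real.exp (-(Φ x / 2)) * w x t := funext fun t => hu x hx t
  refine RiccatiFP.tendsto_wrightTransform (C := Real.exp (-(Φ x / 2)) * C) h0 h1 hl ?_ (fun t ht => ?_) ha
  · rw [e]
    exact (continuousOn_const.mul (h.cont_time hx)).aestronglyMeasurable measurableSet_Ioi
  · rw [e, abs_mul, abs_of_pos (Real.exp_pos _), mul_assoc]
    exact mul_le_mul_of_nonneg_left (hb.self_of_nhds t ht) (Real.exp_pos _).le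

lemma ParabolicSolution.integrableOn (h : ParabolicSolution s V w wx wxx) (h0 : 0 < β) (h1 : β < 1)
    (hu : ∀ x ∈ s, ∀ t, u x t = Real.exp (-(Φ x / 2)) * w x t) {x t : ℝ} (hx : x ∈ s) (ht : 0 < t) :
    IntegrableOn (fun τ => u x τ * wrightDensity β τ t) (Ioi 0) := by
  refine (((h.bound x hx).integrableOn (h.cont_time hx) h0 h1 ht).const_mul (Real.exp (-(Φ x / 2)))).congr
    (Eventually.of_forall fun τ => ?_)
  simp only [hu x hx]; ring

end FokkerPlanck

/-! ### The Bessel functions as profiles -/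

lemma rpow_le_add_one_div_pow (p : ℝ) : ∃ m : ℕ, ∀ z : ℝ, 0 < z → z ^ p ≤ (z + 1 / z) ^ m := by
  obtain ⟨m, hm⟩ := exists_nat_ge |p|
  refine ⟨m, fun z hz => ?_⟩
  have h1 : 1 ≤ z + 1 / z := by linarith [two_le_add_one_div hz]
  have h0 : 0 < 1 / z := by positivity
  rw [← Real.rpow_natCast]
  rcases le_total 0 p with hp | hp
  · calc z ^ p ≤ (z + 1 / z) ^ p := Real.rpow_le_rpow hz.le (by linarith) hp
      _ ≤ _ := Real.rpow_le_rpow_of_exponent_le h1 ((le_abs_self p).trans hm)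
  · calc z ^ p = (1 / z) ^ (-p) := by rw [one_div, Real.inv_rpow hz.le, Real.rpow_neg hz.le, inv_inv]
      _ ≤ (z + 1 / z) ^ (-p) := Real.rpow_le_rpow h0.le (by linarith) (neg_nonneg.2 hp)
      _ ≤ _ := Real.rpow_le_rpow_of_exponent_le h1 ((neg_le_abs p).trans hm)

lemma besselProfile_normalI (a : ℝ) :
    BesselProfile (a ^ 2 - 1 / 4) (√(2 * π))⁻¹ (normalI a) (normalI' a) (fun z => z ^ (a + 1 / 2)) where
  weight_pos z hz := by positivity
  weight_mul c z hc hz := (Real.mul_rpow hc.le hz.le).le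
  weight_le := by
    obtain ⟨m, hm⟩ := rpow_le_add_one_div_pow (a + 1 / 2)
    exact ⟨1, m, one_pos.le, fun z hz => by rw [one_mul]; exact hm z hz⟩
  solves := solves_normalI a
  bound := normalI_bound a
  lim := tendsto_normalI a

lemma abs_log_le_add_one_div {z : ℝ} (hz : 0 < z) : |Real.log z| ≤ z + 1 / z := by
  have h1 := Real.log_le_sub_one_of_pos hz
  have h2 := Real.log_le_sub_one_of_pos (inv_pos.2 hz)
  have h3 : 0 < z⁻¹ := inv_pos.2 hz
  rw [Real.log_inv] at h2
  rw [one_div, abs_le]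
  constructor <;> linarith

lemma besselProfile_normalK {a : ℝ} (ha : 0 ≤ a) :
    BesselProfile (a ^ 2 - 1 / 4) 0 (normalK a) (normalK' a) (fun z => z ^ (-a + 1 / 2) * (1 + |Real.log z|)) where
  weight_pos z hz := by positivity
  weight_mul c z hc hz := by
    rw [Real.mul_rpow hc.le hz.le, Real.log_mul hc.ne' hz.ne']
    have h1 := abs_add_le (Real.log c) (Real.log z)
    have h2 : 0 ≤ |Real.log c| * |Real.log z| := by positivity
    calc c ^ (-a + 1 / 2) * z ^ (-a + 1 / 2) * (1 + |Real.log c + Real.log z|)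
        ≤ c ^ (-a + 1 / 2) * z ^ (-a + 1 / 2) * ((1 + |Real.log c|) * (1 + |Real.log z|)) := by
          gcongr
          linarith
      _ = _ := by ring
  weight_le := by
    obtain ⟨m, hm⟩ := rpow_le_add_one_div_pow (-a + 1 / 2)
    refine ⟨2, m + 1, by norm_num, fun z hz => ?_⟩
    have h1 := two_le_add_one_div hz
    have h2 := abs_log_le_add_one_div hz
    calc z ^ (-a + 1 / 2) * (1 + |Real.log z|) ≤ (z + 1 / z) ^ m * (2 * (z + 1 / z)) := by
          gcongr
          · exact hm z hz
          · linarith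
      _ = _ := by ring
  solves := solves_normalK a
  bound := by
    obtain ⟨C, hC, h⟩ := normalK_bound ha
    refine ⟨C, 0, hC, fun z hz => ?_⟩
    rw [pow_zero, mul_one]
    exact (h z hz).trans (le_mul_of_one_le_right (by positivity) (Real.one_le_exp hz.le))
  lim := tendsto_normalK ha

/-! ### The kernel in self-similar variables -/

lemma rpow_quarter_sq {S : ℝ} (hS : 0 ≤ S) : (S ^ 2) ^ (1 / 4 : ℝ) = √S := by
  rw [Real.sqrt_eq_rpow, ← Real.rpow_natCast, ← Real.rpow_mul hS]; norm_num

/-- The factors of the kernel combine to the Bessel heat kernel in self-similar variables. -/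
lemma kernel_factor_eq {b t γ r y P I : ℝ} {g : ℝ → ℝ} (hb : b ≠ 0) (ht : 0 < t) (hr : 0 < r) (hy : 0 < y)
    (hI : √(|b| * y * (r / √(4 * Real.sinh (b * t) ^ 2))) * I = g (|b| * y * (r / √(4 * Real.sinh (b * t) ^ 2)))) :
    (r / √(4 * Real.sinh (b * t) ^ 2)) ^ (1 / 2 : ℝ) * I *
        (Real.exp (γ * t / 4) / (4 * Real.sinh (b * t) ^ 2) ^ (1 / 4 : ℝ)) *
        Real.exp (-(b / 4 * (Real.cosh (b * t) / Real.sinh (b * t)) * r ^ 2 + 1 / 2 * P)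
          + y ^ 2 * b / (2 * (1 - Real.exp (2 * b * t)))) =
      Real.exp (-(P / 2)) * (Real.exp (b * r ^ 2 / 4 + (γ + 2 * b) * t / 4) *
        (heatK g (r * Real.exp (b * t)) (timeChange b t) y * (|b|⁻¹ * y ^ (-(1 / 2) : ℝ)))) := by
  have hT := timeChange_pos hb ht
  set E := Real.exp (b * t) with hE
  have hE0 : 0 < E := Real.exp_pos _
  have hE2 : Real.exp (2 * b * t) = E ^ 2 := by
    rw [hE, ← Real.exp_nat_mul]; congr 1; push_cast; ring
  have hE1 : E ^ 2 - 1 ≠ 0 := by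
    intro h0
    rw [timeChange, hE2, h0, zero_div] at hT
    exact lt_irrefl _ hT
  have hsinh : Real.sinh (b * t) = (E ^ 2 - 1) / (2 * E) := by
    rw [Real.sinh_eq, Real.exp_neg, ← hE]; field_simp
  have hcosh : Real.cosh (b * t) = (E ^ 2 + 1) / (2 * E) := by
    rw [Real.cosh_eq, Real.exp_neg, ← hE]; field_simp
  set S := √(4 * Real.sinh (b * t) ^ 2) with hS
  have hS2 : 4 * Real.sinh (b * t) ^ 2 = S ^ 2 := (Real.sq_sqrt (by positivity)).symm
  have hsne : Real.sinh (b * t) ≠ 0 := by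
    rw [hsinh]; exact div_ne_zero hE1 (by positivity)
  have hS0 : 0 < S := Real.sqrt_pos.2 (by positivity)
  have hb0 : 0 < |b| := abs_pos.2 hb
  -- As S = 2|sinh(bt)| and T > 0 for either sign of b, it is |b| that appears here and in the
  -- Bessel argument Xy/2T.
  have h2T : 2 * timeChange b t = E * S / |b| := by
    have h1 : 0 ≤ 2 * timeChange b t := by positivity
    have h2 : 0 ≤ E * S / |b| := by positivity
    rw [← abs_of_nonneg h1, ← abs_of_nonneg h2, ← sq_eq_sq_iff_abs_eq_abs, div_pow, mul_pow, mul_pow, ← hS2, sq_abs, timeChange,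
      hE2, hsinh]
    field_simp
    ring
  have hz : r * E * y / (2 * timeChange b t) = |b| * y * (r / S) := by
    rw [h2T]; field_simp
  have hrt : (r / S) ^ (1 / 2 : ℝ) * I = (√(|b| * y))⁻¹ * g (|b| * y * (r / S)) := by
    have h1 : √(|b| * y) ≠ 0 := by positivity
    rw [← hI, Real.sqrt_mul (by positivity) (r / S), ← Real.sqrt_eq_rpow]
    field_simp
  have hpow : (2 * timeChange b t) ^ (-(1 / 2) : ℝ) = Real.exp (-(b * t / 2)) * (√|b| / √S) := by
    have h3 : √E = Real.exp (b * t / 2) := by rw [hE, Real.exp_half]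
    rw [h2T, Real.rpow_neg (by positivity), ← Real.sqrt_eq_rpow, Real.sqrt_div (by positivity),
      Real.sqrt_mul hE0.le, h3, Real.exp_neg, inv_div]
    field_simp
  -- The leftover powers of |b| and y are those built into `heatDensity`.
  have hcoef : |b|⁻¹ * y ^ (-(1 / 2) : ℝ) * √|b| = (√(|b| * y))⁻¹ := by
    rw [Real.sqrt_mul hb0.le, Real.rpow_neg hy.le, ← Real.sqrt_eq_rpow]
    have h1 : √|b| ^ 2 = |b| := Real.sq_sqrt hb0.le
    have h2 : √|b| ≠ 0 := by positivity
    have h3 : √y ≠ 0 := by positivity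
    field_simp
    exact h1
  -- Since 1/T = 2b/(E² - 1), the y²-term is -y²/4T and -(b/4) coth(bt) r² = b r²/4 - (rE)²/4T.
  have hexp : γ * t / 4 + (-(b / 4 * (Real.cosh (b * t) / Real.sinh (b * t)) * r ^ 2 + 1 / 2 * P)
        + y ^ 2 * b / (2 * (1 - Real.exp (2 * b * t)))) =
      -(P / 2) + (b * r ^ 2 / 4 + (γ + 2 * b) * t / 4) + -(b * t / 2)
        + -(((r * E) ^ 2 + y ^ 2) / (4 * timeChange b t)) := by
    rw [hsinh, hcosh, timeChange, hE2]
    have h1 : 1 - E ^ 2 ≠ 0 := by rw [← neg_sub]; exact neg_ne_zero.2 hE1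
    have h2 : y ^ 2 * b / (2 * (1 - E ^ 2)) = -(y ^ 2 * b / (2 * (E ^ 2 - 1))) := by
      rw [← neg_sub (E ^ 2) 1, mul_neg, div_neg]
    rw [h2]
    field_simp
    ring
  have hexp' := congrArg Real.exp hexp
  rw [Real.exp_add (γ * t / 4), Real.exp_add _ (-(((r * E) ^ 2 + y ^ 2) / (4 * timeChange b t))),
    Real.exp_add _ (-(b * t / 2)), Real.exp_add (-(P / 2))] at hexp'
  rw [heatK, hz, hrt, hpow, hS2, rpow_quarter_sq hS0.le]
  calc _ = (√(|b| * y))⁻¹ * g (|b| * y * (r / S)) / √S * (Real.exp (γ * t / 4) *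
        Real.exp (-(b / 4 * (Real.cosh (b * t) / Real.sinh (b * t)) * r ^ 2 + 1 / 2 * P)
          + y ^ 2 * b / (2 * (1 - Real.exp (2 * b * t))))) := by ring
    _ = _ := by rw [hexp', ← hcoef]; ring

/-- The density against which the Bessel heat kernel is integrated. -/
def heatDensity (b : ℝ) (A φ : ℝ → ℝ) (y : ℝ) : ℝ := |b|⁻¹ * y ^ (-(1 / 2) : ℝ) * (A y * φ y)

lemma contDiffOn_heatDensity (b : ℝ) {A φ : ℝ → ℝ} (hA : ContDiffOn ℝ 2 A (Ioi 0)) (hφ : ContDiffOn ℝ 2 φ (Ioi 0)) :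
    ContDiffOn ℝ 2 (heatDensity b A φ) (Ioi 0) := by
  have : ContDiffOn ℝ 2 (fun y : ℝ => y ^ (-(1 / 2) : ℝ)) (Ioi 0) := fun y hy =>
    (Real.contDiffAt_rpow_const_of_ne (ne_of_gt hy)).contDiffWithinAt
  exact (contDiffOn_const.mul this).mul (hA.mul hφ)

lemma hasDerivAt_of_contDiffOn_two {α : ℝ → ℝ} (h : ContDiffOn ℝ 2 α (Ioi 0)) :
    (∀ y, 0 < y → HasDerivAt α (deriv α y) y) ∧ (∀ y, 0 < y → HasDerivAt (deriv α) (deriv (deriv α) y) y) ∧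
      ContinuousOn (deriv (deriv α)) (Ioi 0) := by
  have e : (2 : WithTop ℕ∞) = 1 + 1 := by norm_num
  rw [e, contDiffOn_succ_iff_deriv_of_isOpen isOpen_Ioi] at h
  have e' : (1 : WithTop ℕ∞) = 0 + 1 := by norm_num
  obtain ⟨h1, -, h2⟩ := h
  rw [e', contDiffOn_succ_iff_deriv_of_isOpen isOpen_Ioi, contDiffOn_zero] at h2
  exact ⟨fun y hy => (h1.differentiableAt (Ioi_mem_nhds hy)).hasDerivAt,
    fun y hy => (h2.1.differentiableAt (Ioi_mem_nhds hy)).hasDerivAt, h2.2.2⟩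

section TwoTerms

variable {κ L₁ L₂ b γ : ℝ} {g₁ g₁' ρ₁ g₂ g₂' ρ₂ A₁ A₂ φ : ℝ → ℝ}

/-- A parabolic solution on the half-line which is a superposition of two Bessel profiles, together with
the integrability of its integrand and its initial value. -/
lemma exists_parabolicSolution (h₁ : BesselProfile κ L₁ g₁ g₁' ρ₁) (h₂ : BesselProfile κ L₂ g₂ g₂' ρ₂) (hb : b ≠ 0)
    (hA₁ : ContDiffOn ℝ 2 A₁ (Ioi 0)) (hA₂ : ContDiffOn ℝ 2 A₂ (Ioi 0)) (hφ : ContDiffOn ℝ 2 φ (Ioi 0)) {N : ℕ}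
    (i₁ : IntegrableOn (fun y => ρ₁ y / (1 + y) ^ N * heatDensity b A₁ φ y) (Ioi 0))
    (i₂ : IntegrableOn (fun y => ρ₂ y / (1 + y) ^ N * heatDensity b A₂ φ y) (Ioi 0)) (γ : ℝ) :
    ∃ w wx wxx : ℝ → ℝ → ℝ,
      ParabolicSolution (Ioi 0) (fun r => γ / 4 - b ^ 2 * r ^ 2 / 4 - κ / r ^ 2) w wx wxx ∧
      (∀ r, 0 < r → Tendsto (w r) (𝓝[>] 0) (𝓝 (Real.exp (b * r ^ 2 / 4) *
        (√(2 * π) * (L₁ * heatDensity b A₁ φ r + L₂ * heatDensity b A₂ φ r))))) ∧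
      ∀ r t P : ℝ, 0 < r → 0 < t → ∀ I₁ I₂ : ℝ → ℝ,
        (∀ y, 0 < y → √(|b| * y * (r / √(4 * Real.sinh (b * t) ^ 2))) * I₁ y =
          g₁ (|b| * y * (r / √(4 * Real.sinh (b * t) ^ 2)))) →
        (∀ y, 0 < y → √(|b| * y * (r / √(4 * Real.sinh (b * t) ^ 2))) * I₂ y =
          g₂ (|b| * y * (r / √(4 * Real.sinh (b * t) ^ 2)))) →
        ∀ p : ℝ → ℝ, (∀ y, 0 < y → p y =
          (r / √(4 * Real.sinh (b * t) ^ 2)) ^ (1 / 2 : ℝ) * (A₁ y * I₁ y + A₂ y * I₂ y) *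
          (Real.exp (γ * t / 4) / (4 * Real.sinh (b * t) ^ 2) ^ (1 / 4 : ℝ)) *
          Real.exp (-(b / 4 * (Real.cosh (b * t) / Real.sinh (b * t)) * r ^ 2 + 1 / 2 * P)
            + y ^ 2 * b / (2 * (1 - Real.exp (2 * b * t))))) →
        IntegrableOn (fun y => p y * φ y) (Ioi 0) ∧
          ∫ y in Ioi (0 : ℝ), p y * φ y = Real.exp (-(P / 2)) * w r t := by
  have c₁ := contDiffOn_heatDensity b hA₁ hφ
  have c₂ := contDiffOn_heatDensity b hA₂ hφ
  obtain ⟨d₁, d₁', d₁''⟩ := hasDerivAt_of_contDiffOn_two c₁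
  obtain ⟨d₂, d₂', d₂''⟩ := hasDerivAt_of_contDiffOn_two c₂
  obtain ⟨wx, wxx, hs₁⟩ := h₁.parabolicSolution (γ := γ) hb i₁ d₁ d₁' d₁''
  obtain ⟨zx, zxx, hs₂⟩ := h₂.parabolicSolution (γ := γ) hb i₂ d₂ d₂' d₂''
  refine ⟨_, _, _, hs₁.add hs₂, fun r hr => ?_, fun r t P hr ht I₁ I₂ hI₁ hI₂ p hp => ?_⟩
  · have := (h₁.tendsto_selfSimilar (γ := γ) hb c₁.continuousOn i₁ hr).add
      (h₂.tendsto_selfSimilar (γ := γ) hb c₂.continuousOn i₂ hr)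
    refine this.congr' EventuallyEq.rfl |>.trans_eq ?_
    congr 1; ring
  · have hX : 0 < r * Real.exp (b * t) := by positivity
    have hT := timeChange_pos hb ht
    have j₁ := (h₁.dominated_heatK N).integrableOn c₁.continuousOn i₁ hX hT
    have j₂ := (h₂.dominated_heatK N).integrableOn c₂.continuousOn i₂ hX hT
    set c := Real.exp (-(P / 2)) * Real.exp (b * r ^ 2 / 4 + (γ + 2 * b) * t / 4) with hc
    have e : EqOn (fun y => p y * φ y) (fun y => c *
        (heatK g₁ (r * Real.exp (b * t)) (timeChange b t) y * heatDensity b A₁ φ y +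
          heatK g₂ (r * Real.exp (b * t)) (timeChange b t) y * heatDensity b A₂ φ y)) (Ioi 0) := by
      intro y hy
      have k₁ := kernel_factor_eq (γ := γ) (P := P) hb ht hr hy (hI₁ y hy)
      have k₂ := kernel_factor_eq (γ := γ) (P := P) hb ht hr hy (hI₂ y hy)
      simp only [hp y hy, heatDensity, hc]
      linear_combination (A₁ y * φ y) * k₁ + (A₂ y * φ y) * k₂
    refine ⟨IntegrableOn.congr_fun ((j₁.add j₂).const_mul c) e.symm measurableSet_Ioi, ?_⟩
    rw [setIntegral_congr_fun measurableSet_Ioi e, integral_const_mul, integral_add j₁ j₂, hc, selfSimilar, selfSimilar,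
      heatInt, heatInt]
    ring

end TwoTerms

/-- The factor √y in the weight of a profile cancels the y^{-1/2} of the density, so the plain power
y^p appears in the hypothesis. -/
lemma integrableOn_heatDensity_mul {b p : ℝ} {q A φ : ℝ → ℝ} {N : ℕ}
    (h : IntegrableOn (fun y => y ^ p * q y * (A y * φ y) / (1 + y) ^ N) (Ioi 0)) :
    IntegrableOn (fun y => y ^ (p + 1 / 2) * q y / (1 + y) ^ N * heatDensity b A φ y) (Ioi 0) := by
  refine IntegrableOn.congr_fun (h.const_mul |b|⁻¹) (fun y hy => ?_) measurableSet_Ioi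
  have hy0 : (0 : ℝ) < y := hy
  have e : y ^ p = y ^ (p + 1 / 2) * y ^ (-(1 / 2) : ℝ) := by
    rw [← Real.rpow_add hy0]; congr 1; ring
  simp only [heatDensity, e]
  ring

lemma integrableOn_heatDensity {b p : ℝ} {A φ : ℝ → ℝ} {N : ℕ}
    (h : IntegrableOn (fun y => y ^ p * (A y * φ y) / (1 + y) ^ N) (Ioi 0)) :
    IntegrableOn (fun y => y ^ (p + 1 / 2) / (1 + y) ^ N * heatDensity b A φ y) (Ioi 0) := by
  have := integrableOn_heatDensity_mul (b := b) (p := p) (q := fun _ => 1) (A := A) (φ := φ) (N := N) (by simpa using h)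
  simpa using this

lemma kernel_of_pos {b γ v x t y : ℝ} {Φ A₁ A₂ B₁ B₂ : ℝ → ℝ} (hb : b ≠ 0) (hx : 0 < x) (ht : 0 < t) :
    kernel b γ v Φ A₁ A₂ B₁ B₂ x t y = (x / √(4 * Real.sinh (b * t) ^ 2)) ^ (1 / 2 : ℝ) *
      (A₁ y * besselI (2 * v) (|b| * y * (x / √(4 * Real.sinh (b * t) ^ 2))) +
        A₂ y * besselI (-(2 * v)) (|b| * y * (x / √(4 * Real.sinh (b * t) ^ 2)))) *
      (Real.exp (γ * t / 4) / (4 * Real.sinh (b * t) ^ 2) ^ (1 / 4 : ℝ)) *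
      Real.exp (-(b / 4 * (Real.cosh (b * t) / Real.sinh (b * t)) * x ^ 2 + 1 / 2 * Φ x)
        + y ^ 2 * b / (2 * (1 - Real.exp (2 * b * t)))) := by
  have hs : Real.sinh (b * t) ≠ 0 := Real.sinh_ne_zero.2 (mul_ne_zero hb ht.ne')
  have h0 : 0 < x / √(4 * Real.sinh (b * t) ^ 2) := by positivity
  rw [kernel, profile, if_pos h0]

/-- Written at r = -x > 0 with Φ still evaluated at x; for this reason `P` is a free parameter in
`kernel_factor_eq`. -/
lemma kernel_of_neg {b γ v x t y : ℝ} {Φ A₁ A₂ B₁ B₂ : ℝ → ℝ} (hx : x < 0) :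
    kernel b γ v Φ A₁ A₂ B₁ B₂ x t y = (-x / √(4 * Real.sinh (b * t) ^ 2)) ^ (1 / 2 : ℝ) *
      (B₁ y * besselK (2 * v) (|b| * y * (-x / √(4 * Real.sinh (b * t) ^ 2))) +
        B₂ y * besselI (2 * v) (|b| * y * (-x / √(4 * Real.sinh (b * t) ^ 2)))) *
      (Real.exp (γ * t / 4) / (4 * Real.sinh (b * t) ^ 2) ^ (1 / 4 : ℝ)) *
      Real.exp (-(b / 4 * (Real.cosh (b * t) / Real.sinh (b * t)) * (-x) ^ 2 + 1 / 2 * Φ x)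
        + y ^ 2 * b / (2 * (1 - Real.exp (2 * b * t)))) := by
  have h0 : x / √(4 * Real.sinh (b * t) ^ 2) ≤ 0 := div_nonpos_of_nonpos_of_nonneg hx.le (Real.sqrt_nonneg _)
  rw [kernel, profile, if_neg (not_lt.2 h0), abs_of_nonpos h0, ← neg_div, neg_sq]

end RiccatiFP

end

/-! ### Assembly on the two half-lines -/

theorem corollary4p1
    (β : ℝ) (hβ0 : 0 < β) (hβ1 : β ≤ 1)
    (b γ v : ℝ) (hb : b ≠ 0)
    (f : ℝ → ℝ) (hodd : ∀ x, f (-x) = -f x)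
    (hf : ∀ x, x ≠ 0 → DifferentiableAt ℝ f x)
    (hRiccati : ∀ x, x ≠ 0 →
      2 * deriv f x - f x ^ 2 + b ^ 2 * x ^ 2 - γ + (16 * v ^ 2 - 1) / x ^ 2 = 0)
    (Φ : ℝ → ℝ) (hΦ : ∀ x, x ≠ 0 → HasDerivAt Φ (f x) x)
    (A₁ A₂ B₁ B₂ φ : ℝ → ℝ)
    (hA₁ : ContDiffOn ℝ 2 A₁ (Ioi 0)) (hA₂ : ContDiffOn ℝ 2 A₂ (Ioi 0))
    (hB₁ : ContDiffOn ℝ 2 B₁ (Ioi 0)) (hB₂ : ContDiffOn ℝ 2 B₂ (Ioi 0))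
    (hφ : ContDiffOn ℝ 2 φ (Ioi 0))
    (N : ℕ)
    (hA₁φ : IntegrableOn (fun y => y ^ (2 * v) * (A₁ y * φ y) / (1 + y) ^ N) (Ioi 0))
    (hA₂φ : IntegrableOn (fun y => y ^ (-(2 * v)) * (A₂ y * φ y) / (1 + y) ^ N) (Ioi 0))
    (hB₁φ : IntegrableOn
      (fun y => y ^ (-(2 * |v|)) * (1 + |Real.log y|) * (B₁ y * φ y) / (1 + y) ^ N) (Ioi 0))
    (hB₂φ : IntegrableOn (fun y => y ^ (2 * v) * (B₂ y * φ y) / (1 + y) ^ N) (Ioi 0)) :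
    let p : ℝ → ℝ → ℝ → ℝ := RiccatiFP.kernel b γ v Φ A₁ A₂ B₁ B₂
    let u : ℝ → ℝ → ℝ := RiccatiFP.kernelIntegral b γ v Φ A₁ A₂ B₁ B₂ φ
    let uβ : ℝ → ℝ → ℝ := fun x t => RiccatiFP.wrightTransform β (fun s => u x s) t
    -- all integrals involved converge absolutely
    (∀ x t : ℝ, x ≠ 0 → 0 < t → IntegrableOn (fun y => p x t y * φ y) (Ioi 0)) ∧
    (β < 1 → ∀ x t : ℝ, x ≠ 0 → 0 < t →
      (∀ s : ℝ, Summable (fun k : ℕ => (-(s / t ^ β)) ^ k /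
        ((k.factorial : ℝ) * Real.Gamma (-β * k + (1 - β))))) ∧
      IntegrableOn (fun s => u x s * RiccatiFP.wrightDensity β s t) (Ioi 0)) ∧
    -- the transformed function solves the fractional equation
    RiccatiFP.SolvesFractionalFokkerPlanck β f uβ ∧
    -- if the constants are normalized so that the kernel starts from the point mass at `y`,
    -- then the initial value is `φ` on the positive and `0` on the negative half-line
    ((∀ y, 0 < y → A₁ y + A₂ y = |b| * √y * Real.exp (Φ y / 2 - b * y ^ 2 / 4)) →
      ∀ x, 0 < x → Tendsto (fun t => uβ x t) (𝓝[>] 0) (𝓝 (φ x))) ∧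
    ((∀ y, 0 < y → B₂ y = 0) →
      ∀ x, x < 0 → Tendsto (fun t => uβ x t) (𝓝[>] 0) (𝓝 0)) := by
  intro p u uβ
  set κ : ℝ := (2 * v) ^ 2 - 1 / 4 with hκ
  have prof₁ := RiccatiFP.besselProfile_normalI (2 * v)
  have prof₂ := RiccatiFP.besselProfile_normalI (-(2 * v))
  -- K is even in its order, so the order |2v| may be used; all three profiles share the same κ.
  have prof₃ := RiccatiFP.besselProfile_normalK (abs_nonneg (2 * v))
  rw [neg_sq, ← hκ] at prof₂
  rw [sq_abs, ← hκ] at prof₃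
  rw [← hκ] at prof₁
  have hB₁φ' := RiccatiFP.integrableOn_heatDensity_mul (b := b) hB₁φ
  have e2v : -(2 * |v|) = -|2 * v| := by rw [abs_mul, abs_of_pos (by norm_num : (0 : ℝ) < 2)]
  rw [e2v] at hB₁φ'
  obtain ⟨w₁, wx₁, wxx₁, sol₁, lim₁, int₁⟩ := RiccatiFP.exists_parabolicSolution prof₁ prof₂ hb hA₁ hA₂ hφ
    (RiccatiFP.integrableOn_heatDensity hA₁φ) (RiccatiFP.integrableOn_heatDensity hA₂φ) γ
  obtain ⟨w₂, wx₂, wxx₂, sol₂, lim₂, int₂⟩ := RiccatiFP.exists_parabolicSolution prof₃ prof₁ hb hB₁ hB₂ hφ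
    hB₁φ' (RiccatiFP.integrableOn_heatDensity hB₂φ) γ
  have pos : ∀ x t : ℝ, 0 < x → 0 < t → IntegrableOn (fun y => p x t y * φ y) (Ioi 0) ∧
      u x t = Real.exp (-(Φ x / 2)) * w₁ x t := fun x t hx ht =>
    int₁ x t (Φ x) hx ht _ _ (fun y _ => rfl) (fun y _ => rfl) _ fun y _ => RiccatiFP.kernel_of_pos hb hx ht
  have neg : ∀ x t : ℝ, x < 0 → 0 < t → IntegrableOn (fun y => p x t y * φ y) (Ioi 0) ∧
      u x t = Real.exp (-(Φ x / 2)) * w₂ (-x) t := by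
    intro x t hx ht
    have hx' : 0 < -x := neg_pos.2 hx
    have hs : Real.sinh (b * t) ≠ 0 := Real.sinh_ne_zero.2 (mul_ne_zero hb ht.ne')
    have hb' : 0 < |b| := abs_pos.2 hb
    exact int₂ (-x) t (Φ x) hx' ht _ _ (fun y hy => RiccatiFP.sqrt_mul_besselK _ (by positivity))
      (fun y _ => rfl) _ fun y _ => RiccatiFP.kernel_of_neg hx
  set V : ℝ → ℝ := fun r => γ / 4 - b ^ 2 * r ^ 2 / 4 - κ / r ^ 2 with hV
  have hVneg : ∀ x, V (-x) = V x := fun x => by simp only [hV, neg_sq]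
  -- A single w makes u = e^{-Φ/2} w an identity everywhere; on each half-line it coincides for t >
  -- 0 with the solution constructed there.
  set w : ℝ → ℝ → ℝ := fun x t => Real.exp (Φ x / 2) * u x t with hw
  have hexp : ∀ x c : ℝ, Real.exp (Φ x / 2) * (Real.exp (-(Φ x / 2)) * c) = c := fun x c => by
    rw [← mul_assoc, ← Real.exp_add, add_neg_cancel, Real.exp_zero, one_mul]
  have hu : ∀ x t, u x t = Real.exp (-(Φ x / 2)) * w x t := fun x t => by
    rw [hw, ← mul_assoc, ← Real.exp_add, neg_add_cancel, Real.exp_zero, one_mul]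
  have sp : RiccatiFP.ParabolicSolution (Ioi 0) V w wx₁ wxx₁ := sol₁.congr isOpen_Ioi fun x hx t ht => by
    rw [hw]; simp only; rw [(pos x t hx ht).2, hexp]
  have sn : RiccatiFP.ParabolicSolution (Iio 0) V w (fun x t => -wx₂ (-x) t) (fun x t => wxx₂ (-x) t) :=
    (sol₂.comp_neg hVneg).congr isOpen_Iio fun x hx t ht => by
      rw [hw]; simp only; rw [(neg x t hx ht).2, hexp]
  -- The Riccati equation enters here, with 16v² - 1 = 4κ.
  have hVf : ∀ x, x ≠ 0 → V x = deriv f x / 2 - f x ^ 2 / 4 := by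
    intro x hx
    have h1 := hRiccati x hx
    have h2 : (16 * v ^ 2 - 1) / x ^ 2 = 4 * (κ / x ^ 2) := by rw [hκ]; ring
    simp only [hV]
    linarith
  -- Differentiability of f is all that is assumed; continuity of f' follows from the Riccati
  -- equation, which expresses f' by f² and V.
  have hf' : ContinuousOn (deriv f) {0}ᶜ := by
    have hc : ContinuousOn f {0}ᶜ := fun x hx => (hf x hx).continuousAt.continuousWithinAt
    have h1 : ContinuousOn (fun x : ℝ => κ / x ^ 2) {0}ᶜ :=
      continuousOn_const.div (by fun_prop) fun x hx => pow_ne_zero 2 hx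
    have h2 : ContinuousOn V {0}ᶜ := ContinuousOn.sub (by fun_prop) h1
    refine ((h2.add ((hc.pow 2).div_const 4)).const_mul 2).congr fun x hx => ?_
    simp only [Pi.add_apply, Pi.pow_apply, hVf x hx]; ring
  have np : ∀ x ∈ Ioi (0 : ℝ), x ≠ 0 := fun x hx => ne_of_gt hx
  have nn : ∀ x ∈ Iio (0 : ℝ), x ≠ 0 := fun x hx => ne_of_lt hx
  have cases : ∀ x : ℝ, x ≠ 0 → x ∈ Ioi (0 : ℝ) ∨ x ∈ Iio (0 : ℝ) := fun x hx => hx.lt_or_gt.symm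
  refine ⟨fun x t hx ht => ?_, fun hβ x t hx ht => ⟨fun s => RiccatiFP.summable_wright hβ0 hβ _, ?_⟩,
    fun x t hx ht => ?_, fun hA x hx => ?_, fun hB x hx => ?_⟩
  · rcases cases x hx with h | h
    · exact (pos x t h ht).1
    · exact (neg x t h ht).1
  · rcases cases x hx with h | h
    · exact sp.integrableOn hβ0 hβ (fun x _ t => hu x t) h ht
    · exact sn.integrableOn hβ0 hβ (fun x _ t => hu x t) h ht
  · rcases cases x hx with h | h
    · exact sp.solves_fokkerPlanck isOpen_Ioi hβ0 hβ1 (fun x hx => hΦ x (np x hx))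
        (fun x hx => (hf x (np x hx)).hasDerivAt) (hf'.mono np) (fun x hx => hVf x (np x hx)) (fun x _ t => hu x t) h ht
    · exact sn.solves_fokkerPlanck isOpen_Iio hβ0 hβ1 (fun x hx => hΦ x (nn x hx))
        (fun x hx => (hf x (nn x hx)).hasDerivAt) (hf'.mono nn) (fun x hx => hVf x (nn x hx)) (fun x _ t => hu x t) h ht
  · refine sp.tendsto_wrightTransform hβ0 hβ1 (fun x _ t => hu x t) hx ?_
    have h1 := (lim₁ x hx).const_mul (Real.exp (-(Φ x / 2)))
    -- Both I-profiles have the limit (2π)^{-1/2}, so only A₁ + A₂ enters, and its normalization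
    -- cancels the exponentials and the factor |b|^{-1} x^{-1/2} of the density.
    have e : Real.exp (-(Φ x / 2)) * (Real.exp (b * x ^ 2 / 4) * (√(2 * π) * ((√(2 * π))⁻¹ *
        RiccatiFP.heatDensity b A₁ φ x + (√(2 * π))⁻¹ * RiccatiFP.heatDensity b A₂ φ x))) = φ x := by
      have h2 : √(2 * π) ≠ 0 := by positivity
      have h3 : Real.exp (-(Φ x / 2)) * Real.exp (b * x ^ 2 / 4) * Real.exp (Φ x / 2 - b * x ^ 2 / 4) = 1 := by
        rw [← Real.exp_add, ← Real.exp_add, ← Real.exp_zero]; congr 1; ring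
      have h4 : |b| ≠ 0 := abs_ne_zero.2 hb
      have h5 : x ^ (-(1 / 2) : ℝ) * √x = 1 := by
        rw [Real.sqrt_eq_rpow, ← Real.rpow_add hx]; norm_num
      rw [← mul_add, mul_inv_cancel_left₀ h2, RiccatiFP.heatDensity, RiccatiFP.heatDensity]
      calc _ = Real.exp (-(Φ x / 2)) * Real.exp (b * x ^ 2 / 4) * (|b|⁻¹ * x ^ (-(1 / 2) : ℝ)) *
            (A₁ x + A₂ x) * φ x := by ring
        _ = (Real.exp (-(Φ x / 2)) * Real.exp (b * x ^ 2 / 4) * Real.exp (Φ x / 2 - b * x ^ 2 / 4)) *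
            (|b|⁻¹ * |b|) * (x ^ (-(1 / 2) : ℝ) * √x) * φ x := by rw [hA x hx]; ring
        _ = φ x := by rw [h3, inv_mul_cancel₀ h4, h5]; ring
    rw [e] at h1
    refine h1.congr' ?_
    filter_upwards [self_mem_nhdsWithin] with t ht using (pos x t hx ht).2.symm
  · refine sn.tendsto_wrightTransform hβ0 hβ1 (fun x _ t => hu x t) hx ?_
    have h1 := (lim₂ (-x) (neg_pos.2 hx)).const_mul (Real.exp (-(Φ x / 2)))
    have e : RiccatiFP.heatDensity b B₂ φ (-x) = 0 := by
      rw [RiccatiFP.heatDensity, hB _ (neg_pos.2 hx)]; ring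
    -- The K-term has L = 0 and drops out, so no condition on B₁ is needed.
    rw [e, mul_zero, zero_mul, add_zero, mul_zero, mul_zero, mul_zero] at h1
    refine h1.congr' ?_
    filter_upwards [self_mem_nhdsWithin] with t ht using (neg x t hx ht).2.symm
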